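/- Let $n\in\{1,2\}$ and let $\Omega\subset\mathbb{R}^n$ be open and bounded with smooth boundary. Let $H^2(\Omega)$ be the real Sobolev space with its standard norm $\big(\sum_{|\alpha|\le 2}\|\partial^\alpha u\|_{L^2(\Omega)}^2\big)^{1/2}$ (up to the usual weighting of the mixed second derivatives), and let $H^2_o(\Omega)=H^2(\Omega)\cap H^1_0(\Omega)$ carry the same norm. There is a constant $C=C(\Omega)>0$, and for all $\beta_F,\kappa>0$ and all $M$ there is a constant $L_G=L_G(\Omega,\kappa,M,\beta_F)>0$, such that the following holds. Let $\beta_p,\theta_1,\theta_2,T>0$, let $\tilde w_0\in H^2(\Omega)$ and $w_0=\tilde w_0+\theta_2$ satisfy $\inf_\Omega w_0=\kappa$ and $\|w_0\|_{H^2(\Omega)}=M$, and let $0<r<\frac{\kappa}{2C}$. Put $$B_r(\tilde w_0)=\{\psi\in H^2(\Omega):\|\psi-\tilde w_0\|_{H^2(\Omega)}\le r\},\qquad B_r(\tilde w_0,T)=\Big\{\tilde w\in C([0,T];H^2(\Omega)):\ \sup_{t\in[0,T]}\|\tilde w(t)-\tilde w_0\|_{H^2(\Omega)}\le r\Big\}.$$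 1. For $\psi\in B_r(\tilde w_0)$ one has $\psi+\theta_2\ge\kappa/2$ a.e. in $\Omega$, the function $G(\psi)=-\frac{\beta_F}{(\psi+\theta_2)^2}+\beta_p(\theta_1-1)$ belongs to $H^2(\Omega)$, and $G'(\psi)q=\frac{2\beta_F}{(\psi+\theta_2)^3}\,q$ defines a bounded linear operator $G'(\psi):H^2_o(\Omega)\to H^2_o(\Omega)$, which is the Fréchet derivative at $q=0$ of $q\in H^2_o(\Omega)\mapsto G(\psi+q)\in H^2(\Omega)$. 2. For $\tilde w\in B_r(\tilde w_0,T)$ the function $[G(\tilde w)](t)=G(\tilde w(t))$ belongs to $C([0,T];H^2(\Omega))$, and for all $s,t\in[0,T]$ $$\|[G(\tilde w)](s)-[G(\tilde w)](t)\|_{H^2(\Omega)}\le L_G\|\tilde w(s)-\tilde w(t)\|_{H^2(\Omega)}.$$ 3. For all $\tilde w_1,\tilde w_2\in B_r(\tilde w_0,T)$, $$\sup_{t\in[0,T]}\|[G(\tilde w_1)](t)-[G(\tilde w_2)](t)\|_{H^2(\Omega)}\le L_G\sup_{t\in[0,T]}\|\tilde w_1(t)-\tilde w_2(t)\|_{H^2(\Omega)},\qquad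 \sup_{t\in[0,T]}\|[G(\tilde w_1)](t)-G(\tilde w_0)\|_{H^2(\Omega)}\le L_G\,r.$$ 4. At every $\tilde w\in B_r(\tilde w_0,T)$ the map $G$, with values in $C([0,T];H^2(\Omega))$, is Fréchet differentiable on $C([0,T];H^2(\Omega))$ (it is given by the formula of item 2 in a neighbourhood of $\tilde w$), with derivative $$[G'(\tilde w)q](t)=\frac{2\beta_F}{(\tilde w(t)+\theta_2)^3}\,q(t),\qquad \sup_{t\in[0,T]}\|[G'(\tilde w)q](t)\|_{H^2(\Omega)}\le L_G\sup_{t\in[0,T]}\|q(t)\|_{H^2(\Omega)},$$ and $G'(\tilde w)$ restricts to a bounded linear operator of $C([0,T];H^2_o(\Omega))$ into itself, given by $[G'(\tilde w)q](t)=G'(\tilde w(t))q(t)$ and satisfying the same bound. 5. For every $\tilde w\in B_r(\tilde w_0,T)$, $$\lim_{h\to0}\ \sup_{\substack{0\le t\le t+h\le T\\ 0\le\tau\le1}}\big\|G'\big(\tilde w(t)+\tau[\tilde w(t+h)-\tilde w(t)]\big)-G'(\tilde w(t))\big\|_{\mathcal{B}(H^2_o(\Omega))}=0 .$$ -/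

import Mathlib

open MeasureTheory Set Filter Topology
open scoped ContDiff ENNReal

noncomputable section

/-- `Ω` has smooth boundary: near every boundary point, `Ω` is the strict sublevel set of a smooth
function whose differential does not vanish at that point. -/
def HasSmoothBoundary {n : ℕ} (Ω : Set (EuclideanSpace ℝ (Fin n))) : Prop :=
  ∀ x₀ ∈ frontier Ω, ∃ U ∈ 𝓝 x₀, ∃ φ : EuclideanSpace ℝ (Fin n) → ℝ,
    ContDiff ℝ ∞ φ ∧ fderiv ℝ φ x₀ ≠ 0 ∧ Ω ∩ U = {x | φ x < 0} ∩ U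

/-- `φ ∈ C_c^∞(Ω)`. -/
def IsTestFunction {n : ℕ} (Ω : Set (EuclideanSpace ℝ (Fin n)))
    (φ : EuclideanSpace ℝ (Fin n) → ℝ) : Prop :=
  ContDiff ℝ ∞ φ ∧ HasCompactSupport φ ∧ tsupport φ ⊆ Ω

/-- The classical partial derivative `∂ᵢ φ`. -/
def partialDeriv {n : ℕ} (i : Fin n) (φ : EuclideanSpace ℝ (Fin n) → ℝ)
    (x : EuclideanSpace ℝ (Fin n)) : ℝ :=
  fderiv ℝ φ x (EuclideanSpace.single i 1)

/-- The real space `L²(Ω)`. -/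
abbrev L2 {n : ℕ} (Ω : Set (EuclideanSpace ℝ (Fin n))) : Type :=
  Lp ℝ 2 (volume.restrict Ω)

/-- `v` is the weak `i`-th partial derivative of `u` on `Ω`. -/
def HasWeakPartial {n : ℕ} (Ω : Set (EuclideanSpace ℝ (Fin n))) (i : Fin n) (u v : L2 Ω) : Prop :=
  ∀ φ : EuclideanSpace ℝ (Fin n) → ℝ, IsTestFunction Ω φ →
    ∫ x in Ω, u x * partialDeriv i φ x = - ∫ x in Ω, v x * φ x

theorem IsTestFunction.memLp {n : ℕ} {Ω : Set (EuclideanSpace ℝ (Fin n))}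
    {φ : EuclideanSpace ℝ (Fin n) → ℝ} (h : IsTestFunction Ω φ) :
    MemLp φ 2 (volume.restrict Ω) :=
  (h.1.continuous.memLp_of_hasCompactSupport h.2.1).restrict Ω

theorem IsTestFunction.memLp_partialDeriv {n : ℕ} {Ω : Set (EuclideanSpace ℝ (Fin n))}
    {φ : EuclideanSpace ℝ (Fin n) → ℝ} (h : IsTestFunction Ω φ) (i : Fin n) :
    MemLp (partialDeriv i φ) 2 (volume.restrict Ω) := by
  have hc : Continuous (partialDeriv i φ) :=
    (h.1.continuous_fderiv (by simp)).clm_apply continuous_const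
  have hs : HasCompactSupport (partialDeriv i φ) := h.2.1.fderiv_apply (𝕜 := ℝ) _
  exact (hc.memLp_of_hasCompactSupport hs).restrict Ω

theorem integrable_L2_mul {n : ℕ} {Ω : Set (EuclideanSpace ℝ (Fin n))} (u : L2 Ω)
    {φ : EuclideanSpace ℝ (Fin n) → ℝ} (h : MemLp φ 2 (volume.restrict Ω)) :
    Integrable (fun x => u x * φ x) (volume.restrict Ω) :=
  (Lp.memLp u).integrable_mul h

theorem integral_L2_add_mul {n : ℕ} {Ω : Set (EuclideanSpace ℝ (Fin n))} (u v : L2 Ω)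
    {φ : EuclideanSpace ℝ (Fin n) → ℝ} (h : MemLp φ 2 (volume.restrict Ω)) :
    ∫ x in Ω, (u + v : L2 Ω) x * φ x = (∫ x in Ω, u x * φ x) + ∫ x in Ω, v x * φ x := by
  rw [← integral_add (integrable_L2_mul u h) (integrable_L2_mul v h)]
  refine integral_congr_ae ?_
  filter_upwards [Lp.coeFn_add u v] with x hx
  rw [hx, Pi.add_apply, add_mul]

theorem integral_L2_smul_mul {n : ℕ} {Ω : Set (EuclideanSpace ℝ (Fin n))} (c : ℝ) (u : L2 Ω)
    (φ : EuclideanSpace ℝ (Fin n) → ℝ) :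
    ∫ x in Ω, (c • u : L2 Ω) x * φ x = c * ∫ x in Ω, u x * φ x := by
  rw [← integral_const_mul]
  refine integral_congr_ae ?_
  filter_upwards [Lp.coeFn_smul c u] with x hx
  rw [hx, Pi.smul_apply, smul_eq_mul, mul_assoc]

theorem HasWeakPartial.add {n : ℕ} {Ω : Set (EuclideanSpace ℝ (Fin n))} {i : Fin n}
    {u v u' v' : L2 Ω} (h : HasWeakPartial Ω i u v) (h' : HasWeakPartial Ω i u' v') :
    HasWeakPartial Ω i (u + u') (v + v') := by
  intro φ hφ
  rw [integral_L2_add_mul _ _ (hφ.memLp_partialDeriv i), integral_L2_add_mul _ _ hφ.memLp,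
    h φ hφ, h' φ hφ]
  ring

theorem HasWeakPartial.smul {n : ℕ} {Ω : Set (EuclideanSpace ℝ (Fin n))} {i : Fin n}
    {u v : L2 Ω} (c : ℝ) (h : HasWeakPartial Ω i u v) :
    HasWeakPartial Ω i (c • u) (c • v) := by
  intro φ hφ
  rw [integral_L2_smul_mul, integral_L2_smul_mul, h φ hφ]
  ring

theorem HasWeakPartial.zero {n : ℕ} (Ω : Set (EuclideanSpace ℝ (Fin n))) (i : Fin n) :
    HasWeakPartial Ω i 0 0 := by
  intro φ _
  have e : ∀ ψ : EuclideanSpace ℝ (Fin n) → ℝ, ∫ x in Ω, (0 : L2 Ω) x * ψ x = 0 := fun ψ => by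
    simpa only [zero_smul, zero_mul] using integral_L2_smul_mul (Ω := Ω) 0 0 ψ
  rw [e, e, neg_zero]

/-- Weak derivatives are unique. -/
theorem HasWeakPartial.unique {n : ℕ} {Ω : Set (EuclideanSpace ℝ (Fin n))} (hΩ : IsOpen Ω)
    {i : Fin n} {u v v' : L2 Ω} (h : HasWeakPartial Ω i u v) (h' : HasWeakPartial Ω i u v') :
    v = v' := by
  have hloc : LocallyIntegrableOn (fun x => v x - v' x) Ω volume := by
    have hm : MemLp (fun x => v x - v' x) 2 (volume.restrict Ω) := (Lp.memLp v).sub (Lp.memLp v')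
    exact locallyIntegrableOn_of_locallyIntegrable_restrict
      (hm.locallyIntegrable (by norm_num))
  have key : ∀ᵐ x ∂volume, x ∈ Ω → v x - v' x = 0 := by
    refine hΩ.ae_eq_zero_of_integral_contDiff_smul_eq_zero hloc ?_
    intro g hg hgc hgs
    have ht : IsTestFunction Ω g := ⟨hg, hgc, hgs⟩
    have e : ∫ x in Ω, v x * g x = ∫ x in Ω, v' x * g x :=
      neg_injective ((h g ht).symm.trans (h' g ht))
    have hz : ∫ x in Ω, g x • (v x - v' x) = 0 := by
      have : ∀ x, g x • (v x - v' x) = v x * g x - v' x * g x := fun x => by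
        rw [smul_eq_mul]; ring
      simp_rw [this]
      rw [integral_sub (integrable_L2_mul v ht.memLp) (integrable_L2_mul v' ht.memLp), e, sub_self]
    rw [← hz]
    refine (setIntegral_eq_integral_of_forall_compl_eq_zero fun x hx => ?_).symm
    rw [image_eq_zero_of_notMem_tsupport fun hx' => hx (hgs hx'), zero_smul]
  refine Lp.ext ?_
  filter_upwards [(ae_restrict_iff' hΩ.measurableSet).2 key] with x hx
  linarith

/-- The Sobolev space `H¹(Ω)`: a function (index `none`) together with its weak first partial
derivatives (indices `some i`), all in `L²(Ω)`, with the norm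
`(‖u‖² + ∑ᵢ ‖∂ᵢu‖²)^(1/2)`. -/
def H1 {n : ℕ} (Ω : Set (EuclideanSpace ℝ (Fin n))) :
    Submodule ℝ (PiLp 2 (fun _ : Option (Fin n) => L2 Ω)) where
  carrier := {U | ∀ i, HasWeakPartial Ω i (U none) (U (some i))}
  add_mem' hU hV i := (hU i).add (hV i)
  zero_mem' i := HasWeakPartial.zero Ω i
  smul_mem' c _ hU i := (hU i).smul c

/-- The Sobolev space `H²(Ω)`: a function `u` (index `none`) together with its weak first partial
derivatives `∂ᵢu` (indices `some (inl i)`) and second partial derivatives `∂ⱼ∂ᵢu`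
(indices `some (inr (i, j))`), all in `L²(Ω)`, with the norm
`(‖u‖² + ∑ᵢ ‖∂ᵢu‖² + ∑ᵢⱼ ‖∂ⱼ∂ᵢu‖²)^(1/2)`. The derivatives are determined by `u`
(see `H2_ext`). -/
def H2 {n : ℕ} (Ω : Set (EuclideanSpace ℝ (Fin n))) :
    Submodule ℝ (PiLp 2 (fun _ : Option (Fin n ⊕ Fin n × Fin n) => L2 Ω)) where
  carrier := {U | (∀ i, HasWeakPartial Ω i (U none) (U (some (Sum.inl i)))) ∧
    ∀ i j, HasWeakPartial Ω j (U (some (Sum.inl i))) (U (some (Sum.inr (i, j))))}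
  add_mem' hU hV := ⟨fun i => (hU.1 i).add (hV.1 i), fun i j => (hU.2 i j).add (hV.2 i j)⟩
  zero_mem' := ⟨fun i => HasWeakPartial.zero Ω i, fun _ j => HasWeakPartial.zero Ω j⟩
  smul_mem' c _ hU := ⟨fun i => (hU.1 i).smul c, fun i j => (hU.2 i j).smul c⟩

/-- The function underlying an element of `H²(Ω)` (a representative of its a.e. class). -/
def H2.fn {n : ℕ} {Ω : Set (EuclideanSpace ℝ (Fin n))} (U : H2 Ω) :
    EuclideanSpace ℝ (Fin n) → ℝ :=
  ((U : PiLp 2 (fun _ : Option (Fin n ⊕ Fin n × Fin n) => L2 Ω)) none : L2 Ω)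

/-- An element of `H²(Ω)` is determined by its underlying function, up to a.e. equality. -/
theorem H2_ext {n : ℕ} {Ω : Set (EuclideanSpace ℝ (Fin n))} (hΩ : IsOpen Ω) {U V : H2 Ω}
    (h : H2.fn U =ᵐ[volume.restrict Ω] H2.fn V) : U = V := by
  obtain ⟨U, hU1, hU2⟩ := U
  obtain ⟨V, hV1, hV2⟩ := V
  have h0 : U none = V none := Lp.ext h
  have h1 : ∀ i, U (some (Sum.inl i)) = V (some (Sum.inl i)) := fun i =>
    (hU1 i).unique hΩ (h0 ▸ hV1 i)
  have h2 : ∀ i j, U (some (Sum.inr (i, j))) = V (some (Sum.inr (i, j))) := fun i j =>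
    (hU2 i j).unique hΩ (h1 i ▸ hV2 i j)
  refine Subtype.ext (PiLp.ext ?_)
  rintro (_ | i | ⟨i, j⟩)
  exacts [h0, h1 i, h2 i j]

/-- `H¹₀(Ω)`: the closure of `C_c^∞(Ω)` in `H¹(Ω)`. -/
def H10 {n : ℕ} (Ω : Set (EuclideanSpace ℝ (Fin n))) : Submodule ℝ (H1 Ω) :=
  (Submodule.span ℝ {U : H1 Ω | ∃ φ : EuclideanSpace ℝ (Fin n) → ℝ, IsTestFunction Ω φ ∧
    U.1 none =ᵐ[volume.restrict Ω] φ ∧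
    ∀ i, U.1 (some i) =ᵐ[volume.restrict Ω] partialDeriv i φ}).topologicalClosure

/-- The inclusion `H²(Ω) → H¹(Ω)`. -/
def H2.toH1 {n : ℕ} (Ω : Set (EuclideanSpace ℝ (Fin n))) : H2 Ω →ₗ[ℝ] H1 Ω where
  toFun U := ⟨WithLp.toLp 2 fun a => U.1 (a.map Sum.inl), fun i => U.2.1 i⟩
  map_add' _ _ := rfl
  map_smul' _ _ := rfl

/-- `H²ₒ(Ω) = H²(Ω) ∩ H¹₀(Ω)`, with the norm of `H²(Ω)`. -/
def Ho2 {n : ℕ} (Ω : Set (EuclideanSpace ℝ (Fin n))) : Submodule ℝ (H2 Ω) :=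
  (H10 Ω).comap (H2.toH1 Ω)

/-- The superposition `u ↦ f ∘ u` in `H²(Ω)`, with value `0` if `f ∘ u` is not in `H²(Ω)`. -/
def superposition {n : ℕ} (Ω : Set (EuclideanSpace ℝ (Fin n))) (f : ℝ → ℝ) (u : H2 Ω) : H2 Ω :=
  open scoped Classical in
  if h : ∃ v : H2 Ω, H2.fn v =ᵐ[volume.restrict Ω] fun x => f (H2.fn u x) then h.choose else 0

/-- `G(ψ) = -β_F / (ψ + θ₂)² + β_p (θ₁ - 1)` for `ψ ∈ H²(Ω)`. -/
def gapForce {n : ℕ} (Ω : Set (EuclideanSpace ℝ (Fin n))) (βF βp θ₁ θ₂ : ℝ) : H2 Ω → H2 Ω :=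
  superposition Ω fun s => -βF / (s + θ₂) ^ 2 + βp * (θ₁ - 1)

/-- The operator `w ↦ (t ↦ F (w t))` on continuous paths, with value `0` if that path is not
continuous. -/
def pathLift {X : Type} [TopologicalSpace X] [Zero X] (T : ℝ) (F : X → X)
    (w : C(Icc (0 : ℝ) T, X)) : C(Icc (0 : ℝ) T, X) :=
  open scoped Classical in
  if h : Continuous fun t => F (w t) then ⟨fun t => F (w t), h⟩ else 0

/-- The operator `G` on paths, `[G(w)](t) = G(w(t))`. -/
def pathGapForce {n : ℕ} (Ω : Set (EuclideanSpace ℝ (Fin n))) (T βF βp θ₁ θ₂ : ℝ) :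
    C(Icc (0 : ℝ) T, H2 Ω) → C(Icc (0 : ℝ) T, H2 Ω) :=
  pathLift T (gapForce Ω βF βp θ₁ θ₂)

/-- Multiplication by `m` as a bounded operator on `H²ₒ(Ω)`, with value `0` if multiplication by
`m` is not such an operator. -/
def mulOperator {n : ℕ} (Ω : Set (EuclideanSpace ℝ (Fin n)))
    (m : EuclideanSpace ℝ (Fin n) → ℝ) : Ho2 Ω →L[ℝ] Ho2 Ω :=
  open scoped Classical in
  if h : ∃ A : Ho2 Ω →L[ℝ] Ho2 Ω, ∀ q : Ho2 Ω,
      H2.fn (A q : H2 Ω) =ᵐ[volume.restrict Ω] fun x => m x * H2.fn (q : H2 Ω) x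
  then h.choose else 0

/-- `G'(ψ)`, multiplication by `2β_F / (ψ + θ₂)³` on `H²ₒ(Ω)`. -/
def gapForceDeriv {n : ℕ} (Ω : Set (EuclideanSpace ℝ (Fin n))) (βF θ₂ : ℝ) (ψ : H2 Ω) :
    Ho2 Ω →L[ℝ] Ho2 Ω :=
  mulOperator Ω fun x => 2 * βF / (H2.fn ψ x + θ₂) ^ 3

/-- The inclusion `C([0,T]; H²ₒ(Ω)) → C([0,T]; H²(Ω))`. -/
def pathIncl {n : ℕ} (Ω : Set (EuclideanSpace ℝ (Fin n))) (T : ℝ) :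
    C(Icc (0 : ℝ) T, Ho2 Ω) →L[ℝ] C(Icc (0 : ℝ) T, H2 Ω) :=
  (Ho2 Ω).subtypeL.compLeftContinuous ℝ (Icc (0 : ℝ) T)

/-- The closed ball `B_r(w₀, T)` in `C([0,T]; H²(Ω))` around the constant path `w₀`. -/
def pathBall {n : ℕ} (Ω : Set (EuclideanSpace ℝ (Fin n))) (T : ℝ) (w₀ : H2 Ω) (r : ℝ) :
    Set (C(Icc (0 : ℝ) T, H2 Ω)) :=
  {w | ∀ t, ‖w t - w₀‖ ≤ r}

end

/-! In dimension one or two, `H²(Ω)` embeds in `L^∞(Ω)` and is closed under multiplication, with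
`‖uv‖ ≤ K‖u‖‖v‖`. A function in `H²(Ω)` that is bounded below by a positive constant has its
reciprocal in `H²(Ω)`, with norm controlled by the lower bound and by the norm of the function. On
the ball the gap `ψ + θ₂` stays above `κ / 2`, since a perturbation of norm at most `r` has size at
most `C r < κ / 2` almost everywhere.

With `a = 1 / (ψ₁ + θ₂)` and `b = 1 / (ψ₂ + θ₂)` one has `a - b = -ab(ψ₁ - ψ₂)`. The differences of
`G` and of `G'`, and the Taylor remainder of `G`, are therefore polynomials in `a`, `b` and the
increment, with respectively one, one and two factors of the increment. The product inequality turns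
these identities into Lipschitz bounds and a quadratic remainder bound (`exists_gapForce_bounds`).
All constants are uniform over the ball, so the statements on paths follow pointwise in time.

The embeddings are proved by hand. Near each point of its closure the domain is stable under short
translations in suitable directions, so a weakly differentiable function is bounded a.e. by
integrals of itself and its derivative along a segment inside `Ω`
(`HasWeakDirDeriv.ae_enorm_le_lintegral`). In dimension one this is already the sup bound. In
dimension two, iterating along two independent directions gives `H² ⊂ L^∞`, and multiplying the
bounds for `V²` along the two directions gives `H¹ ⊂ L⁴`, which handles the terms `∂ᵢu ∂ⱼv` in
second derivatives of products and reciprocals.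

Weak product and reciprocal rules come from mollification, which commutes with weak derivatives away
from the boundary. The same device shows that multiplication by `U ∈ H²` preserves `H¹₀`: for a test
function `φ` the functions `U_k φ`, with `U_k` mollified, are test functions converging to `Uφ` in
`H¹`, and density does the rest. -/

/-- Euclidean space `ℝⁿ`. -/
abbrev Euc (n : ℕ) : Type := EuclideanSpace ℝ (Fin n)

/-! ### Mollification and its convergence in `Lᵖ` -/

section Mollifier

variable {n : ℕ}

/-- A smooth bump supported in the ball of radius `1 / (k + 1)`. -/
noncomputable def shrinkingBump (n k : ℕ) : ContDiffBump (0 : Euc n) where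
  rIn := 1 / (2 * (k + 1))
  rOut := 1 / (k + 1)
  rIn_pos := by positivity
  rIn_lt_rOut := by
    apply one_div_lt_one_div_of_lt <;> [positivity; linarith [(k.cast_nonneg : (0 : ℝ) ≤ k)]]

/-- The mollification kernel with support in the ball of radius `1 / (k + 1)`. -/
noncomputable def mollKernel (n k : ℕ) : Euc n → ℝ := (shrinkingBump n k).normed volume

/-- The mollification of `f` at scale `1 / (k + 1)`. -/
noncomputable def mollify (k : ℕ) (f : Euc n → ℝ) : Euc n → ℝ :=
  convolution (mollKernel n k) f (ContinuousLinearMap.lsmul ℝ ℝ) volume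

theorem mollKernel_nonneg (k : ℕ) (x : Euc n) : 0 ≤ mollKernel n k x :=
  (shrinkingBump n k).nonneg_normed x

theorem contDiff_mollKernel (k : ℕ) : ContDiff ℝ ∞ (mollKernel n k) :=
  (shrinkingBump n k).contDiff_normed

theorem hasCompactSupport_mollKernel (k : ℕ) : HasCompactSupport (mollKernel n k) :=
  (shrinkingBump n k).hasCompactSupport_normed

theorem integrable_mollKernel (k : ℕ) : Integrable (mollKernel n k) :=
  (contDiff_mollKernel k).continuous.integrable_of_hasCompactSupport
    (hasCompactSupport_mollKernel k)

theorem integral_mollKernel (k : ℕ) : ∫ x, mollKernel n k x = 1 :=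
  (shrinkingBump n k).integral_normed

theorem support_mollKernel (k : ℕ) :
    Function.support (mollKernel n k) = Metric.ball 0 (1 / (k + 1)) :=
  (shrinkingBump n k).support_normed_eq

theorem mollKernel_eq_zero {k : ℕ} {x : Euc n} (h : 1 / ((k : ℝ) + 1) ≤ ‖x‖) :
    mollKernel n k x = 0 := by
  by_contra hx
  have := (support_mollKernel (n := n) k).subset hx
  rw [mem_ball_zero_iff] at this
  linarith

theorem mollify_apply (k : ℕ) (f : Euc n → ℝ) (x : Euc n) :
    mollify k f x = ∫ t, mollKernel n k t * f (x - t) := by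
  simp only [mollify, convolution_lsmul, smul_eq_mul]

theorem mollify_apply_swap (k : ℕ) (f : Euc n → ℝ) (x : Euc n) :
    mollify k f x = ∫ t, mollKernel n k (x - t) * f t := by
  simp only [mollify, convolution_eq_swap, ContinuousLinearMap.lsmul_apply, smul_eq_mul]

theorem mollify_congr (k : ℕ) {f g : Euc n → ℝ} (h : f =ᵐ[volume] g) :
    mollify k f = mollify k g := by
  ext x
  rw [mollify_apply_swap, mollify_apply_swap]
  refine integral_congr_ae ?_
  filter_upwards [h] with t ht
  rw [ht]

theorem mollify_nonneg (k : ℕ) {f : Euc n → ℝ} (h : ∀ᵐ x, 0 ≤ f x) (x : Euc n) :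
    0 ≤ mollify k f x := by
  rw [mollify_apply_swap]
  refine integral_nonneg_of_ae ?_
  filter_upwards [h] with t ht
  exact mul_nonneg (mollKernel_nonneg _ _) ht

theorem contDiff_mollify (k : ℕ) {f : Euc n → ℝ} (hf : LocallyIntegrable f) :
    ContDiff ℝ ∞ (mollify k f) :=
  (hasCompactSupport_mollKernel k).contDiff_convolution_left _ (contDiff_mollKernel k) hf

theorem integrable_mollKernel_mul (k : ℕ) {f : Euc n → ℝ} (hf : LocallyIntegrable f) (x : Euc n) :
    Integrable fun t => mollKernel n k t * f (x - t) :=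
  (hasCompactSupport_mollKernel k).convolutionExists_left (ContinuousLinearMap.lsmul ℝ ℝ)
    (contDiff_mollKernel k).continuous hf x

/-- The derivative falls on the smooth kernel, so local integrability of `f` suffices. The
translated kernel can then be used as a test function. -/
theorem fderiv_mollify (k : ℕ) {f : Euc n → ℝ} (hf : LocallyIntegrable f) (x e : Euc n) :
    fderiv ℝ (mollify k f) x e = ∫ t, fderiv ℝ (mollKernel n k) (x - t) e * f t := by
  have hc1 : ContDiff ℝ 1 (mollKernel n k) := (contDiff_mollKernel k).of_le (by norm_cast)
  have h := (hasCompactSupport_mollKernel k).hasFDerivAt_convolution_left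
    (ContinuousLinearMap.lsmul ℝ ℝ) hc1 hf x
  have h' : HasFDerivAt (mollify k f) _ x := h
  have hint := ((hasCompactSupport_mollKernel (n := n) k).fderiv
      (𝕜 := ℝ)).convolutionExists_left
      (ContinuousLinearMap.precompL (Euc n) (ContinuousLinearMap.lsmul ℝ ℝ))
      (hc1.continuous_fderiv (by simp)) hf x
  rw [h'.fderiv, convolution_eq_swap, ContinuousLinearMap.integral_apply hint.integrable_swap]
  refine integral_congr_ae (Eventually.of_forall fun t => ?_)
  simp [ContinuousLinearMap.precompL_apply]

/-- The probability measure with density the mollification kernel. -/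
noncomputable def mollMeasure (n k : ℕ) : Measure (Euc n) :=
  volume.withDensity fun x => ENNReal.ofReal (mollKernel n k x)

theorem measurable_mollKernel (k : ℕ) : Measurable (mollKernel n k) :=
  (contDiff_mollKernel k).continuous.measurable

instance (k : ℕ) : IsProbabilityMeasure (mollMeasure n k) := by
  constructor
  rw [mollMeasure, withDensity_apply _ MeasurableSet.univ, setLIntegral_univ,
    ← ofReal_integral_eq_lintegral_ofReal (integrable_mollKernel k)
      (Eventually.of_forall (mollKernel_nonneg k)), integral_mollKernel, ENNReal.ofReal_one]

theorem ae_mollMeasure_norm_lt (k : ℕ) : ∀ᵐ t ∂mollMeasure n k, ‖t‖ < 1 / ((k : ℝ) + 1) := by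
  rw [mollMeasure, ae_withDensity_iff (measurable_mollKernel k).ennreal_ofReal]
  refine Eventually.of_forall fun t ht => ?_
  by_contra h
  exact ht (by rw [mollKernel_eq_zero (not_lt.1 h), ENNReal.ofReal_zero])

/-- The kernel has mass one, so the mollification error is an average of translation differences. -/
theorem enorm_mollify_sub_le (k : ℕ) {f : Euc n → ℝ} (hf : LocallyIntegrable f) (x : Euc n) :
    ‖mollify k f x - f x‖ₑ ≤ ∫⁻ t, ‖f (x - t) - f x‖ₑ ∂mollMeasure n k := by
  have e : mollify k f x - f x = ∫ t, mollKernel n k t * (f (x - t) - f x) := by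
    simp_rw [mul_sub]
    rw [integral_sub (integrable_mollKernel_mul k hf x) ((integrable_mollKernel k).mul_const _),
      integral_mul_const, integral_mollKernel, one_mul, mollify_apply]
  rw [e, mollMeasure, lintegral_withDensity_eq_lintegral_mul_non_measurable _
    (measurable_mollKernel k).ennreal_ofReal (Eventually.of_forall fun _ => ENNReal.ofReal_lt_top)]
  refine (enorm_integral_le_lintegral_enorm _).trans (lintegral_mono fun t => ?_)
  rw [Pi.mul_apply, enorm_mul, Real.enorm_of_nonneg (mollKernel_nonneg k t)]

/-- Jensen's inequality for the probability measure `mollMeasure`, in the form that `Lᵖ` norms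
increase with the exponent. -/
theorem enorm_mollify_sub_rpow_le (k : ℕ) {f : Euc n → ℝ} (hf : LocallyIntegrable f)
    (hm : Measurable f) {p : ℝ} (hp : 1 ≤ p) (x : Euc n) :
    ‖mollify k f x - f x‖ₑ ^ p ≤ ∫⁻ t, ‖f (x - t) - f x‖ₑ ^ p ∂mollMeasure n k := by
  have hp0 : 0 < p := by linarith
  have h := eLpNorm'_le_eLpNorm'_of_exponent_le (f := fun t => f (x - t) - f x) one_pos hp
    (mollMeasure n k) ((hm.comp (measurable_const.sub measurable_id)).sub_const
      _).aestronglyMeasurable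
  simp only [eLpNorm', ENNReal.rpow_one, one_div, inv_one] at h
  calc _ ≤ _ := ENNReal.rpow_le_rpow ((enorm_mollify_sub_le k hf x).trans h) hp0.le
    _ = _ := by rw [← ENNReal.rpow_mul, inv_mul_cancel₀ hp0.ne', ENNReal.rpow_one]

/-- Translations are a continuous family of measure preserving maps, and composition with such a
family is continuous in `Lᵖ` for finite `p`. -/
theorem tendsto_eLpNorm_translate_sub {p : ℝ≥0∞} (hp1 : 1 ≤ p) (hp : p ≠ ⊤) {f : Euc n → ℝ}
    (hf : MemLp f p) :
    Tendsto (fun t : Euc n => eLpNorm (fun x => f (x - t) - f x) p) (𝓝 0) (𝓝 0) := by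
  have : Fact (1 ≤ p) := ⟨hp1⟩
  let g : Euc n → C(Euc n, Euc n) := fun t => ⟨fun x => x - t, by fun_prop⟩
  have hg : Continuous g := by
    apply ContinuousMap.continuous_of_continuous_uncurry
    exact continuous_snd.sub continuous_fst
  have hgm : ∀ t, MeasurePreserving (g t) (volume : Measure (Euc n)) volume := fun t =>
    measurePreserving_sub_right volume t
  have h := (continuous_const (y := hf.toLp f)).compMeasurePreservingLp hg hgm hp
  have h0 := (tendsto_iff_edist_tendsto_0.1 (h.tendsto 0))
  refine h0.congr fun t => ?_
  rw [Lp.edist_def]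
  refine eLpNorm_congr_ae ?_
  filter_upwards [Lp.coeFn_compMeasurePreserving (hf.toLp f) (hgm t),
    Lp.coeFn_compMeasurePreserving (hf.toLp f) (hgm 0), hf.coeFn_toLp,
    (hgm t).quasiMeasurePreserving.ae hf.coeFn_toLp] with x h1 h2 h3 h4
  simp only [Pi.sub_apply, h1, h2, Function.comp_apply]
  simp only [g, ContinuousMap.coe_mk, sub_zero] at h4 ⊢
  rw [h3, h4]

/-- By Jensen and Tonelli, the `p`-th power of the error norm is at most an average over `t` of
those of the translation differences. Only `t` with `‖t‖ < 1 / (k + 1)` carry mass. -/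
theorem eLpNorm_mollify_sub_le (k : ℕ) {p : ℝ≥0∞} (hp1 : 1 ≤ p) (hp : p ≠ ⊤) {f : Euc n → ℝ}
    (hf : MemLp f p) (hm : Measurable f) {c : ℝ≥0∞}
    (hc : ∀ t : Euc n, ‖t‖ < 1 / ((k : ℝ) + 1) → eLpNorm (fun x => f (x - t) - f x) p ≤ c) :
    eLpNorm (fun x => mollify k f x - f x) p ≤ c := by
  have hp0 : p ≠ 0 := (zero_lt_one.trans_le hp1).ne'
  have hq1 : 1 ≤ p.toReal := by
    rw [← ENNReal.toReal_one]; exact (ENNReal.toReal_le_toReal (by simp) hp).2 hp1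
  have hq : 0 < p.toReal := by linarith
  rw [← ENNReal.rpow_le_rpow_iff hq, eLpNorm_eq_lintegral_rpow_enorm_toReal hp0 hp,
    ← ENNReal.rpow_mul, one_div, inv_mul_cancel₀ hq.ne', ENNReal.rpow_one]
  calc ∫⁻ x, ‖mollify k f x - f x‖ₑ ^ p.toReal
      ≤ ∫⁻ x, (∫⁻ t, ‖f (x - t) - f x‖ₑ ^ p.toReal ∂mollMeasure n k) :=
        lintegral_mono fun x => enorm_mollify_sub_rpow_le k (hf.locallyIntegrable hp1) hm hq1 x
    _ = ∫⁻ t, (∫⁻ x, ‖f (x - t) - f x‖ₑ ^ p.toReal) ∂mollMeasure n k := by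
        refine lintegral_lintegral_swap (Measurable.aemeasurable ?_)
        exact ((((hm.comp (measurable_fst.sub measurable_snd)).sub
          (hm.comp measurable_fst))).enorm).pow_const _
    _ ≤ ∫⁻ t, c ^ p.toReal ∂mollMeasure n k := by
        refine lintegral_mono_ae ?_
        filter_upwards [ae_mollMeasure_norm_lt k] with t ht
        have := ENNReal.rpow_le_rpow (hc t ht) hq.le
        rwa [eLpNorm_eq_lintegral_rpow_enorm_toReal hp0 hp, ← ENNReal.rpow_mul, one_div,
          inv_mul_cancel₀ hq.ne', ENNReal.rpow_one] at this
    _ = c ^ p.toReal := by simp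

/-- Mollifications converge in `Lᵖ`. -/
theorem tendsto_eLpNorm_mollify_sub {p : ℝ≥0∞} (hp1 : 1 ≤ p) (hp : p ≠ ⊤) {f : Euc n → ℝ}
    (hf : MemLp f p) :
    Tendsto (fun k => eLpNorm (fun x => mollify k f x - f x) p) atTop (𝓝 0) := by
  -- Tonelli is applied to a measurable representative; the mollification depends only on the a.e.
  -- class.
  wlog hm : Measurable f generalizing f
  · have hfm := hf.1.aemeasurable
    have h := this (f := hfm.mk f) (hf.ae_eq hfm.ae_eq_mk) hfm.measurable_mk
    refine h.congr fun k => eLpNorm_congr_ae ?_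
    filter_upwards [hfm.ae_eq_mk] with x hx
    rw [mollify_congr k hfm.ae_eq_mk, hx]
  rw [ENNReal.tendsto_atTop_zero]
  intro ε hε
  have h := (ENNReal.tendsto_nhds_zero.1 (tendsto_eLpNorm_translate_sub hp1 hp hf)) ε hε
  obtain ⟨δ, hδ, hδ'⟩ := Metric.eventually_nhds_iff.1 h
  obtain ⟨N, hN⟩ := exists_nat_one_div_lt hδ
  refine ⟨N, fun k hk => eLpNorm_mollify_sub_le k hp1 hp hf hm fun t ht => hδ' ?_⟩
  rw [dist_zero_right]
  refine ht.trans_le (le_trans ?_ hN.le)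
  exact one_div_le_one_div_of_le (by positivity) (by exact_mod_cast Nat.succ_le_succ hk)

end Mollifier

/-! ### Hölder estimates and continuity of the `L²` pairing -/

section Lp

variable {α : Type*} {mα : MeasurableSpace α} {μ : Measure α}

theorem eLpNorm_mul_le_of_holderTriple {p q r : ℝ≥0∞} [p.HolderTriple q r] {f g : α → ℝ}
    (hf : AEStronglyMeasurable f μ) (hg : AEStronglyMeasurable g μ) :
    eLpNorm (fun x => f x * g x) r μ ≤ eLpNorm f p μ * eLpNorm g q μ := by
  have e : (fun x => f x * g x) = f • g := by ext; simp
  rw [e]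
  exact eLpNorm_smul_le_mul_eLpNorm hg hf

theorem eLpNorm_one_mul_le {f g : α → ℝ} (hf : AEStronglyMeasurable f μ)
    (hg : AEStronglyMeasurable g μ) : eLpNorm (f * g) 1 μ ≤ eLpNorm f 2 μ * eLpNorm g 2 μ :=
  eLpNorm_mul_le_of_holderTriple hf hg

theorem MeasureTheory.MemLp.integrable_fun_mul {f g : α → ℝ} (hf : MemLp f 2 μ) (hg : MemLp g 2 μ) :
    Integrable (fun x => f x * g x) μ :=
  hf.integrable_mul hg

/-- The `L²` pairing is sequentially continuous. -/
theorem tendsto_integral_mul_of_tendsto_eLpNorm {F G : ℕ → α → ℝ} {f g : α → ℝ}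
    (hf : MemLp f 2 μ) (hg : MemLp g 2 μ)
    (hFm : ∀ k, AEStronglyMeasurable (F k) μ) (hGm : ∀ k, AEStronglyMeasurable (G k) μ)
    (hF : Tendsto (fun k => eLpNorm (F k - f) 2 μ) atTop (𝓝 0))
    (hG : Tendsto (fun k => eLpNorm (G k - g) 2 μ) atTop (𝓝 0)) :
    Tendsto (fun k => ∫ x, F k x * G k x ∂μ) atTop (𝓝 (∫ x, f x * g x ∂μ)) := by
  have hmem : ∀ {H : ℕ → α → ℝ} {h : α → ℝ}, MemLp h 2 μ → (∀ k, AEStronglyMeasurable (H k) μ) →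
      Tendsto (fun k => eLpNorm (H k - h) 2 μ) atTop (𝓝 0) → ∀ᶠ k in atTop, MemLp (H k) 2 μ := by
    intro H h hh hm ht
    filter_upwards [ht.eventually (gt_mem_nhds ENNReal.zero_lt_top)] with k hk
    have : MemLp (H k - h) 2 μ := ⟨(hm k).sub hh.1, hk⟩
    simpa using this.add hh
  refine tendsto_integral_of_L1' (F := fun k => F k * G k) (fun x => f x * g x)
    (hf.1.mul hg.1) ?_ ?_
  · filter_upwards [hmem hf hFm hF, hmem hg hGm hG] with k h1 h2 using h1.integrable_mul h2
  have hlim : Tendsto (fun k => eLpNorm (F k - f) 2 μ * eLpNorm (G k - g) 2 μ +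
      eLpNorm f 2 μ * eLpNorm (G k - g) 2 μ + eLpNorm (F k - f) 2 μ * eLpNorm g 2 μ)
      atTop (𝓝 (0 * 0 + eLpNorm f 2 μ * 0 + 0 * eLpNorm g 2 μ)) :=
    ((ENNReal.Tendsto.mul hF (by simp) hG (by simp)).add
      (ENNReal.Tendsto.const_mul hG (Or.inr hf.2.ne))).add
      (ENNReal.Tendsto.mul_const hF (Or.inr hg.2.ne))
  simp only [mul_zero, zero_mul, add_zero] at hlim
  refine tendsto_of_tendsto_of_tendsto_of_le_of_le tendsto_const_nhds hlim (fun _ => zero_le)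
    fun k => ?_
  -- Expanded around the limits, every term contains a factor tending to zero in `L²`.
  have e : (F k * G k - fun x => f x * g x) =
      (F k - f) * (G k - g) + f * (G k - g) + (F k - f) * g := by
    ext x; simp only [Pi.sub_apply, Pi.mul_apply, Pi.add_apply]; ring
  dsimp only
  rw [e]
  have m1 := (hFm k).sub hf.1
  have m2 := (hGm k).sub hg.1
  refine (eLpNorm_add_le ((m1.mul m2).add (hf.1.mul m2)) (m1.mul hg.1) le_rfl).trans ?_
  refine add_le_add ((eLpNorm_add_le (m1.mul m2) (hf.1.mul m2) le_rfl).trans ?_)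
    (eLpNorm_one_mul_le m1 hg.1)
  exact add_le_add (eLpNorm_one_mul_le m1 m2) (eLpNorm_one_mul_le hf.1 m2)

theorem MeasureTheory.MemLp.mul_bounded {p : ℝ≥0∞} {f g : α → ℝ} (hf : MemLp f p μ)
    (hg : AEStronglyMeasurable g μ) {C : ℝ} (hC : ∀ᵐ x ∂μ, |g x| ≤ C) :
    MemLp (fun x => f x * g x) p μ := by
  refine hf.of_le_mul (c := C) (hf.1.mul hg) ?_
  filter_upwards [hC] with x hx
  rw [Real.norm_eq_abs, Real.norm_eq_abs, abs_mul, mul_comm]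
  exact mul_le_mul_of_nonneg_right hx (abs_nonneg _)

theorem eLpNorm_mul_bounded_le {p : ℝ≥0∞} {f g : α → ℝ} {C : ℝ} (hC : ∀ᵐ x ∂μ, |g x| ≤ C) :
    eLpNorm (fun x => f x * g x) p μ ≤ ENNReal.ofReal C * eLpNorm f p μ := by
  refine eLpNorm_le_mul_eLpNorm_of_ae_le_mul ?_ p
  filter_upwards [hC] with x hx
  rw [Real.norm_eq_abs, Real.norm_eq_abs, abs_mul, mul_comm]
  exact mul_le_mul_of_nonneg_right hx (abs_nonneg _)

end Lp

/-! ### Weak directional derivatives and the product rule -/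

section WeakDerivatives

variable {n : ℕ} {Ω : Set (Euc n)}

/-- `g` is the weak derivative of `f` on `Ω` in the direction `e`. -/
def HasWeakDirDeriv (Ω : Set (Euc n)) (e : Euc n) (f g : Euc n → ℝ) : Prop :=
  ∀ φ : Euc n → ℝ, IsTestFunction Ω φ → ∫ x in Ω, f x * fderiv ℝ φ x e = - ∫ x in Ω, g x * φ x

theorem HasWeakDirDeriv.congr_ae {e : Euc n} {f g f' g' : Euc n → ℝ}
    (h : HasWeakDirDeriv Ω e f g) (hf : f =ᵐ[volume.restrict Ω] f')
    (hg : g =ᵐ[volume.restrict Ω] g') : HasWeakDirDeriv Ω e f' g' := by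
  intro φ hφ
  have e1 : ∫ x in Ω, f' x * fderiv ℝ φ x e = ∫ x in Ω, f x * fderiv ℝ φ x e :=
    integral_congr_ae (by filter_upwards [hf] with x hx; rw [hx])
  have e2 : ∫ x in Ω, g' x * φ x = ∫ x in Ω, g x * φ x :=
    integral_congr_ae (by filter_upwards [hg] with x hx; rw [hx])
  rw [e1, e2, h φ hφ]

theorem HasWeakDirDeriv.indicator (hΩ : MeasurableSet Ω) {e : Euc n} {f g : Euc n → ℝ}
    (h : HasWeakDirDeriv Ω e f g) :
    HasWeakDirDeriv Ω e (Ω.indicator f) (Ω.indicator g) :=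
  h.congr_ae (indicator_ae_eq_restrict hΩ).symm (indicator_ae_eq_restrict hΩ).symm

theorem IsTestFunction.continuous_fderiv_apply {φ : Euc n → ℝ} (h : IsTestFunction Ω φ)
    (e : Euc n) : Continuous fun x => fderiv ℝ φ x e :=
  (h.1.continuous_fderiv (by simp)).clm_apply continuous_const

theorem IsTestFunction.hasCompactSupport_fderiv_apply {φ : Euc n → ℝ} (h : IsTestFunction Ω φ)
    (e : Euc n) : HasCompactSupport fun x => fderiv ℝ φ x e :=
  h.2.1.fderiv_apply (𝕜 := ℝ) e

theorem IsTestFunction.memLp_fderiv_apply {φ : Euc n → ℝ} (h : IsTestFunction Ω φ)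
    (e : Euc n) : MemLp (fun x => fderiv ℝ φ x e) 2 (volume.restrict Ω) :=
  ((h.continuous_fderiv_apply e).memLp_of_hasCompactSupport
    (h.hasCompactSupport_fderiv_apply e)).restrict Ω

theorem IsTestFunction.mul_left {φ u : Euc n → ℝ} (h : IsTestFunction Ω φ)
    (hu : ContDiff ℝ ∞ u) : IsTestFunction Ω fun x => u x * φ x :=
  ⟨hu.mul h.1, h.2.1.mul_left, (tsupport_mul_subset_right (f := u)).trans h.2.2⟩

/-- Integration by parts against the constant function one. -/
theorem IsTestFunction.integral_fderiv_eq_zero {φ : Euc n → ℝ} (h : IsTestFunction Ω φ)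
    (e : Euc n) : ∫ x in Ω, fderiv ℝ φ x e = 0 := by
  rw [setIntegral_eq_integral_of_forall_compl_eq_zero]
  · have i1 : Integrable fun x => fderiv ℝ φ x e :=
      (h.continuous_fderiv_apply e).integrable_of_hasCompactSupport
        (h.hasCompactSupport_fderiv_apply e)
    have i2 : Integrable φ := h.1.continuous.integrable_of_hasCompactSupport h.2.1
    have := integral_mul_fderiv_eq_neg_fderiv_mul_of_integrable (μ := (volume : Measure (Euc n)))
      (f := fun _ => (1 : ℝ)) (g := φ) (v := e) (by simp)
      (by simpa using i1) (by simpa using i2) (fun x _ => by fun_prop) (fun x _ => (h.1.differentiable (by simp)).differentiableAt)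
    simpa using this
  · intro x hx
    have : x ∉ tsupport (fderiv ℝ φ) := fun h' => hx (h.2.2 (tsupport_fderiv_subset ℝ h'))
    rw [image_eq_zero_of_notMem_tsupport this]; rfl

/-- Needed for the reciprocal rule: subtracting the lower bound of `w` leaves a function whose
extension by zero is nonnegative. -/
theorem HasWeakDirDeriv.sub_const {e : Euc n} {f g : Euc n → ℝ}
    (hf : MemLp f 2 (volume.restrict Ω)) (h : HasWeakDirDeriv Ω e f g) (c : ℝ) :
    HasWeakDirDeriv Ω e (fun x => f x - c) g := by
  intro φ hφ
  have e1 : ∫ x in Ω, (f x - c) * fderiv ℝ φ x e = ∫ x in Ω, f x * fderiv ℝ φ x e := by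
    simp_rw [sub_mul]
    rw [integral_sub (hf.integrable_fun_mul (hφ.memLp_fderiv_apply e))
      ((((hφ.continuous_fderiv_apply e).integrable_of_hasCompactSupport
        (hφ.hasCompactSupport_fderiv_apply e)).restrict).const_mul c),
      integral_const_mul, hφ.integral_fderiv_eq_zero, mul_zero, sub_zero]
  rw [e1, h φ hφ]

/-- Mollification commutes with weak derivatives away from the boundary. -/
theorem HasWeakDirDeriv.fderiv_mollify {e : Euc n} {f g : Euc n → ℝ}
    (h : HasWeakDirDeriv Ω e f g) (hf : LocallyIntegrable f) {k : ℕ} {x : Euc n}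
    (hx : Metric.closedBall x (1 / ((k : ℝ) + 1)) ⊆ Ω) :
    fderiv ℝ (mollify k f) x e = mollify k g x := by
  -- The reflected and translated kernel is a test function on `Ω`, because the closed ball around
  -- `x` lies in `Ω`. Its derivative carries a sign that cancels the sign in the weak formulation.
  set φ : Euc n → ℝ := fun t => mollKernel n k (x - t) with hφ
  have hd : ∀ t, fderiv ℝ φ t e = - fderiv ℝ (mollKernel n k) (x - t) e := by
    intro t
    have h1 : HasFDerivAt (mollKernel n k) (fderiv ℝ (mollKernel n k) (x - t)) (x - t) :=
      (((contDiff_mollKernel k).differentiable (by simp)) _).hasFDerivAt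
    have h2 : HasFDerivAt (fun t : Euc n => x - t) (-ContinuousLinearMap.id ℝ (Euc n)) t :=
      (hasFDerivAt_id t).const_sub x
    have h3 : HasFDerivAt φ _ t := h1.comp t h2
    rw [h3.fderiv]; simp
  have hsupp : Function.support φ ⊆ Metric.closedBall x (1 / ((k : ℝ) + 1)) := by
    intro t ht
    rw [Metric.mem_closedBall, dist_comm, dist_eq_norm]
    by_contra hlt
    exact ht (mollKernel_eq_zero (not_le.1 hlt).le)
  have htsupp : tsupport φ ⊆ Metric.closedBall x (1 / ((k : ℝ) + 1)) :=
    closure_minimal hsupp Metric.isClosed_closedBall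
  have htest : IsTestFunction Ω φ :=
    ⟨(contDiff_mollKernel k).comp (contDiff_const.sub contDiff_id),
      HasCompactSupport.of_support_subset_isCompact (isCompact_closedBall _ _) hsupp,
      htsupp.trans hx⟩
  have key := h φ htest
  rw [setIntegral_eq_integral_of_forall_compl_eq_zero (fun t ht => by
      have : t ∉ tsupport (fderiv ℝ φ) := fun h' => ht (htest.2.2 (tsupport_fderiv_subset ℝ h'))
      rw [image_eq_zero_of_notMem_tsupport this]; simp),
    setIntegral_eq_integral_of_forall_compl_eq_zero (fun t ht => by
      rw [image_eq_zero_of_notMem_tsupport (fun h' => ht (htest.2.2 h')), mul_zero])] at key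
  rw [_root_.fderiv_mollify k hf, mollify_apply_swap]
  simp_rw [hd, mul_neg, integral_neg, neg_inj] at key
  rw [← integral_congr_ae (Eventually.of_forall fun t => mul_comm (f t) _), key]
  exact integral_congr_ae (Eventually.of_forall fun t => mul_comm _ _)

/-- A compact subset keeps a positive distance from the complement of `Ω`. Hence mollification
commutes with weak derivatives on the support of a fixed test function once `k` is large. -/
theorem eventually_forall_closedBall_subset {K : Set (Euc n)} (hK : IsCompact K) (hΩ : IsOpen Ω)
    (hKΩ : K ⊆ Ω) :
    ∀ᶠ k : ℕ in atTop, ∀ x ∈ K, Metric.closedBall x (1 / ((k : ℝ) + 1)) ⊆ Ω := by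
  obtain ⟨δ, hδ, hsub⟩ := hK.exists_cthickening_subset_open hΩ hKΩ
  filter_upwards [(tendsto_one_div_add_atTop_nhds_zero_nat (𝕜 := ℝ)).eventually
    (gt_mem_nhds hδ)] with k hk x hx
  refine ((Metric.closedBall_subset_closedBall hk.le).trans
    (Metric.closedBall_subset_cthickening hx δ)).trans hsub

theorem tendsto_eLpNorm_mollify_indicator_sub (hΩ : MeasurableSet Ω) {f : Euc n → ℝ}
    (hf : MemLp f 2 (volume.restrict Ω)) :
    Tendsto (fun k => eLpNorm (mollify k (Ω.indicator f) - f) 2 (volume.restrict Ω)) atTop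
      (𝓝 0) := by
  have h := tendsto_eLpNorm_mollify_sub (n := n) one_le_two (by simp)
    ((memLp_indicator_iff_restrict hΩ).2 hf)
  refine tendsto_of_tendsto_of_tendsto_of_le_of_le tendsto_const_nhds h (fun _ => zero_le)
    fun k => ?_
  calc eLpNorm (mollify k (Ω.indicator f) - f) 2 (volume.restrict Ω)
      = eLpNorm (fun x => mollify k (Ω.indicator f) x - Ω.indicator f x) 2
          (volume.restrict Ω) := by
        refine eLpNorm_congr_ae ?_
        filter_upwards [indicator_ae_eq_restrict (f := f) hΩ] with x hx
        rw [hx, Pi.sub_apply]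
    _ ≤ _ := eLpNorm_mono_measure _ Measure.restrict_le_self

theorem locallyIntegrable_indicator (hΩ : MeasurableSet Ω) {f : Euc n → ℝ}
    (hf : MemLp f 2 (volume.restrict Ω)) : LocallyIntegrable (Ω.indicator f) :=
  ((memLp_indicator_iff_restrict hΩ).2 hf).locallyIntegrable one_le_two

/-- The product rule for weak derivatives of `L²` functions. -/
theorem HasWeakDirDeriv.mul (hΩ : IsOpen Ω) {e : Euc n} {u u' v v' : Euc n → ℝ}
    (hu : MemLp u 2 (volume.restrict Ω)) (hu' : MemLp u' 2 (volume.restrict Ω))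
    (hv : MemLp v 2 (volume.restrict Ω)) (hv' : MemLp v' 2 (volume.restrict Ω))
    (h : HasWeakDirDeriv Ω e u u') (h' : HasWeakDirDeriv Ω e v v') :
    HasWeakDirDeriv Ω e (fun x => u x * v x) (fun x => u' x * v x + u x * v' x) := by
  intro φ hφ
  have hm := hΩ.measurableSet
  -- Only `u` is mollified: multiplied by `φ` it becomes a test function for the weak derivative of
  -- `v`. The limit in `k` uses the `L²` pairing, so no bound on `u v` in `L²` is required.
  set U := Ω.indicator u
  set U' := Ω.indicator u'
  have hUl : LocallyIntegrable U := locallyIntegrable_indicator hm hu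
  have hUl' : LocallyIntegrable U' := locallyIntegrable_indicator hm hu'
  have hs : ∀ k, ContDiff ℝ ∞ (mollify k U) := fun k => contDiff_mollify k hUl
  have hs' : ∀ k, ContDiff ℝ ∞ (mollify k U') := fun k => contDiff_mollify k hUl'
  obtain ⟨C, hC⟩ := hφ.2.1.exists_bound_of_continuous hφ.1.continuous
  obtain ⟨C', hC'⟩ := (hφ.hasCompactSupport_fderiv_apply e).exists_bound_of_continuous
    (hφ.continuous_fderiv_apply e)
  have mφ : AEStronglyMeasurable φ (volume.restrict Ω) := hφ.1.continuous.aestronglyMeasurable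
  have mφ' : AEStronglyMeasurable (fun x => fderiv ℝ φ x e) (volume.restrict Ω) :=
    (hφ.continuous_fderiv_apply e).aestronglyMeasurable
  have hvφ : MemLp (fun x => v x * φ x) 2 (volume.restrict Ω) :=
    MemLp.mul_bounded hv mφ (Eventually.of_forall hC)
  have hvφ' : MemLp (fun x => v x * fderiv ℝ φ x e) 2 (volume.restrict Ω) :=
    MemLp.mul_bounded hv mφ' (Eventually.of_forall hC')
  have hv'φ : MemLp (fun x => v' x * φ x) 2 (volume.restrict Ω) :=
    MemLp.mul_bounded hv' mφ (Eventually.of_forall hC)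
  have lim : ∀ {a f : Euc n → ℝ}, MemLp a 2 (volume.restrict Ω) → MemLp f 2 (volume.restrict Ω) →
      Tendsto (fun k => ∫ x in Ω, a x * mollify k (Ω.indicator f) x) atTop
        (𝓝 (∫ x in Ω, a x * f x)) := by
    intro a f ha hf
    refine tendsto_integral_mul_of_tendsto_eLpNorm (F := fun _ => a) ha hf (fun _ => ha.1)
      (fun k => (contDiff_mollify k
        (locallyIntegrable_indicator hm hf)).continuous.aestronglyMeasurable)
      (by simp) (tendsto_eLpNorm_mollify_indicator_sub hm hf)
  have hlim1 := (lim hvφ' hu).add (lim hvφ hu')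
  have hlim2 := (lim hv'φ hu).neg
  have heq : ∀ᶠ k in atTop, (∫ x in Ω, (v x * fderiv ℝ φ x e) * mollify k U x) +
      ∫ x in Ω, (v x * φ x) * mollify k U' x = -∫ x in Ω, (v' x * φ x) * mollify k U x := by
    filter_upwards [eventually_forall_closedBall_subset hφ.2.1.isCompact hΩ hφ.2.2] with k hk
    have htest := hφ.mul_left (hs k)
    have key := h' _ htest
    obtain ⟨D, hD⟩ := (htest.2.1).exists_bound_of_continuous htest.1.continuous
    have hd : ∀ x, v x * fderiv ℝ (fun x => mollify k U x * φ x) x e =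
        (v x * fderiv ℝ φ x e) * mollify k U x + (v x * φ x) * mollify k U' x := by
      intro x
      have d1 : DifferentiableAt ℝ (mollify k U) x := (hs k).differentiable (by simp) x
      have d2 : DifferentiableAt ℝ φ x := hφ.1.differentiable (by simp) x
      have : fderiv ℝ (fun x => mollify k U x * φ x) x = _ := fderiv_mul d1 d2
      rw [this]
      -- On the support the derivative of the mollification is the mollification of `u'`; elsewhere
      -- that term is multiplied by `φ x = 0`.
      by_cases hx : x ∈ tsupport φ
      · have := (h.indicator hm).fderiv_mollify hUl (hk x hx)
        simp only [add_apply, smul_apply, smul_eq_mul]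
        rw [this]; ring
      · simp only [add_apply, smul_apply, smul_eq_mul,
          image_eq_zero_of_notMem_tsupport hx]
        ring
    have i1 : Integrable (fun x => (v x * fderiv ℝ φ x e) * mollify k U x)
        (volume.restrict Ω) := by
      have : MemLp (fun x => fderiv ℝ φ x e * mollify k U x) 2 (volume.restrict Ω) :=
        (((hφ.continuous_fderiv_apply e).mul (hs k).continuous).memLp_of_hasCompactSupport
          (hφ.hasCompactSupport_fderiv_apply e).mul_right).restrict Ω
      simpa only [mul_assoc] using hv.integrable_fun_mul this
    have i2 : Integrable (fun x => (v x * φ x) * mollify k U' x) (volume.restrict Ω) := by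
      have : MemLp (fun x => φ x * mollify k U' x) 2 (volume.restrict Ω) :=
        ((hφ.1.continuous.mul (hs' k).continuous).memLp_of_hasCompactSupport
          hφ.2.1.mul_right).restrict Ω
      simpa only [mul_assoc] using hv.integrable_fun_mul this
    simp_rw [hd] at key
    rw [integral_add i1 i2] at key
    rw [key]
    congr 1
    exact integral_congr_ae (Eventually.of_forall fun x => by ring)
  have huniq := tendsto_nhds_unique (hlim1.congr' heq) hlim2
  have r1 : ∫ x in Ω, (u' x * v x + u x * v' x) * φ x =
      (∫ x in Ω, v x * φ x * u' x) + ∫ x in Ω, v' x * φ x * u x := by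
    rw [← integral_add (hvφ.integrable_fun_mul hu') (hv'φ.integrable_fun_mul hu)]
    exact integral_congr_ae (Eventually.of_forall fun x => by ring)
  have r2 : ∫ x in Ω, u x * v x * fderiv ℝ φ x e = ∫ x in Ω, v x * fderiv ℝ φ x e * u x :=
    integral_congr_ae (Eventually.of_forall fun x => by ring)
  rw [r1, r2]
  linarith

end WeakDerivatives

/-! ### Weak derivative of a reciprocal, and linearity in the direction -/

section Reciprocal

variable {n : ℕ} {Ω : Set (Euc n)}

theorem abs_inv_sub_inv_le {δ a b : ℝ} (hδ : 0 < δ) (ha : δ ≤ a) (hb : δ ≤ b) :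
    |a⁻¹ - b⁻¹| ≤ (δ ^ 2)⁻¹ * |a - b| := by
  have ha0 : 0 < a := hδ.trans_le ha
  have hb0 : 0 < b := hδ.trans_le hb
  rw [inv_sub_inv ha0.ne' hb0.ne', abs_div, abs_of_pos (mul_pos ha0 hb0), abs_sub_comm,
    div_eq_inv_mul]
  refine mul_le_mul_of_nonneg_right (inv_anti₀ (by positivity) ?_) (abs_nonneg _)
  rw [sq]
  exact mul_le_mul ha hb hδ.le ha0.le

theorem abs_inv_sq_sub_inv_sq_le {δ a b : ℝ} (hδ : 0 < δ) (ha : δ ≤ a) (hb : δ ≤ b) :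
    |(a ^ 2)⁻¹ - (b ^ 2)⁻¹| ≤ (2 * δ⁻¹ * (δ ^ 2)⁻¹) * |a - b| := by
  have ha0 : 0 < a := hδ.trans_le ha
  have hb0 : 0 < b := hδ.trans_le hb
  have e : (a ^ 2)⁻¹ - (b ^ 2)⁻¹ = (a⁻¹ + b⁻¹) * (a⁻¹ - b⁻¹) := by rw [← inv_pow, ← inv_pow]; ring
  rw [e, abs_mul, mul_assoc]
  refine mul_le_mul ?_ (abs_inv_sub_inv_le hδ ha hb) (abs_nonneg _) (by positivity)
  rw [abs_of_pos (by positivity), two_mul]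
  exact add_le_add (inv_anti₀ hδ ha) (inv_anti₀ hδ hb)

/-- The weak derivative of `1 / w` for `w` bounded below by a positive constant. -/
theorem HasWeakDirDeriv.inv (hΩ : IsOpen Ω) (hfin : volume Ω ≠ ⊤) {e : Euc n} {w w' : Euc n → ℝ}
    (hw : MemLp w 2 (volume.restrict Ω)) (hw' : MemLp w' 2 (volume.restrict Ω))
    (h : HasWeakDirDeriv Ω e w w') {δ : ℝ} (hδ : 0 < δ) (hwδ : ∀ᵐ x ∂volume.restrict Ω, δ ≤ w x) :
    HasWeakDirDeriv Ω e (fun x => (w x)⁻¹) (fun x => -(w' x * (w x ^ 2)⁻¹)) := by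
  intro φ hφ
  have hm := hΩ.measurableSet
  have : IsFiniteMeasure (volume.restrict Ω) := isFiniteMeasure_restrict.2 hfin
  have hgL : MemLp (fun x => w x - δ) 2 (volume.restrict Ω) := hw.sub (memLp_const δ)
  set G := Ω.indicator fun x => w x - δ with hG
  set G' := Ω.indicator w' with hG'
  have hGl : LocallyIntegrable G := locallyIntegrable_indicator hm hgL
  have hGl' : LocallyIntegrable G' := locallyIntegrable_indicator hm hw'
  have hd := (h.sub_const hw δ).indicator hm
  have hG0 : ∀ᵐ x, 0 ≤ G x := by
    filter_upwards [(ae_restrict_iff' hm).1 hwδ] with x hx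
    by_cases hxΩ : x ∈ Ω
    · rw [hG, indicator_of_mem hxΩ]; linarith [hx hxΩ]
    · rw [hG, indicator_of_notMem hxΩ]
  -- Mollifying `w - δ` and adding `δ` back keeps the approximations at least `δ` on the whole
  -- space, so their reciprocals are smooth.
  let W : ℕ → Euc n → ℝ := fun k x => δ + mollify k G x
  have hWδ : ∀ k x, δ ≤ W k x := fun k x => by
    simpa [W] using mollify_nonneg k hG0 x
  have hW0 : ∀ k x, W k x ≠ 0 := fun k x => (hδ.trans_le (hWδ k x)).ne'
  have hWs : ∀ k, ContDiff ℝ ∞ (W k) := fun k => contDiff_const.add (contDiff_mollify k hGl)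
  have hWi : ∀ k, ContDiff ℝ ∞ fun x => (W k x)⁻¹ := fun k => (hWs k).inv (hW0 k)
  have hconv := tendsto_eLpNorm_mollify_indicator_sub hm hgL
  -- On `Ω`, `W k - w` is the mollification error of `w - δ`, so a pointwise Lipschitz bound
  -- suffices for `L²` convergence.
  have hbd : ∀ {F : ℕ → Euc n → ℝ} {f : Euc n → ℝ} {c : ℝ},
      (∀ k, ∀ᵐ x ∂volume.restrict Ω, |F k x - f x| ≤ c * |W k x - w x|) →
      Tendsto (fun k => eLpNorm (F k - f) 2 (volume.restrict Ω)) atTop (𝓝 0) := by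
    intro F f c hF
    have hlim := ENNReal.Tendsto.const_mul (a := ENNReal.ofReal c) hconv
      (Or.inr ENNReal.ofReal_ne_top)
    rw [mul_zero] at hlim
    refine tendsto_of_tendsto_of_tendsto_of_le_of_le tendsto_const_nhds hlim (fun _ => zero_le)
      fun k => ?_
    refine eLpNorm_le_mul_eLpNorm_of_ae_le_mul ?_ 2
    filter_upwards [hF k] with x hx
    simp only [Pi.sub_apply, Real.norm_eq_abs]
    convert hx using 3
    simp only [W]; ring
  have hinv : Tendsto (fun k => eLpNorm ((fun x => (W k x)⁻¹) - fun x => (w x)⁻¹) 2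
      (volume.restrict Ω)) atTop (𝓝 0) := by
    refine hbd (c := (δ ^ 2)⁻¹) fun k => ?_
    filter_upwards [hwδ] with x hx using abs_inv_sub_inv_le hδ (hWδ k x) hx
  have hinv2 : Tendsto (fun k => eLpNorm ((fun x => φ x * (W k x ^ 2)⁻¹) -
      fun x => φ x * (w x ^ 2)⁻¹) 2 (volume.restrict Ω)) atTop (𝓝 0) := by
    obtain ⟨C, hC⟩ := hφ.2.1.exists_bound_of_continuous hφ.1.continuous
    refine hbd (c := C * (2 * δ⁻¹ * (δ ^ 2)⁻¹)) fun k => ?_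
    filter_upwards [hwδ] with x hx
    rw [← mul_sub, abs_mul, mul_assoc]
    exact mul_le_mul (hC x) (abs_inv_sq_sub_inv_sq_le hδ (hWδ k x) hx) (abs_nonneg _)
      ((abs_nonneg _).trans (hC x))
  have hwm : AEMeasurable w (volume.restrict Ω) := hw.1.aemeasurable
  have hwinv : MemLp (fun x => (w x)⁻¹) 2 (volume.restrict Ω) := by
    refine MemLp.of_bound hwm.inv.aestronglyMeasurable δ⁻¹ ?_
    filter_upwards [hwδ] with x hx
    rw [Real.norm_eq_abs, abs_of_pos (inv_pos.2 (hδ.trans_le hx))]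
    exact inv_anti₀ hδ hx
  have hwinv2 : MemLp (fun x => φ x * (w x ^ 2)⁻¹) 2 (volume.restrict Ω) := by
    refine hφ.memLp.mul_bounded (hwm.pow_const 2).inv.aestronglyMeasurable (C := (δ ^ 2)⁻¹) ?_
    filter_upwards [hwδ] with x hx
    rw [abs_of_pos (inv_pos.2 (pow_pos (hδ.trans_le hx) 2))]
    exact inv_anti₀ (by positivity) (pow_le_pow_left₀ hδ.le hx 2)
  have lim1 := tendsto_integral_mul_of_tendsto_eLpNorm hwinv (hφ.memLp_fderiv_apply e)
    (fun k => (hWi k).continuous.aestronglyMeasurable)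
    (fun _ => (hφ.memLp_fderiv_apply e).1) hinv (G := fun _ x => fderiv ℝ φ x e) (by simp)
  have lim2 := tendsto_integral_mul_of_tendsto_eLpNorm hw' hwinv2
    (fun k => (contDiff_mollify k hGl').continuous.aestronglyMeasurable)
    (fun k => (hφ.1.continuous.mul
      ((hWs k).continuous.pow 2 |>.inv₀ fun x => pow_ne_zero 2 (hW0 k x))).aestronglyMeasurable)
    (tendsto_eLpNorm_mollify_indicator_sub hm hw') hinv2
  have heq : ∀ᶠ k in atTop, ∫ x in Ω, (W k x)⁻¹ * fderiv ℝ φ x e =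
      ∫ x in Ω, mollify k (Ω.indicator w') x * (φ x * (W k x ^ 2)⁻¹) := by
    filter_upwards [eventually_forall_closedBall_subset hφ.2.1.isCompact hΩ hφ.2.2] with k hk
    have htest := hφ.mul_left (hWi k)
    -- Expanding the vanishing integral of the derivative of `φ / W k` gives the weak formulation
    -- for `1 / W k`.
    have key := htest.integral_fderiv_eq_zero e
    have hder : ∀ x, fderiv ℝ (fun x => (W k x)⁻¹ * φ x) x e = (W k x)⁻¹ * fderiv ℝ φ x e -
        mollify k (Ω.indicator w') x * (φ x * (W k x ^ 2)⁻¹) := by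
      intro x
      have d1 : HasFDerivAt (W k) (fderiv ℝ (mollify k G) x) x :=
        (((contDiff_mollify k hGl).differentiable (by simp)) x).hasFDerivAt.const_add δ
      have d2 : HasFDerivAt φ (fderiv ℝ φ x) x :=
        (hφ.1.differentiable (by simp) x).hasFDerivAt
      have d3 := ((hasDerivAt_inv (hW0 k x)).comp_hasFDerivAt x d1).mul d2
      have d4 : HasFDerivAt (fun x => (W k x)⁻¹ * φ x) _ x := d3
      rw [d4.fderiv]
      simp only [add_apply, smul_apply, smul_eq_mul, Function.comp_apply]
      by_cases hx : x ∈ tsupport φ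
      · rw [hd.fderiv_mollify hGl (hk x hx)]; ring
      · rw [image_eq_zero_of_notMem_tsupport hx]; ring
    simp_rw [hder] at key
    have i1 : Integrable (fun x => (W k x)⁻¹ * fderiv ℝ φ x e) (volume.restrict Ω) :=
      (((hWi k).continuous.mul (hφ.continuous_fderiv_apply e)).integrable_of_hasCompactSupport
        (hφ.hasCompactSupport_fderiv_apply e).mul_left).restrict
    have i2 : Integrable (fun x => mollify k (Ω.indicator w') x * (φ x * (W k x ^ 2)⁻¹))
        (volume.restrict Ω) :=
      (((contDiff_mollify k hGl').continuous.mul (hφ.1.continuous.mul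
        ((hWs k).continuous.pow 2 |>.inv₀ fun x =>
          pow_ne_zero 2 (hW0 k x)))).integrable_of_hasCompactSupport
        hφ.2.1.mul_right.mul_left).restrict
    rw [integral_sub i1 i2] at key
    linarith
  rw [tendsto_nhds_unique (lim1.congr' heq) lim2, ← integral_neg]
  exact integral_congr_ae (Eventually.of_forall fun x => by ring)

theorem HasWeakDirDeriv.sum_smul {ι : Type*} (s : Finset ι) {e : ι → Euc n} {f : Euc n → ℝ}
    {g : ι → Euc n → ℝ} (hf : MemLp f 2 (volume.restrict Ω))
    (hg : ∀ i, MemLp (g i) 2 (volume.restrict Ω)) (h : ∀ i, HasWeakDirDeriv Ω (e i) f (g i))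
    (c : ι → ℝ) :
    HasWeakDirDeriv Ω (∑ i ∈ s, c i • e i) f (fun x => ∑ i ∈ s, c i * g i x) := by
  intro φ hφ
  simp_rw [map_sum, map_smul, smul_eq_mul, Finset.mul_sum, Finset.sum_mul]
  rw [integral_finsetSum _ fun i _ => ?_, integral_finsetSum _ fun i _ => ?_,
    ← Finset.sum_neg_distrib]
  · refine Finset.sum_congr rfl fun i _ => ?_
    have e1 : ∀ x, f x * (c i * fderiv ℝ φ x (e i)) = c i * (f x * fderiv ℝ φ x (e i)) :=
      fun x => by ring
    have e2 : ∀ x, c i * g i x * φ x = c i * (g i x * φ x) := fun x => by ring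
    simp only [e1, e2, integral_const_mul, h i φ hφ, mul_neg]
  · simp only [mul_assoc]
    exact ((hg i).integrable_fun_mul hφ.memLp).const_mul _
  · have e1 : ∀ x, f x * (c i * fderiv ℝ φ x (e i)) = c i * (f x * fderiv ℝ φ x (e i)) :=
      fun x => by ring
    simp only [e1]
    exact (hf.integrable_fun_mul (hφ.memLp_fderiv_apply (e i))).const_mul _

end Reciprocal

/-! ### Pointwise bounds by integrals over segments -/

section LineEstimate

variable {n : ℕ} {Ω : Set (Euc n)}

/-- The fundamental theorem of calculus bounds `|u 0|` by `|u s|` plus the integral of `|u'|`;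
averaging over `s` in `[0, h]` gives the weight `h⁻¹`. -/
theorem enorm_apply_zero_le_lintegral {u u' : ℝ → ℝ} {h : ℝ} (hh : 0 < h)
    (hu : ∀ s, HasDerivAt u (u' s) s) (hu' : Continuous u') :
    ‖u 0‖ₑ ≤ ∫⁻ s in Icc 0 h, (ENNReal.ofReal h⁻¹ * ‖u s‖ₑ + ‖u' s‖ₑ) := by
  have hc : Continuous u := continuous_iff_continuousAt.2 fun s => (hu s).continuousAt
  have hpt : ∀ s ∈ Icc 0 h, ‖u 0‖ₑ ≤ ‖u s‖ₑ + ∫⁻ t in Icc 0 h, ‖u' t‖ₑ := by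
    intro s hs
    have e : u 0 = u s - ∫ t in (0 : ℝ)..s, u' t := by
      rw [intervalIntegral.integral_eq_sub_of_hasDerivAt (fun t _ => hu t)
        (hu'.intervalIntegrable _ _)]
      ring
    rw [e]
    refine (enorm_sub_le).trans (add_le_add le_rfl ?_)
    rw [intervalIntegral.integral_of_le hs.1]
    refine (enorm_integral_le_lintegral_enorm _).trans (lintegral_mono_set fun t ht => ?_)
    exact ⟨ht.1.le, ht.2.trans hs.2⟩
  have hvol : volume (Icc (0 : ℝ) h) = ENNReal.ofReal h := by simp
  have hmul : ENNReal.ofReal h⁻¹ * ENNReal.ofReal h = 1 := by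
    rw [← ENNReal.ofReal_mul (by positivity), inv_mul_cancel₀ hh.ne', ENNReal.ofReal_one]
  have m1 : Measurable fun s => ‖u s‖ₑ := hc.measurable.enorm
  calc ‖u 0‖ₑ = ENNReal.ofReal h⁻¹ * ∫⁻ _ in Icc 0 h, ‖u 0‖ₑ := by
        rw [setLIntegral_const, hvol, mul_comm, mul_assoc, mul_comm _ (ENNReal.ofReal h⁻¹), hmul,
          mul_one]
    _ ≤ ENNReal.ofReal h⁻¹ * ∫⁻ s in Icc 0 h, (‖u s‖ₑ + ∫⁻ t in Icc 0 h, ‖u' t‖ₑ) := by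
        gcongr 1
        exact setLIntegral_mono' measurableSet_Icc hpt
    _ = _ := by
        rw [lintegral_add_left m1, setLIntegral_const, hvol, mul_add, mul_left_comm,
          ← mul_assoc, mul_comm (ENNReal.ofReal h⁻¹) _, mul_assoc, hmul, mul_one]
        rw [lintegral_add_left (m1.const_mul _), lintegral_const_mul _ m1, mul_comm]

/-- A weakly differentiable function is bounded, almost everywhere, by integrals of the function
and of its derivative over segments inside the domain. -/
theorem HasWeakDirDeriv.ae_enorm_le_lintegral (hΩ : IsOpen Ω) {e : Euc n} {f g : Euc n → ℝ}
    (hd : HasWeakDirDeriv Ω e f g) (hfm : Measurable f) (hgm : Measurable g)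
    (hf : MemLp f 1) (hg : MemLp g 1) {h : ℝ} (hh : 0 < h) :
    ∀ᵐ x, (∀ s ∈ Icc 0 h, x + s • e ∈ Ω) →
      ‖f x‖ₑ ≤ ∫⁻ s in Icc 0 h, (ENNReal.ofReal h⁻¹ * ‖f (x + s • e)‖ₑ + ‖g (x + s • e)‖ₑ) := by
  have hfl : LocallyIntegrable f := hf.locallyIntegrable le_rfl
  have hgl : LocallyIntegrable g := hg.locallyIntegrable le_rfl
  -- `P k` is the mollification error in the integrand, and `D k` below is the total error at `x`
  -- and along the segment issuing from `x`.
  set P : ℕ → Euc n → ℝ≥0∞ := fun k y =>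
    ENNReal.ofReal h⁻¹ * ‖mollify k f y - f y‖ₑ + ‖mollify k g y - g y‖ₑ with hP
  have mf : ∀ k, Measurable fun y => ‖mollify k f y - f y‖ₑ := fun k =>
    ((contDiff_mollify k hfl).continuous.measurable.sub hfm).enorm
  have mg : ∀ k, Measurable fun y => ‖mollify k g y - g y‖ₑ := fun k =>
    ((contDiff_mollify k hgl).continuous.measurable.sub hgm).enorm
  have mP : ∀ k, Measurable (P k) := fun k => ((mf k).const_mul _).add (mg k)
  have mP2 : ∀ k, Measurable fun z : Euc n × ℝ => P k (z.1 + z.2 • e) := fun k =>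
    (mP k).comp (by fun_prop)
  set D : ℕ → Euc n → ℝ≥0∞ := fun k x =>
    ‖mollify k f x - f x‖ₑ + ∫⁻ s in Icc 0 h, P k (x + s • e) with hD
  have mD : ∀ k, Measurable (D k) := fun k => (mf k).add (mP2 k).lintegral_prod_right'
  have tf := tendsto_eLpNorm_mollify_sub le_rfl (by simp) hf
  have tg := tendsto_eLpNorm_mollify_sub le_rfl (by simp) hg
  simp_rw [eLpNorm_one_eq_lintegral_enorm] at tf tg
  -- Tonelli and translation invariance remove the dependence on the segment: each `s` contributes
  -- the same integral over the whole space.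
  have hDint : ∀ k, ∫⁻ x, D k x = (∫⁻ x, ‖mollify k f x - f x‖ₑ) +
      (ENNReal.ofReal h⁻¹ * (∫⁻ x, ‖mollify k f x - f x‖ₑ) + ∫⁻ x, ‖mollify k g x - g x‖ₑ) *
        ENNReal.ofReal h := by
    intro k
    rw [hD, lintegral_add_left (mf k), lintegral_lintegral_swap (mP2 k).aemeasurable]
    simp_rw [lintegral_add_right_eq_self (μ := (volume : Measure (Euc n))) (P k)]
    rw [setLIntegral_const, hP, lintegral_add_left ((mf k).const_mul _),
      lintegral_const_mul _ (mf k)]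
    simp
  have tD : Tendsto (fun k => ∫⁻ x, D k x) atTop (𝓝 0) := by
    simp_rw [hDint]
    have := tf.add (ENNReal.Tendsto.mul_const (b := ENNReal.ofReal h)
      ((ENNReal.Tendsto.const_mul (a := ENNReal.ofReal h⁻¹) tf
        (Or.inr ENNReal.ofReal_ne_top)).add tg) (Or.inr ENNReal.ofReal_ne_top))
    simpa using this
  -- Fatou's lemma gives a vanishing lower limit almost everywhere, which replaces the choice of an
  -- a.e. convergent subsequence.
  have hlim : ∀ᵐ x, liminf (fun k => D k x) atTop = 0 := by
    have h0 : ∫⁻ x, liminf (fun k => D k x) atTop = 0 :=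
      le_antisymm ((lintegral_liminf_le mD).trans tD.liminf_eq.le) zero_le
    exact (lintegral_eq_zero_iff (Measurable.liminf mD)).1 h0
  filter_upwards [hlim] with x hx hseg
  set R := ∫⁻ s in Icc 0 h, (ENNReal.ofReal h⁻¹ * ‖f (x + s • e)‖ₑ + ‖g (x + s • e)‖ₑ) with hR
  have hK : IsCompact ((fun s : ℝ => x + s • e) '' Icc 0 h) :=
    isCompact_Icc.image (by fun_prop)
  -- The left side does not depend on `k`, so it is at most the lower limit of `D k x`, which is
  -- zero.
  have hev : ∀ᶠ k in atTop, ‖f x‖ₑ - R ≤ D k x := by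
    filter_upwards [eventually_forall_closedBall_subset hK hΩ
      (by rintro _ ⟨s, hs, rfl⟩; exact hseg s hs)] with k hk
    rw [tsub_le_iff_left]
    have hder : ∀ s : ℝ, HasDerivAt (fun s : ℝ => mollify k f (x + s • e))
        (fderiv ℝ (mollify k f) (x + s • e) e) s := by
      intro s
      have h1 : HasFDerivAt (mollify k f) _ (x + s • e) :=
        ((contDiff_mollify k hfl).differentiable (by simp) _).hasFDerivAt
      have h2 : HasDerivAt (fun s : ℝ => x + s • e) e s := by
        simpa using ((hasDerivAt_id s).smul_const e).const_add x
      exact h1.comp_hasDerivAt s h2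
    have hcont : Continuous fun s : ℝ => fderiv ℝ (mollify k f) (x + s • e) e :=
      (((contDiff_mollify k hfl).continuous_fderiv (by simp)).comp
        (by fun_prop : Continuous fun s : ℝ => x + s • e)).clm_apply continuous_const
    have key := enorm_apply_zero_le_lintegral hh hder hcont
    simp only [zero_smul, add_zero] at key
    have key2 : ‖mollify k f x‖ₑ ≤ R + ∫⁻ s in Icc 0 h, P k (x + s • e) := by
      refine key.trans ?_
      have mline : Measurable fun s : ℝ => x + s • e := by fun_prop
      have mPl : Measurable fun s : ℝ => P k (x + s • e) := (mP k).comp mline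
      rw [hR, ← lintegral_add_right _ mPl]
      refine setLIntegral_mono' measurableSet_Icc fun s hs => ?_
      rw [hd.fderiv_mollify hfl (hk _ ⟨s, hs, rfl⟩)]
      have tri : ∀ a b : ℝ, ‖a‖ₑ ≤ ‖b‖ₑ + ‖a - b‖ₑ := fun a b => by
        simpa using enorm_add_le b (a - b)
      calc _ ≤ ENNReal.ofReal h⁻¹ * (‖f (x + s • e)‖ₑ +
              ‖mollify k f (x + s • e) - f (x + s • e)‖ₑ) +
            (‖g (x + s • e)‖ₑ + ‖mollify k g (x + s • e) - g (x + s • e)‖ₑ) := by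
            gcongr <;> exact tri _ _
        _ = _ := by rw [hP]; ring
    have tri : ‖f x‖ₑ ≤ ‖mollify k f x‖ₑ + ‖mollify k f x - f x‖ₑ := by
      simpa using enorm_sub_le (a := mollify k f x) (b := mollify k f x - f x)
    calc ‖f x‖ₑ ≤ (R + ∫⁻ s in Icc 0 h, P k (x + s • e)) + ‖mollify k f x - f x‖ₑ :=
          tri.trans (add_le_add key2 le_rfl)
      _ = R + D k x := by rw [hD]; ring
  have := le_liminf_of_le (by isBoundedDefault) hev
  rw [hx] at this
  exact tsub_eq_zero_iff_le.1 (le_antisymm this zero_le)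

end LineEstimate

/-! ### Translations that stay inside the domain -/

section Geometry

variable {n : ℕ} {Ω : Set (Euc n)}

theorem exists_parallelogram_subset_of_mem {x₀ : Euc n} (hΩ : IsOpen Ω) (hx : x₀ ∈ Ω)
    (e f : Euc n) : ∃ U ∈ 𝓝 x₀, ∃ h : ℝ, 0 < h ∧ ∀ y ∈ Ω ∩ U, ∀ s ∈ Icc 0 h, ∀ t ∈ Icc 0 h,
      y + (s • e + t • f) ∈ Ω := by
  have hc : Tendsto (fun p : Euc n × ℝ × ℝ => p.1 + (p.2.1 • e + p.2.2 • f)) (𝓝 (x₀, 0, 0))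
      (𝓝 x₀) := by
    have : Continuous fun p : Euc n × ℝ × ℝ => p.1 + (p.2.1 • e + p.2.2 • f) := by fun_prop
    simpa using this.tendsto (x₀, 0, 0)
  have hev := hc.eventually (hΩ.mem_nhds hx)
  rw [nhds_prod_eq, nhds_prod_eq] at hev
  obtain ⟨pa, ha, pb, hb, hab⟩ := eventually_prod_iff.1 hev
  obtain ⟨pc, hc, pd, hd, hcd⟩ := eventually_prod_iff.1 hb
  obtain ⟨δ, hδ, hδ'⟩ := Metric.eventually_nhds_iff.1 (hc.and hd)
  refine ⟨{x | pa x}, ha, δ / 2, by positivity, fun y hy s hs t ht => hab hy.2 (hcd ?_ ?_)⟩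
  · exact (hδ' (by rw [Real.dist_0_eq_abs, abs_of_nonneg hs.1]; linarith [hs.2])).1
  · exact (hδ' (by rw [Real.dist_0_eq_abs, abs_of_nonneg ht.1]; linarith [ht.2])).2

/-- Near a smooth boundary point, the domain is stable under small translations in inward
directions. -/
theorem exists_parallelogram_subset_of_frontier (hs : HasSmoothBoundary Ω) {x₀ : Euc n}
    (hx : x₀ ∈ frontier Ω) : ∃ l : Euc n →L[ℝ] ℝ, l ≠ 0 ∧ ∀ e f : Euc n, l e < 0 → l f < 0 →
      ∃ U ∈ 𝓝 x₀, ∃ h : ℝ, 0 < h ∧ ∀ y ∈ Ω ∩ U, ∀ s ∈ Icc 0 h, ∀ t ∈ Icc 0 h,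
        y + (s • e + t • f) ∈ Ω := by
  obtain ⟨U, hU, φ, hφ, hd, hΩU⟩ := hs x₀ hx
  refine ⟨fderiv ℝ φ x₀, hd, fun e f he hf => ?_⟩
  have hcont : ∀ v : Euc n, Continuous fun x => fderiv ℝ φ x v := fun v =>
    (hφ.continuous_fderiv (by simp)).clm_apply continuous_const
  have hev := (((hcont e).tendsto x₀).eventually (gt_mem_nhds he)).and
    ((((hcont f).tendsto x₀).eventually (gt_mem_nhds hf)).and hU)
  obtain ⟨ρ, hρ, hball⟩ := Metric.eventually_nhds_iff_ball.1 hev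
  obtain ⟨W, hW, h, hh, hpar⟩ := exists_parallelogram_subset_of_mem Metric.isOpen_ball
    (Metric.mem_ball_self hρ) e f
  refine ⟨W ∩ Metric.ball x₀ ρ, inter_mem hW (Metric.ball_mem_nhds _ hρ), h, hh,
    fun y hy s hs t ht => ?_⟩
  have hz := hpar y ⟨hy.2.2, hy.2.1⟩ s hs t ht
  have hyφ : φ y < 0 := (hΩU.subset ⟨hy.1, (hball y hy.2.2).2.2⟩).1
  -- Both directional derivatives of `φ` are negative throughout the ball, so by the mean value
  -- theorem the translation cannot increase `φ`.
  obtain ⟨ξ, hξ, hmv⟩ := domain_mvt (f := φ) (f' := fun x => fderiv ℝ φ x)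
    (fun x _ => ((hφ.differentiable (by simp)) x).hasFDerivAt.hasFDerivWithinAt)
    (convex_ball x₀ ρ) hy.2.2 hz
  have hξb : ξ ∈ Metric.ball x₀ ρ := (convex_ball x₀ ρ).segment_subset hy.2.2 hz hξ
  obtain ⟨h1, h2, -⟩ := hball ξ hξb
  simp only [add_sub_cancel_left, map_add, map_smul, smul_eq_mul] at hmv
  have hzφ : φ (y + (s • e + t • f)) < 0 := by
    nlinarith [mul_nonneg hs.1 (neg_pos.2 h1).le, mul_nonneg ht.1 (neg_pos.2 h2).le]
  exact (hΩU.symm.subset ⟨hzφ, (hball _ hz).2.2⟩).1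

/-- At interior points every direction is admissible; a coordinate functional is supplied there only
so that both cases share one form, which is why `n ≠ 0` is required. -/
theorem exists_parallelogram_subset (hΩ : IsOpen Ω) (hs : HasSmoothBoundary Ω) (hn : n ≠ 0)
    {x₀ : Euc n} (hx : x₀ ∈ closure Ω) : ∃ l : Euc n →L[ℝ] ℝ, l ≠ 0 ∧
      ∀ e f : Euc n, l e < 0 → l f < 0 →
      ∃ U ∈ 𝓝 x₀, ∃ h : ℝ, 0 < h ∧ ∀ y ∈ Ω ∩ U, ∀ s ∈ Icc 0 h, ∀ t ∈ Icc 0 h,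
        y + (s • e + t • f) ∈ Ω := by
  by_cases h : x₀ ∈ Ω
  · refine ⟨EuclideanSpace.proj ⟨0, Nat.pos_of_ne_zero hn⟩, fun h0 => ?_, fun e f _ _ =>
      exists_parallelogram_subset_of_mem hΩ h e f⟩
    have := congrArg (fun l => l (EuclideanSpace.single ⟨0, Nat.pos_of_ne_zero hn⟩ (1 : ℝ))) h0
    simp at this
  · exact exists_parallelogram_subset_of_frontier hs (hΩ.frontier_eq ▸ ⟨hx, h⟩)

theorem exists_segment_chart {Ω : Set (Euc 1)} (hΩ : IsOpen Ω) (hs : HasSmoothBoundary Ω)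
    {x₀ : Euc 1} (hx : x₀ ∈ closure Ω) : ∃ L : ℝ ≃L[ℝ] Euc 1, ∃ U ∈ 𝓝 x₀, ∃ h : ℝ, 0 < h ∧
      ∀ y ∈ Ω ∩ U, ∀ s ∈ Icc 0 h, y + s • L 1 ∈ Ω := by
  obtain ⟨l, hl, hlU⟩ := exists_parallelogram_subset hΩ hs one_ne_zero hx
  obtain ⟨v, hv⟩ : ∃ v, l v ≠ 0 := by
    by_contra hcon
    push Not at hcon
    exact hl (ContinuousLinearMap.ext hcon)
  -- This choice gives `l e = -(l v)² < 0`, whatever the sign of `l v`.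
  set e : Euc 1 := (-l v) • v with he
  have hle : l e < 0 := by
    rw [he, map_smul, smul_eq_mul]; nlinarith [mul_self_pos.2 hv]
  have he0 : e ≠ 0 := fun h0 => by rw [h0, map_zero] at hle; exact lt_irrefl _ hle
  obtain ⟨U, hU, h, hh, hpar⟩ := hlU e e hle hle
  have hinj : Function.Injective (LinearMap.toSpanSingleton ℝ (Euc 1) e) := by
    intro s t hst
    simpa [he0] using hst
  let L := (LinearMap.linearEquivOfInjective _ hinj (by simp)).toContinuousLinearEquiv
  have hL : L 1 = e := by simp [L]
  refine ⟨L, U, hU, h, hh, fun y hy s hs => ?_⟩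
  simpa [hL] using hpar y hy s hs 0 ⟨le_rfl, hh.le⟩

theorem exists_parallelogram_chart {Ω : Set (Euc 2)} (hΩ : IsOpen Ω) (hs : HasSmoothBoundary Ω)
    {x₀ : Euc 2} (hx : x₀ ∈ closure Ω) : ∃ L : (ℝ × ℝ) ≃L[ℝ] Euc 2, ∃ U ∈ 𝓝 x₀, ∃ h : ℝ, 0 < h ∧
      ∀ y ∈ Ω ∩ U, ∀ s ∈ Icc 0 h, ∀ t ∈ Icc 0 h, y + (s • L (1, 0) + t • L (0, 1)) ∈ Ω := by
  obtain ⟨l, hl, hlU⟩ := exists_parallelogram_subset hΩ hs two_ne_zero hx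
  set a := l (EuclideanSpace.single 0 1) with ha
  set b := l (EuclideanSpace.single 1 1) with hb
  have hlv : ∀ v : Euc 2, l v = v 0 * a + v 1 * b := by
    intro v
    have : v = v 0 • EuclideanSpace.single (0 : Fin 2) (1 : ℝ) +
        v 1 • EuclideanSpace.single (1 : Fin 2) (1 : ℝ) := by
      ext i; fin_cases i <;> simp
    conv_lhs => rw [this]
    rw [map_add, map_smul, map_smul, smul_eq_mul, smul_eq_mul]
  have hab : 0 < a ^ 2 + b ^ 2 := by
    by_contra hcon
    have ha0 : a = 0 := by nlinarith [sq_nonneg a, sq_nonneg b]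
    have hb0 : b = 0 := by nlinarith [sq_nonneg a, sq_nonneg b]
    exact hl (ContinuousLinearMap.ext fun v => by simp [hlv, ha0, hb0])
  -- The directions are `-(a, b)` rotated by 45 degrees either way and scaled by `√2`. They are
  -- orthogonal, and `l` takes the value `-(a² + b²)` on both.
  set e : Euc 2 := !₂[-a - b, a - b] with he
  set f : Euc 2 := !₂[b - a, -a - b] with hf
  have hle : l e < 0 := by rw [hlv]; simp [he]; nlinarith
  have hlf : l f < 0 := by rw [hlv]; simp [hf]; nlinarith
  obtain ⟨U, hU, h, hh, hpar⟩ := hlU e f hle hlf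
  let L₀ : ℝ × ℝ →ₗ[ℝ] Euc 2 :=
    (LinearMap.toSpanSingleton ℝ (Euc 2) e).coprod (LinearMap.toSpanSingleton ℝ (Euc 2) f)
  have hinj : Function.Injective L₀ := by
    rw [injective_iff_map_eq_zero]
    rintro ⟨s, t⟩ hst
    have h0 : s * (-a - b) + t * (b - a) = 0 := by
      have := congrArg (fun v : Euc 2 => v 0) hst
      simpa [L₀, he, hf] using this
    have h1 : s * (a - b) + t * (-a - b) = 0 := by
      have := congrArg (fun v : Euc 2 => v 1) hst
      simpa [L₀, he, hf] using this
    have hs0 : s * (a ^ 2 + b ^ 2) = 0 := by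
      linear_combination (-(a + b) / 2) * h0 - ((b - a) / 2) * h1
    have ht0 : t * (a ^ 2 + b ^ 2) = 0 := by
      linear_combination (-(a + b) / 2) * h1 - ((a - b) / 2) * h0
    have hs' : s = 0 := (mul_eq_zero.1 hs0).resolve_right hab.ne'
    have ht' : t = 0 := (mul_eq_zero.1 ht0).resolve_right hab.ne'
    rw [hs', ht']; rfl
  let L := (LinearMap.linearEquivOfInjective _ hinj (by simp)).toContinuousLinearEquiv
  have hL1 : L (1, 0) = e := by simp [L, L₀]
  have hL2 : L (0, 1) = f := by simp [L, L₀]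
  exact ⟨L, U, hU, h, hh, by rw [hL1, hL2]; exact hpar⟩

end Geometry

/-! ### Linear changes of variables and Fubini along lines -/

section ChangeOfVariables

variable {n : ℕ}

/-- The image of Lebesgue measure under `L` is a Haar measure, hence a nonzero finite multiple of
Lebesgue measure. The value of the factor is never needed. -/
theorem exists_lintegral_comp_eq_mul {F : Type*} [NormedAddCommGroup F] [NormedSpace ℝ F]
    [MeasureSpace F] [BorelSpace F] [Measure.IsAddHaarMeasure (volume : Measure F)]
    (L : F ≃L[ℝ] Euc n) : ∃ c : ℝ≥0∞, c ≠ 0 ∧ c ≠ ⊤ ∧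
      ∀ g : Euc n → ℝ≥0∞, ∫⁻ s, g (L s) = c * ∫⁻ x, g x := by
  have : Measure.IsAddHaarMeasure ((volume : Measure F).map L) :=
    L.isAddHaarMeasure_map volume
  set c := Measure.addHaarScalarFactor ((volume : Measure F).map L) (volume : Measure (Euc n))
  have h : (volume : Measure F).map L = c • (volume : Measure (Euc n)) :=
    Measure.isAddLeftInvariant_eq_smul _ _
  have hc : c ≠ 0 := (Measure.addHaarScalarFactor_pos_of_isAddHaarMeasure _ _).ne'
  refine ⟨c, by simpa using hc, by simp, fun g => ?_⟩
  rw [← smul_eq_mul, ← ENNReal.smul_def, ← lintegral_smul_measure, ← h]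
  exact (lintegral_map_equiv g L.toHomeomorph.toMeasurableEquiv).symm

/-- A two dimensional Loomis–Whitney identity: the integral of a product of two line integrals in
independent directions. -/
theorem exists_lintegral_mul_line_eq (L : (ℝ × ℝ) ≃L[ℝ] Euc n) : ∃ c : ℝ≥0∞, c ≠ ⊤ ∧
    ∀ F G : Euc n → ℝ≥0∞, Measurable F → Measurable G →
      ∫⁻ x, (∫⁻ s : ℝ, F (x + s • L (1, 0))) * (∫⁻ t : ℝ, G (x + t • L (0, 1))) =
        c * ((∫⁻ x, F x) * ∫⁻ x, G x) := by
  obtain ⟨c, hc0, hc, h⟩ := exists_lintegral_comp_eq_mul L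
  refine ⟨c, hc, fun F G hF hG => ?_⟩
  -- In the coordinates of `L`, a full line integral in the first direction depends only on the
  -- second coordinate. The integrand therefore separates.
  have e1 : ∀ p : ℝ × ℝ, ∫⁻ s : ℝ, F (L p + s • L (1, 0)) = ∫⁻ s : ℝ, F (L (s, p.2)) := by
    intro p
    rw [← lintegral_add_left_eq_self (fun s : ℝ => F (L (s, p.2))) p.1]
    refine lintegral_congr fun s => ?_
    rw [← map_smul, ← map_add]
    congr 2
    ext <;> simp
  have e2 : ∀ p : ℝ × ℝ, ∫⁻ t : ℝ, G (L p + t • L (0, 1)) = ∫⁻ t : ℝ, G (L (p.1, t)) := by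
    intro p
    rw [← lintegral_add_left_eq_self (fun t : ℝ => G (L (p.1, t))) p.2]
    refine lintegral_congr fun s => ?_
    rw [← map_smul, ← map_add]
    congr 2
    ext <;> simp
  have mF : Measurable fun p : ℝ × ℝ => F (L p) := hF.comp L.continuous.measurable
  have mG : Measurable fun p : ℝ × ℝ => G (L p) := hG.comp L.continuous.measurable
  have key := h fun x => (∫⁻ s : ℝ, F (x + s • L (1, 0))) * (∫⁻ t : ℝ, G (x + t • L (0, 1)))
  simp only [e1, e2] at key
  have i1 : ∫⁻ p : ℝ × ℝ, (∫⁻ s : ℝ, F (L (s, p.2))) * ∫⁻ t : ℝ, G (L (p.1, t)) =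
      (c * ∫⁻ x, F x) * (c * ∫⁻ x, G x) := by
    rw [← h F, ← h G]
    have mf : Measurable fun t : ℝ => ∫⁻ s : ℝ, F (L (s, t)) := mF.lintegral_prod_left'
    have mg : Measurable fun s : ℝ => ∫⁻ t : ℝ, G (L (s, t)) := mG.lintegral_prod_right'
    simp_rw [mul_comm (∫⁻ s : ℝ, F (L (s, _)))]
    rw [Measure.volume_eq_prod, lintegral_prod_mul mg.aemeasurable mf.aemeasurable,
      lintegral_prod _ mG.aemeasurable, lintegral_prod_symm _ mF.aemeasurable, mul_comm]
  rw [i1] at key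
  rw [← ENNReal.mul_right_inj hc0 hc, ← key]
  ring

theorem ae_ae_add_smul {Q : Euc n → Prop} (h : ∀ᵐ y, Q y) (e : Euc n) :
    ∀ᵐ x : Euc n, ∀ᵐ s : ℝ, Q (x + s • e) := by
  -- A measurable null set containing the exceptional set makes the exchange of the two a.e.
  -- quantifiers legitimate.
  set N := toMeasurable volume {y | ¬ Q y} with hN
  have hN0 : volume N = 0 := by rw [hN, measure_toMeasurable]; exact h
  have hNm : MeasurableSet N := measurableSet_toMeasurable _ _
  have h1 : ∀ᵐ s : ℝ, ∀ᵐ x : Euc n, x + s • e ∉ N := Eventually.of_forall fun s =>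
    (measurePreserving_add_right volume (s • e)).quasiMeasurePreserving.ae
      (measure_eq_zero_iff_ae_notMem.1 hN0)
  have h2 : ∀ᵐ x : Euc n, ∀ᵐ s : ℝ, x + s • e ∉ N := by
    refine (Measure.ae_ae_comm (p := fun (s : ℝ) (x : Euc n) => x + s • e ∉ N) ?_).1 h1
    exact (hNm.preimage (by fun_prop : Measurable fun z : ℝ × Euc n => z.2 + z.1 • e)).compl
  filter_upwards [h2] with x hx
  filter_upwards [hx] with s hs
  by_contra hQ
  exact hs (subset_toMeasurable _ _ hQ)

end ChangeOfVariables

/-! ### Line estimates for elements of `H¹(Ω)` and their squares -/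

section SobolevElements

variable {n : ℕ} {Ω : Set (Euc n)}

theorem PiLp_two_norm_le_sum {ι : Type*} [Fintype ι] {E : ι → Type*}
    [∀ i, NormedAddCommGroup (E i)] (x : PiLp 2 E) : ‖x‖ ≤ ∑ i, ‖x i‖ := by
  rw [PiLp.norm_eq_of_L2]
  exact Real.sqrt_le_iff.2 ⟨Finset.sum_nonneg fun i _ => norm_nonneg _,
    Finset.sum_sq_le_sq_sum_of_nonneg fun i _ => norm_nonneg _⟩

theorem H1.eLpNorm_le (V : H1 Ω) (a : Option (Fin n)) :
    eLpNorm (V.1 a) 2 (volume.restrict Ω) ≤ ‖V‖ₑ := by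
  rw [← Lp.enorm_def]
  exact enorm_le_iff_norm_le.2 (PiLp.norm_apply_le V.1 a)

theorem H2.norm_apply_le (U : H2 Ω) (a : Option (Fin n ⊕ Fin n × Fin n)) : ‖U.1 a‖ ≤ ‖U‖ :=
  PiLp.norm_apply_le U.1 a

/-- The weak partial derivative `∂ᵢU ∈ H¹(Ω)` of `U ∈ H²(Ω)`. -/
def H2.partial (U : H2 Ω) (i : Fin n) : H1 Ω :=
  ⟨WithLp.toLp 2 fun a => a.casesOn (U.1 (some (Sum.inl i))) fun j => U.1 (some (Sum.inr (i, j))),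
    fun j => U.2.2 i j⟩

theorem H1.norm_le_of_forall {V : H1 Ω} {c : ℝ} (h : ∀ a, ‖V.1 a‖ ≤ c) :
    ‖V‖ ≤ (n + 1) * c := by
  refine (PiLp_two_norm_le_sum V.1).trans ((Finset.sum_le_sum fun a _ => h a).trans_eq ?_)
  simp

theorem H2.enorm_toH1_le (U : H2 Ω) : ‖H2.toH1 Ω U‖ₑ ≤ (n + 1 : ℝ≥0∞) * ‖U‖ₑ := by
  have h : ‖H2.toH1 Ω U‖ ≤ (n + 1) * ‖U‖ := H1.norm_le_of_forall fun a => H2.norm_apply_le U _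
  have := ENNReal.ofReal_le_ofReal h
  rw [ENNReal.ofReal_mul (by positivity), ofReal_norm, ofReal_norm] at this
  convert this
  rw [ENNReal.ofReal_add (by positivity) (by norm_num)]; simp

theorem H2.enorm_partial_le (U : H2 Ω) (i : Fin n) :
    ‖H2.partial U i‖ₑ ≤ (n + 1 : ℝ≥0∞) * ‖U‖ₑ := by
  have h : ‖H2.partial U i‖ ≤ (n + 1) * ‖U‖ := by
    refine H1.norm_le_of_forall fun a => ?_
    cases a <;> exact H2.norm_apply_le U _
  have := ENNReal.ofReal_le_ofReal h
  rw [ENNReal.ofReal_mul (by positivity), ofReal_norm, ofReal_norm] at this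
  convert this
  rw [ENNReal.ofReal_add (by positivity) (by norm_num)]; simp

/-- The weak directional derivative of an element of `H¹(Ω)`. -/
noncomputable def H1.dirDeriv (V : H1 Ω) (e : Euc n) : Euc n → ℝ :=
  fun x => ∑ i, e i * V.1 (some i) x

theorem H1.measurable_apply (V : H1 Ω) (a : Option (Fin n)) : Measurable (V.1 a) :=
  (Lp.stronglyMeasurable _).measurable

theorem H1.measurable_dirDeriv (V : H1 Ω) (e : Euc n) : Measurable (H1.dirDeriv V e) :=
  Finset.measurable_fun_sum _ fun _ _ => (H1.measurable_apply V _).const_mul _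

theorem H1.measurable_sq (V : H1 Ω) : Measurable fun x => V.1 none x * V.1 none x :=
  (H1.measurable_apply V none).mul (H1.measurable_apply V none)

theorem H1.hasWeakDirDeriv (V : H1 Ω) (e : Euc n) :
    HasWeakDirDeriv Ω e (V.1 none) (H1.dirDeriv V e) := by
  have he : e = ∑ i, e i • EuclideanSpace.single i (1 : ℝ) := by
    ext j; simp [Finset.sum_apply, Pi.single_apply]
  have h := HasWeakDirDeriv.sum_smul (Ω := Ω) Finset.univ
    (e := fun i => EuclideanSpace.single i (1 : ℝ)) (Lp.memLp (V.1 none))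
    (fun i => Lp.memLp (V.1 (some i))) (fun i => V.2 i) (fun i => e i)
  rw [← he] at h
  exact h

theorem H1.eLpNorm_dirDeriv_le (V : H1 Ω) (e : Euc n) :
    eLpNorm (H1.dirDeriv V e) 2 (volume.restrict Ω) ≤ (∑ i, ‖e i‖ₑ) * ‖V‖ₑ := by
  have h : H1.dirDeriv V e = ∑ i, (e i • (V.1 (some i) : Euc n → ℝ)) := by
    ext x; simp [H1.dirDeriv]
  rw [h]
  refine (eLpNorm_sum_le (fun i _ => ((Lp.memLp (V.1 (some i))).1.const_smul _))
    one_le_two).trans ?_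
  rw [Finset.sum_mul]
  refine Finset.sum_le_sum fun i _ => ?_
  rw [eLpNorm_const_smul]
  gcongr
  exact H1.eLpNorm_le V _

theorem H1.memLp_dirDeriv (V : H1 Ω) (e : Euc n) :
    MemLp (H1.dirDeriv V e) 2 (volume.restrict Ω) :=
  ⟨(H1.measurable_dirDeriv V e).aestronglyMeasurable, (H1.eLpNorm_dirDeriv_le V e).trans_lt
    (ENNReal.mul_lt_top (by simp [ENNReal.sum_lt_top]) (by simp))⟩

/-- The density `h⁻¹ |f| + |g|` on `Ω`, extended by zero. -/
noncomputable def lineDensity (Ω : Set (Euc n)) (f g : Euc n → ℝ) (h : ℝ) : Euc n → ℝ≥0∞ :=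
  Ω.indicator fun y => ENNReal.ofReal h⁻¹ * ‖f y‖ₑ + ‖g y‖ₑ

theorem measurable_lineDensity (hΩ : MeasurableSet Ω) {f g : Euc n → ℝ} (hf : Measurable f)
    (hg : Measurable g) (h : ℝ) : Measurable (lineDensity Ω f g h) :=
  ((hf.enorm.const_mul _).add hg.enorm).indicator hΩ

theorem lintegral_lineDensity (hΩ : MeasurableSet Ω) {f : Euc n → ℝ} (hf : Measurable f)
    (g : Euc n → ℝ) (h : ℝ) : ∫⁻ x, lineDensity Ω f g h x =
      ENNReal.ofReal h⁻¹ * eLpNorm f 1 (volume.restrict Ω) + eLpNorm g 1 (volume.restrict Ω) := by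
  rw [lineDensity, lintegral_indicator hΩ, lintegral_add_left (hf.enorm.const_mul _),
    lintegral_const_mul _ hf.enorm, eLpNorm_one_eq_lintegral_enorm, eLpNorm_one_eq_lintegral_enorm]

/-- Extension by zero supplies functions integrable on the whole space. On a segment inside `Ω` the
extension changes nothing. -/
theorem HasWeakDirDeriv.ae_enorm_le_lintegral_lineDensity (hΩ : IsOpen Ω) {e : Euc n}
    {f g : Euc n → ℝ} (hd : HasWeakDirDeriv Ω e f g) (hfm : Measurable f) (hgm : Measurable g)
    (hf : MemLp f 1 (volume.restrict Ω)) (hg : MemLp g 1 (volume.restrict Ω)) {h : ℝ} (hh : 0 < h) :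
    ∀ᵐ x, (∀ s ∈ Icc 0 h, x + s • e ∈ Ω) →
      ‖f x‖ₑ ≤ ∫⁻ s in Icc 0 h, lineDensity Ω f g h (x + s • e) := by
  have hm := hΩ.measurableSet
  filter_upwards [(hd.indicator hm).ae_enorm_le_lintegral hΩ (hfm.indicator hm)
    (hgm.indicator hm) ((memLp_indicator_iff_restrict hm).2 hf)
    ((memLp_indicator_iff_restrict hm).2 hg) hh] with x hx hs
  have h0 := hx hs
  have hx0 : x ∈ Ω := by simpa using hs 0 ⟨le_rfl, hh.le⟩
  rw [indicator_of_mem hx0] at h0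
  refine h0.trans_eq (setLIntegral_congr_fun measurableSet_Icc fun s hs' => ?_)
  simp only [lineDensity, indicator_of_mem (hs s hs')]

theorem eLpNorm_one_le_mul_eLpNorm_two {f : Euc n → ℝ} (hf : Measurable f) :
    eLpNorm f 1 (volume.restrict Ω) ≤
      volume Ω ^ (1 / 2 : ℝ) * eLpNorm f 2 (volume.restrict Ω) := by
  have := eLpNorm_le_eLpNorm_mul_rpow_measure_univ (μ := volume.restrict Ω) (p := 1) (q := 2)
    one_le_two hf.aestronglyMeasurable
  rw [mul_comm]
  convert this using 2
  norm_num

theorem H1.exists_lintegral_lineDensity_le (hΩ : IsOpen Ω) (hfin : volume Ω ≠ ⊤) (e : Euc n)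
    (h : ℝ) : ∃ C : ℝ≥0∞, C ≠ ⊤ ∧ ∀ V : H1 Ω,
      ∫⁻ x, lineDensity Ω (V.1 none) (H1.dirDeriv V e) h x ≤ C * ‖V‖ₑ := by
  have hv : volume Ω ^ (1 / 2 : ℝ) ≠ ⊤ := ENNReal.rpow_ne_top_of_nonneg (by norm_num) hfin
  refine ⟨ENNReal.ofReal h⁻¹ * volume Ω ^ (1 / 2 : ℝ) +
    volume Ω ^ (1 / 2 : ℝ) * ∑ i, ‖e i‖ₑ, ?_, fun V => ?_⟩
  · exact ENNReal.add_ne_top.2 ⟨ENNReal.mul_ne_top ENNReal.ofReal_ne_top hv,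
      ENNReal.mul_ne_top hv (by simp [ENNReal.sum_eq_top])⟩
  · rw [lintegral_lineDensity hΩ.measurableSet (H1.measurable_apply V _), add_mul, mul_assoc,
      mul_assoc]
    gcongr
    · exact (eLpNorm_one_le_mul_eLpNorm_two (H1.measurable_apply V _)).trans
        (by gcongr; exact H1.eLpNorm_le V _)
    · exact (eLpNorm_one_le_mul_eLpNorm_two (H1.measurable_dirDeriv V e)).trans
        (by gcongr; exact H1.eLpNorm_dirDeriv_le V e)

theorem H1.ae_enorm_le_lintegral_lineDensity (V : H1 Ω) (hΩ : IsOpen Ω) (hfin : volume Ω ≠ ⊤)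
    (e : Euc n) {h : ℝ} (hh : 0 < h) : ∀ᵐ x, (∀ s ∈ Icc 0 h, x + s • e ∈ Ω) →
      ‖V.1 none x‖ₑ ≤ ∫⁻ s in Icc 0 h,
        lineDensity Ω (V.1 none) (H1.dirDeriv V e) h (x + s • e) := by
  have : IsFiniteMeasure (volume.restrict Ω) := isFiniteMeasure_restrict.2 hfin
  exact (H1.hasWeakDirDeriv V e).ae_enorm_le_lintegral_lineDensity hΩ (H1.measurable_apply V _)
    (H1.measurable_dirDeriv V e) ((Lp.memLp (V.1 none)).mono_exponent one_le_two)
    ((H1.memLp_dirDeriv V e).mono_exponent one_le_two) hh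

/-- The derivative `2 V ∂ₑV` of `V²`. -/
noncomputable def H1.sqDeriv (V : H1 Ω) (e : Euc n) : Euc n → ℝ := fun x =>
  H1.dirDeriv V e x * V.1 none x + V.1 none x * H1.dirDeriv V e x

theorem H1.measurable_sqDeriv (V : H1 Ω) (e : Euc n) : Measurable (H1.sqDeriv V e) :=
  ((H1.measurable_dirDeriv V e).mul (H1.measurable_apply V _)).add
    ((H1.measurable_apply V _).mul (H1.measurable_dirDeriv V e))

theorem H1.eLpNorm_sqDeriv_le (V : H1 Ω) (e : Euc n) :
    eLpNorm (H1.sqDeriv V e) 1 (volume.restrict Ω) ≤ (2 * ∑ i, ‖e i‖ₑ) * ‖V‖ₑ ^ 2 := by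
  have m1 := (H1.measurable_dirDeriv V e).aestronglyMeasurable (μ := volume.restrict Ω)
  have m2 := (H1.measurable_apply V none).aestronglyMeasurable (μ := volume.restrict Ω)
  have hV := H1.eLpNorm_le V none
  have hV' := H1.eLpNorm_dirDeriv_le V e
  have e1 : eLpNorm (fun x => H1.dirDeriv V e x * V.1 none x) 1 (volume.restrict Ω) ≤
      ((∑ i, ‖e i‖ₑ) * ‖V‖ₑ) * ‖V‖ₑ :=
    (eLpNorm_mul_le_of_holderTriple (p := 2) (q := 2) m1 m2).trans (mul_le_mul' hV' hV)
  have e2 : eLpNorm (fun x => V.1 none x * H1.dirDeriv V e x) 1 (volume.restrict Ω) ≤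
      ‖V‖ₑ * ((∑ i, ‖e i‖ₑ) * ‖V‖ₑ) :=
    (eLpNorm_mul_le_of_holderTriple (p := 2) (q := 2) m2 m1).trans (mul_le_mul' hV hV')
  calc _ ≤ ((∑ i, ‖e i‖ₑ) * ‖V‖ₑ) * ‖V‖ₑ + ‖V‖ₑ * ((∑ i, ‖e i‖ₑ) * ‖V‖ₑ) :=
        (eLpNorm_add_le (m1.mul m2) (m2.mul m1) le_rfl).trans (add_le_add e1 e2)
    _ = _ := by ring

theorem H1.eLpNorm_sq_le (V : H1 Ω) :
    eLpNorm (fun x => V.1 none x * V.1 none x) 1 (volume.restrict Ω) ≤ ‖V‖ₑ ^ 2 := by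
  have m2 := (H1.measurable_apply V none).aestronglyMeasurable (μ := volume.restrict Ω)
  rw [sq]
  exact (eLpNorm_mul_le_of_holderTriple (p := 2) (q := 2) m2 m2).trans (mul_le_mul' (H1.eLpNorm_le V _) (H1.eLpNorm_le V _))

theorem H1.exists_lintegral_lineDensity_sq_le (hΩ : IsOpen Ω) (e : Euc n) (h : ℝ) :
    ∃ C : ℝ≥0∞, C ≠ ⊤ ∧ ∀ V : H1 Ω,
      ∫⁻ x, lineDensity Ω (fun x => V.1 none x * V.1 none x) (H1.sqDeriv V e) h x
        ≤ C * ‖V‖ₑ ^ 2 := by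
  refine ⟨ENNReal.ofReal h⁻¹ + 2 * ∑ i, ‖e i‖ₑ, ?_, fun V => ?_⟩
  · exact ENNReal.add_ne_top.2 ⟨ENNReal.ofReal_ne_top,
      ENNReal.mul_ne_top (by simp) (by simp [ENNReal.sum_eq_top])⟩
  · rw [lintegral_lineDensity hΩ.measurableSet (H1.measurable_sq V),
      add_mul]
    gcongr
    · exact H1.eLpNorm_sq_le V
    · exact H1.eLpNorm_sqDeriv_le V e

/-- The line estimate is applied to `V²`, which has weak derivatives in `L¹`. The product rule asks
only that the factors and their derivatives be in `L²`. -/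
theorem H1.ae_enorm_sq_le_lintegral_lineDensity (V : H1 Ω) (hΩ : IsOpen Ω)
    (e : Euc n) {h : ℝ} (hh : 0 < h) : ∀ᵐ x, (∀ s ∈ Icc 0 h, x + s • e ∈ Ω) →
      ‖V.1 none x‖ₑ ^ 2 ≤ ∫⁻ s in Icc 0 h,
        lineDensity Ω (fun x => V.1 none x * V.1 none x) (H1.sqDeriv V e) h (x + s • e) := by
  have hV := Lp.memLp (V.1 none)
  have hV' := H1.memLp_dirDeriv V e
  have hd : HasWeakDirDeriv Ω e (fun x => V.1 none x * V.1 none x) (H1.sqDeriv V e) :=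
    (H1.hasWeakDirDeriv V e).mul hΩ hV hV' hV hV' (H1.hasWeakDirDeriv V e)
  filter_upwards [hd.ae_enorm_le_lintegral_lineDensity hΩ
    (H1.measurable_sq V) (H1.measurable_sqDeriv V e)
    (memLp_one_iff_integrable.2 (hV.integrable_fun_mul hV))
    (memLp_one_iff_integrable.2
      ((hV'.integrable_fun_mul hV).add (hV.integrable_fun_mul hV'))) hh] with x hx hs
  have := hx hs
  rwa [enorm_mul, ← sq] at this

end SobolevElements

/-! ### Sobolev embeddings by compactness of the closure -/

section Embeddings

/-- `H¹ ⊂ L^∞` in dimension one. -/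
theorem H1.exists_ae_enorm_le_of_dim_one {Ω : Set (Euc 1)} (hΩ : IsOpen Ω)
    (hb : Bornology.IsBounded Ω) (hs : HasSmoothBoundary Ω) : ∃ C : ℝ≥0∞, C ≠ ⊤ ∧
      ∀ V : H1 Ω, ∀ᵐ x ∂volume.restrict Ω, ‖V.1 none x‖ₑ ≤ C * ‖V‖ₑ := by
  have hfin : volume Ω ≠ ⊤ := hb.measure_lt_top.ne
  suffices H : ∃ C : ℝ≥0∞, C ≠ ⊤ ∧ ∀ V : H1 Ω, ∀ᵐ x, x ∈ Ω ∩ closure Ω →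
      ‖V.1 none x‖ₑ ≤ C * ‖V‖ₑ by
    obtain ⟨C, hC, h⟩ := H
    refine ⟨C, hC, fun V => (ae_restrict_iff' hΩ.measurableSet).2 ?_⟩
    filter_upwards [h V] with x hx hxΩ using hx ⟨hxΩ, subset_closure hxΩ⟩
  refine hb.isCompact_closure.induction_on (p := fun S => ∃ C : ℝ≥0∞, C ≠ ⊤ ∧ ∀ V : H1 Ω,
    ∀ᵐ x, x ∈ Ω ∩ S → ‖V.1 none x‖ₑ ≤ C * ‖V‖ₑ) ⟨0, by simp, by simp⟩ ?_ ?_ ?_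
  · rintro S T hST ⟨C, hC, h⟩
    refine ⟨C, hC, fun V => ?_⟩
    filter_upwards [h V] with x hx hxS using hx ⟨hxS.1, hST hxS.2⟩
  · rintro S T ⟨C, hC, h⟩ ⟨C', hC', h'⟩
    refine ⟨C + C', ENNReal.add_ne_top.2 ⟨hC, hC'⟩, fun V => ?_⟩
    filter_upwards [h V, h' V] with x hx hx' hxS
    rw [add_mul]
    rcases hxS.2 with hS | hT
    · exact (hx ⟨hxS.1, hS⟩).trans le_self_add
    · exact (hx' ⟨hxS.1, hT⟩).trans le_add_self
  · intro x₀ hx₀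
    obtain ⟨L, U, hU, h, hh, hseg⟩ := exists_segment_chart hΩ hs hx₀
    obtain ⟨c, -, hc, hcL⟩ := exists_lintegral_comp_eq_mul L
    obtain ⟨C, hC, hCV⟩ := H1.exists_lintegral_lineDensity_le hΩ hfin (L 1) h
    refine ⟨U, mem_nhdsWithin_of_mem_nhds hU, c * C, ENNReal.mul_ne_top hc hC, fun V => ?_⟩
    filter_upwards [H1.ae_enorm_le_lintegral_lineDensity V hΩ hfin (L 1) hh] with x hx hxU
    refine (hx (hseg x hxU)).trans ((setLIntegral_le_lintegral _ _).trans ?_)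
    -- In dimension one the line through `x` is the whole space, so the line integral becomes a
    -- volume integral.
    have e1 : ∀ s : ℝ, x + s • L 1 = x + L s := fun s => by
      rw [← map_smul, smul_eq_mul, mul_one]
    simp_rw [e1]
    rw [hcL fun y => lineDensity Ω (V.1 none) (H1.dirDeriv V (L 1)) h (x + y),
      lintegral_add_left_eq_self, mul_assoc]
    gcongr
    exact hCV V

/-- `H² ⊂ L^∞` in dimension two. -/
theorem H2.exists_ae_enorm_le_of_dim_two {Ω : Set (Euc 2)} (hΩ : IsOpen Ω)
    (hb : Bornology.IsBounded Ω) (hs : HasSmoothBoundary Ω) : ∃ C : ℝ≥0∞, C ≠ ⊤ ∧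
      ∀ U : H2 Ω, ∀ᵐ x ∂volume.restrict Ω, ‖H2.fn U x‖ₑ ≤ C * ‖U‖ₑ := by
  have hfin : volume Ω ≠ ⊤ := hb.measure_lt_top.ne
  have hm := hΩ.measurableSet
  suffices H : ∃ C : ℝ≥0∞, C ≠ ⊤ ∧ ∀ V : H2 Ω, ∀ᵐ x, x ∈ Ω ∩ closure Ω →
      ‖H2.fn V x‖ₑ ≤ C * ‖V‖ₑ by
    obtain ⟨C, hC, h⟩ := H
    refine ⟨C, hC, fun V => (ae_restrict_iff' hm).2 ?_⟩
    filter_upwards [h V] with x hx hxΩ using hx ⟨hxΩ, subset_closure hxΩ⟩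
  refine hb.isCompact_closure.induction_on (p := fun S => ∃ C : ℝ≥0∞, C ≠ ⊤ ∧ ∀ V : H2 Ω,
    ∀ᵐ x, x ∈ Ω ∩ S → ‖H2.fn V x‖ₑ ≤ C * ‖V‖ₑ) ⟨0, by simp, by simp⟩ ?_ ?_ ?_
  · rintro S T hST ⟨C, hC, h⟩
    refine ⟨C, hC, fun V => ?_⟩
    filter_upwards [h V] with x hx hxS using hx ⟨hxS.1, hST hxS.2⟩
  · rintro S T ⟨C, hC, h⟩ ⟨C', hC', h'⟩
    refine ⟨C + C', ENNReal.add_ne_top.2 ⟨hC, hC'⟩, fun V => ?_⟩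
    filter_upwards [h V, h' V] with x hx hx' hxS
    rw [add_mul]
    rcases hxS.2 with hS | hT
    · exact (hx ⟨hxS.1, hS⟩).trans le_self_add
    · exact (hx' ⟨hxS.1, hT⟩).trans le_add_self
  · intro x₀ hx₀
    obtain ⟨L, W, hW, h, hh, hpar⟩ := exists_parallelogram_chart hΩ hs hx₀
    obtain ⟨c, -, hc, hcL⟩ := exists_lintegral_comp_eq_mul L
    set e := L (1, 0) with he
    set f := L (0, 1) with hf
    obtain ⟨C, hC, hCV⟩ := H1.exists_lintegral_lineDensity_le hΩ hfin f h
    let N : H1 Ω → Euc 2 → ℝ≥0∞ := fun V => lineDensity Ω (V.1 none) (H1.dirDeriv V f) h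
    have mN : ∀ V, Measurable (N V) := fun V =>
      measurable_lineDensity hm (H1.measurable_apply V _) (H1.measurable_dirDeriv V f) h
    -- The estimate along `e` involves `U` and its first derivatives. Each of these is bounded by an
    -- integral along `f`, and `H` collects the resulting densities, which contain second
    -- derivatives.
    let H : H2 Ω → Euc 2 → ℝ≥0∞ := fun U y =>
      ENNReal.ofReal h⁻¹ * N (H2.toH1 Ω U) y + ∑ i, ‖e i‖ₑ * N (H2.partial U i) y
    have mH : ∀ U, Measurable (H U) := fun U => ((mN _).const_mul _).add
      (Finset.measurable_fun_sum _ fun i _ => (mN _).const_mul _)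
    set K : ℝ≥0∞ := (ENNReal.ofReal h⁻¹ + ∑ i, ‖e i‖ₑ) * (C * ((2 : ℕ) + 1)) with hK
    have hKtop : K ≠ ⊤ := by
      refine ENNReal.mul_ne_top (ENNReal.add_ne_top.2 ⟨ENNReal.ofReal_ne_top, ?_⟩)
        (ENNReal.mul_ne_top hC ?_)
      · simp
      · norm_num
    have hHint : ∀ U, ∫⁻ y, H U y ≤ K * ‖U‖ₑ := by
      intro U
      rw [lintegral_add_left ((mN _).const_mul _), lintegral_const_mul _ (mN _),
        lintegral_finsetSum _ fun i _ => (mN _).const_mul _, hK, mul_assoc, add_mul,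
        Finset.sum_mul, mul_assoc]
      refine add_le_add ?_ (Finset.sum_le_sum fun i _ => ?_)
      · gcongr
        exact (hCV _).trans (by gcongr; exact H2.enorm_toH1_le U)
      · rw [lintegral_const_mul _ (mN _)]
        gcongr
        exact (hCV _).trans (by gcongr; exact H2.enorm_partial_le U i)
    refine ⟨W, mem_nhdsWithin_of_mem_nhds hW, c * K, ENNReal.mul_ne_top hc hKtop, fun U => ?_⟩
    have a0 := H1.ae_enorm_le_lintegral_lineDensity (H2.toH1 Ω U) hΩ hfin f hh
    have ai : ∀ i, _ := fun i => H1.ae_enorm_le_lintegral_lineDensity (H2.partial U i) hΩ hfin f hh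
    -- The second estimate is used at the points `x + s • e` of a segment, itself a null set, so it
    -- must be known for a.e. `x` at a.e. `s`.
    have a1 := ae_ae_add_smul (a0.and (ae_all_iff.2 ai)) e
    filter_upwards [H1.ae_enorm_le_lintegral_lineDensity (H2.toH1 Ω U) hΩ hfin e hh, a1]
      with x hx hx1 hxW
    have hmem : ∀ s ∈ Icc 0 h, ∀ t ∈ Icc 0 h, x + s • e + t • f ∈ Ω := fun s hs t ht => by
      rw [add_assoc]; exact hpar x hxW s hs t ht
    have hmem0 : ∀ s ∈ Icc 0 h, x + s • e ∈ Ω := fun s hs => by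
      simpa using hmem s hs 0 ⟨le_rfl, hh.le⟩
    calc ‖H2.fn U x‖ₑ ≤ ∫⁻ s in Icc 0 h, lineDensity Ω ((H2.toH1 Ω U).1 none)
            (H1.dirDeriv (H2.toH1 Ω U) e) h (x + s • e) := hx hmem0
      _ ≤ ∫⁻ s in Icc 0 h, ∫⁻ t in Icc 0 h, H U (x + s • e + t • f) := by
          refine lintegral_mono_ae ((ae_restrict_iff' measurableSet_Icc).2 ?_)
          filter_upwards [hx1] with s hs1 hs
          have b0 := hs1.1 (hmem s hs)
          have bi := fun i => hs1.2 i (hmem s hs)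
          have ml : Measurable fun t : ℝ => x + s • e + t • f := by fun_prop
          have mNl : ∀ V, Measurable fun t : ℝ => N V (x + s • e + t • f) :=
            fun V => (mN V).comp ml
          have e1 : ∫⁻ t in Icc 0 h, H U (x + s • e + t • f) =
              ENNReal.ofReal h⁻¹ * (∫⁻ t in Icc 0 h, N (H2.toH1 Ω U) (x + s • e + t • f)) +
              ∑ i, ‖e i‖ₑ * ∫⁻ t in Icc 0 h, N (H2.partial U i) (x + s • e + t • f) := by
            rw [lintegral_add_left ((mNl _).const_mul _), lintegral_const_mul _ (mNl _),
              lintegral_finsetSum _ fun i _ => (mNl _).const_mul _]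
            congr 1
            exact Finset.sum_congr rfl fun i _ => lintegral_const_mul _ (mNl _)
          rw [e1, lineDensity, indicator_of_mem (hmem0 s hs)]
          refine add_le_add (by gcongr) ?_
          refine (enorm_sum_le _ _).trans (Finset.sum_le_sum fun i _ => ?_)
          rw [enorm_mul]
          gcongr
          exact bi i
      _ ≤ ∫⁻ s : ℝ, ∫⁻ t : ℝ, H U (x + s • e + t • f) :=
          (setLIntegral_le_lintegral _ _).trans
            (lintegral_mono fun s => setLIntegral_le_lintegral _ _)
      _ = ∫⁻ p : ℝ × ℝ, H U (x + L p) := by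
          have mp : Measurable fun p : ℝ × ℝ => H U (x + L p) :=
            (mH U).comp (measurable_const.add L.continuous.measurable)
          rw [Measure.volume_eq_prod, lintegral_prod _ mp.aemeasurable]
          refine lintegral_congr fun s => lintegral_congr fun t => ?_
          congr 1
          rw [he, hf, ← map_smul, ← map_smul, add_assoc, ← map_add]
          congr 2
          ext <;> simp
      _ = c * ∫⁻ y, H U y := by
          rw [hcL fun y => H U (x + y), lintegral_add_left_eq_self]
      _ ≤ c * K * ‖U‖ₑ := by
          rw [mul_assoc]; gcongr; exact hHint U

/-- `H¹ ⊂ L⁴` in dimension two. -/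
theorem H1.exists_lintegral_pow_four_le_of_dim_two {Ω : Set (Euc 2)} (hΩ : IsOpen Ω)
    (hb : Bornology.IsBounded Ω) (hs : HasSmoothBoundary Ω) : ∃ C : ℝ≥0∞, C ≠ ⊤ ∧
      ∀ V : H1 Ω, ∫⁻ x in Ω, ‖V.1 none x‖ₑ ^ 4 ≤ C * ‖V‖ₑ ^ 4 := by
  suffices H : ∃ C : ℝ≥0∞, C ≠ ⊤ ∧ ∀ V : H1 Ω,
      ∫⁻ x in Ω ∩ closure Ω, ‖V.1 none x‖ₑ ^ 4 ≤ C * ‖V‖ₑ ^ 4 by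
    rwa [inter_eq_left.2 subset_closure] at H
  refine hb.isCompact_closure.induction_on (p := fun S => ∃ C : ℝ≥0∞, C ≠ ⊤ ∧ ∀ V : H1 Ω,
    ∫⁻ x in Ω ∩ S, ‖V.1 none x‖ₑ ^ 4 ≤ C * ‖V‖ₑ ^ 4) ⟨0, by simp, by simp⟩ ?_ ?_ ?_
  · rintro S T hST ⟨C, hC, h⟩
    exact ⟨C, hC, fun V => (lintegral_mono_set (inter_subset_inter_right _ hST)).trans (h V)⟩
  · rintro S T ⟨C, hC, h⟩ ⟨C', hC', h'⟩
    refine ⟨C + C', ENNReal.add_ne_top.2 ⟨hC, hC'⟩, fun V => ?_⟩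
    rw [inter_union_distrib_left, add_mul]
    exact (lintegral_union_le _ _ _).trans (add_le_add (h V) (h' V))
  · intro x₀ hx₀
    obtain ⟨L, W, hW, h, hh, hpar⟩ := exists_parallelogram_chart hΩ hs hx₀
    obtain ⟨c, hc, hcL⟩ := exists_lintegral_mul_line_eq L
    obtain ⟨C₁, hC₁, hCV₁⟩ := H1.exists_lintegral_lineDensity_sq_le hΩ (L (1, 0)) h
    obtain ⟨C₂, hC₂, hCV₂⟩ := H1.exists_lintegral_lineDensity_sq_le hΩ (L (0, 1)) h
    -- An open neighbourhood is chosen so that `Ω ∩ W'` is measurable.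
    obtain ⟨W', hW'W, hW'o, hxW'⟩ := mem_nhds_iff.1 hW
    refine ⟨W', mem_nhdsWithin_of_mem_nhds (hW'o.mem_nhds hxW'), c * (C₁ * C₂),
      ENNReal.mul_ne_top hc (ENNReal.mul_ne_top hC₁ hC₂), fun V => ?_⟩
    set F := lineDensity Ω (fun x => V.1 none x * V.1 none x) (H1.sqDeriv V (L (1, 0))) h
    set G := lineDensity Ω (fun x => V.1 none x * V.1 none x) (H1.sqDeriv V (L (0, 1))) h
    have mF : Measurable F := measurable_lineDensity hΩ.measurableSet
      (H1.measurable_sq V) (H1.measurable_sqDeriv V _) h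
    have mG : Measurable G := measurable_lineDensity hΩ.measurableSet
      (H1.measurable_sq V) (H1.measurable_sqDeriv V _) h
    calc ∫⁻ x in Ω ∩ W', ‖V.1 none x‖ₑ ^ 4
        ≤ ∫⁻ x in Ω ∩ W', (∫⁻ s : ℝ, F (x + s • L (1, 0))) * (∫⁻ t : ℝ, G (x + t • L (0, 1))) := by
          refine lintegral_mono_ae ((ae_restrict_iff' (hΩ.inter hW'o).measurableSet).2 ?_)
          filter_upwards [H1.ae_enorm_sq_le_lintegral_lineDensity V hΩ (L (1, 0)) hh,
            H1.ae_enorm_sq_le_lintegral_lineDensity V hΩ (L (0, 1)) hh] with x h1 h2 hx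
          have e4 : ‖V.1 none x‖ₑ ^ 4 = ‖V.1 none x‖ₑ ^ 2 * ‖V.1 none x‖ₑ ^ 2 := by ring
          rw [e4]
          -- One factor `V²` is bounded along each direction, which yields the product form needed
          -- for the Loomis–Whitney identity.
          refine mul_le_mul' ((h1 fun s hs => ?_).trans (setLIntegral_le_lintegral _ _))
            ((h2 fun t ht => ?_).trans (setLIntegral_le_lintegral _ _))
          · simpa using hpar x ⟨hx.1, hW'W hx.2⟩ s hs 0 ⟨le_rfl, hh.le⟩
          · simpa using hpar x ⟨hx.1, hW'W hx.2⟩ 0 ⟨le_rfl, hh.le⟩ t ht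
      _ ≤ ∫⁻ x, (∫⁻ s : ℝ, F (x + s • L (1, 0))) * (∫⁻ t : ℝ, G (x + t • L (0, 1))) :=
          setLIntegral_le_lintegral _ _
      _ = c * ((∫⁻ x, F x) * ∫⁻ x, G x) := hcL F G mF mG
      _ ≤ c * ((C₁ * ‖V‖ₑ ^ 2) * (C₂ * ‖V‖ₑ ^ 2)) := by
          gcongr
          · exact hCV₁ V
          · exact hCV₂ V
      _ = c * (C₁ * C₂) * ‖V‖ₑ ^ 4 := by ring

end Embeddings

/-! ### The product on `H²(Ω)` -/

section Algebra

variable {n : ℕ} {Ω : Set (Euc n)} {C : ℝ}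

/-- The embeddings `H²(Ω) ⊂ L^∞(Ω)` and `H¹(Ω) ⊂ L⁴(Ω)`, with a common constant. -/
structure SobolevEmbedding (Ω : Set (Euc n)) (C : ℝ) : Prop where
  isOpen : IsOpen Ω
  volume_ne_top : volume Ω ≠ ⊤
  nonneg : 0 ≤ C
  ae_abs_le : ∀ U : H2 Ω, ∀ᵐ x ∂volume.restrict Ω, |H2.fn U x| ≤ C * ‖U‖
  eLpNorm_four_le : ∀ V : H1 Ω, eLpNorm (V.1 none) 4 (volume.restrict Ω) ≤ ENNReal.ofReal (C * ‖V‖)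

theorem abs_le_toReal_mul_of_enorm_le {E : Type*} [NormedAddCommGroup E] {c : ℝ≥0∞} (hc : c ≠ ⊤)
    {a : ℝ} {V : E} (h : ‖a‖ₑ ≤ c * ‖V‖ₑ) : |a| ≤ c.toReal * ‖V‖ := by
  have := ENNReal.toReal_mono (ENNReal.mul_ne_top hc (by simp)) h
  simpa [ENNReal.toReal_mul] using this

/-- In dimension one, the `L^∞` bound on `H¹` gives both embeddings: the factor 2 compares the `H¹`
and `H²` norms, and `|Ω|^(1/4)` passes from `L^∞` to `L⁴`. In dimension two the embeddings are
separate, and their constants are added. -/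
theorem exists_sobolevEmbedding (hn : n = 1 ∨ n = 2) (hΩ : IsOpen Ω)
    (hb : Bornology.IsBounded Ω) (hs : HasSmoothBoundary Ω) : ∃ C, SobolevEmbedding Ω C := by
  have hfin : volume Ω ≠ ⊤ := hb.measure_lt_top.ne
  rcases hn with rfl | rfl
  · obtain ⟨c, hc, h⟩ := H1.exists_ae_enorm_le_of_dim_one hΩ hb hs
    have hv : volume Ω ^ (4 : ℝ)⁻¹ ≠ ⊤ := ENNReal.rpow_ne_top_of_nonneg (by norm_num) hfin
    have hV : ∀ V : H1 Ω, ∀ᵐ x ∂volume.restrict Ω, |V.1 none x| ≤ c.toReal * ‖V‖ := fun V => by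
      filter_upwards [h V] with x hx using abs_le_toReal_mul_of_enorm_le hc hx
    refine ⟨c.toReal * 2 + (volume Ω ^ (4 : ℝ)⁻¹).toReal * c.toReal, hΩ, hfin, by positivity,
      fun U => ?_, fun V => ?_⟩
    · filter_upwards [hV (H2.toH1 Ω U)] with x hx
      refine le_trans hx ?_
      have : ‖H2.toH1 Ω U‖ ≤ ((1 : ℕ) + 1) * ‖U‖ :=
        H1.norm_le_of_forall fun a => H2.norm_apply_le U _
      calc c.toReal * ‖H2.toH1 Ω U‖ ≤ c.toReal * (((1 : ℕ) + 1) * ‖U‖) := by gcongr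
        _ ≤ _ := by
          have := mul_nonneg (mul_nonneg (volume Ω ^ (4 : ℝ)⁻¹).toReal_nonneg c.toReal_nonneg)
            (norm_nonneg U)
          push_cast
          linarith
    · have h4 := eLpNorm_le_of_ae_bound (p := 4) (f := V.1 none) (C := c.toReal * ‖V‖) (hV V)
      refine h4.trans ?_
      rw [Measure.restrict_apply_univ]
      have e4 : ((4 : ℝ≥0∞).toReal)⁻¹ = (4 : ℝ)⁻¹ := by norm_num
      rw [e4, ← ENNReal.ofReal_toReal hv, ← ENNReal.ofReal_mul ENNReal.toReal_nonneg,
        ENNReal.ofReal_toReal hv]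
      refine ENNReal.ofReal_le_ofReal ?_
      have := mul_nonneg c.toReal_nonneg (norm_nonneg V)
      nlinarith
  · obtain ⟨c, hc, h⟩ := H2.exists_ae_enorm_le_of_dim_two hΩ hb hs
    obtain ⟨d, hd, h'⟩ := H1.exists_lintegral_pow_four_le_of_dim_two hΩ hb hs
    have hdt : d ^ (4 : ℝ)⁻¹ ≠ ⊤ := ENNReal.rpow_ne_top_of_nonneg (by norm_num) hd
    refine ⟨c.toReal + (d ^ (4 : ℝ)⁻¹).toReal, hΩ, hfin, by positivity, fun U => ?_, fun V => ?_⟩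
    · filter_upwards [h U] with x hx
      refine (abs_le_toReal_mul_of_enorm_le hc hx).trans ?_
      gcongr
      exact le_add_of_nonneg_right ENNReal.toReal_nonneg
    · rw [eLpNorm_eq_lintegral_rpow_enorm_toReal (by norm_num) (by norm_num)]
      have e4 : (4 : ℝ≥0∞).toReal = (4 : ℝ) := by norm_num
      rw [e4, one_div]
      have e : ∫⁻ x in Ω, ‖V.1 none x‖ₑ ^ (4 : ℝ) ≤ d * ‖V‖ₑ ^ (4 : ℝ) := by
        have := h' V
        simp only [← ENNReal.rpow_natCast] at this
        exact_mod_cast this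
      calc _ ≤ (d * ‖V‖ₑ ^ (4 : ℝ)) ^ (4 : ℝ)⁻¹ := ENNReal.rpow_le_rpow e (by norm_num)
        _ = d ^ (4 : ℝ)⁻¹ * ‖V‖ₑ := by
          rw [ENNReal.mul_rpow_of_nonneg _ _ (by norm_num), ← ENNReal.rpow_mul,
            mul_inv_cancel₀ (by norm_num), ENNReal.rpow_one]
        _ = ENNReal.ofReal ((d ^ (4 : ℝ)⁻¹).toReal * ‖V‖) := by
          rw [ENNReal.ofReal_mul ENNReal.toReal_nonneg, ENNReal.ofReal_toReal hdt, ofReal_norm]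
        _ ≤ _ := ENNReal.ofReal_le_ofReal (by
          gcongr
          exact le_add_of_nonneg_left ENNReal.toReal_nonneg)

theorem H1_ext (hΩ : IsOpen Ω) {U V : H1 Ω} (h : U.1 none =ᵐ[volume.restrict Ω] V.1 none) :
    U = V := by
  have h0 : U.1 none = V.1 none := Lp.ext h
  refine Subtype.ext (PiLp.ext ?_)
  rintro (_ | i)
  exacts [h0, (U.2 i).unique hΩ (h0 ▸ V.2 i)]

theorem Lp_norm_toLp_le {f : Euc n → ℝ} (hf : MemLp f 2 (volume.restrict Ω)) {c : ℝ} (hc : 0 ≤ c)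
    (h : eLpNorm f 2 (volume.restrict Ω) ≤ ENNReal.ofReal c) : ‖hf.toLp f‖ ≤ c := by
  rw [Lp.norm_toLp]
  exact ENNReal.toReal_le_of_le_ofReal hc h

theorem H2.norm_partial_le (U : H2 Ω) (i : Fin n) : ‖H2.partial U i‖ ≤ (n + 1) * ‖U‖ :=
  H1.norm_le_of_forall fun a => by cases a <;> exact H2.norm_apply_le U _

theorem H1.norm_apply_le (V : H1 Ω) (a : Option (Fin n)) : ‖V.1 a‖ ≤ ‖V‖ :=
  PiLp.norm_apply_le V.1 a

theorem H2.measurable_fn (U : H2 Ω) : Measurable (H2.fn U) := (Lp.stronglyMeasurable _).measurable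

theorem H2.memLp_fn (U : H2 Ω) : MemLp (H2.fn U) 2 (volume.restrict Ω) := Lp.memLp _

namespace SobolevEmbedding

variable (h : SobolevEmbedding Ω C)
include h

/-- Hölder with `1/4 + 1/4 = 1/2`. This controls products of two first derivatives in `L²`. -/
theorem eLpNorm_mul_four_le (V W : H1 Ω) :
    eLpNorm (fun x => V.1 none x * W.1 none x) 2 (volume.restrict Ω) ≤
      ENNReal.ofReal (C ^ 2 * ‖V‖ * ‖W‖) := by
  have : ENNReal.HolderTriple 4 4 2 := ⟨by
    rw [← two_mul, show (4 : ℝ≥0∞) = 2 * 2 by norm_num, ENNReal.mul_inv (by simp) (by simp),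
      ← mul_assoc, ENNReal.mul_inv_cancel (by simp) (by simp), one_mul]⟩
  refine (eLpNorm_mul_le_of_holderTriple (p := 4) (q := 4)
    (H1.measurable_apply V _).aestronglyMeasurable
    (H1.measurable_apply W _).aestronglyMeasurable).trans
    ((mul_le_mul' (h.eLpNorm_four_le V) (h.eLpNorm_four_le W)).trans_eq ?_)
  rw [← ENNReal.ofReal_mul (mul_nonneg h.nonneg (norm_nonneg _))]
  ring_nf

theorem memLp_mul_four (V W : H1 Ω) :
    MemLp (fun x => V.1 none x * W.1 none x) 2 (volume.restrict Ω) :=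
  ⟨((H1.measurable_apply V _).mul (H1.measurable_apply W _)).aestronglyMeasurable,
    (h.eLpNorm_mul_four_le V W).trans_lt ENNReal.ofReal_lt_top⟩

theorem memLp_mul_fn (U : H2 Ω) (f : L2 Ω) :
    MemLp (fun x => f x * H2.fn U x) 2 (volume.restrict Ω) :=
  (Lp.memLp f).mul_bounded (H2.measurable_fn U).aestronglyMeasurable (h.ae_abs_le U)

/-- The product of the values of two elements of `H¹(Ω)`. -/
noncomputable def mulFour (V W : H1 Ω) : L2 Ω := (h.memLp_mul_four V W).toLp _

/-- The product of a square integrable function and the values of an element of `H²(Ω)`. -/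
noncomputable def mulFn (U : H2 Ω) (f : L2 Ω) : L2 Ω := (h.memLp_mul_fn U f).toLp _

theorem norm_mulFour_le (V W : H1 Ω) : ‖h.mulFour V W‖ ≤ C ^ 2 * ‖V‖ * ‖W‖ :=
  Lp_norm_toLp_le _ (by positivity) (h.eLpNorm_mul_four_le V W)

theorem coeFn_mulFour (V W : H1 Ω) :
    h.mulFour V W =ᵐ[volume.restrict Ω] fun x => V.1 none x * W.1 none x := MemLp.coeFn_toLp _

theorem coeFn_mulFn (U : H2 Ω) (f : L2 Ω) :
    h.mulFn U f =ᵐ[volume.restrict Ω] fun x => f x * H2.fn U x := MemLp.coeFn_toLp _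

theorem norm_mulFn_le (U : H2 Ω) (f : L2 Ω) : ‖h.mulFn U f‖ ≤ C * ‖U‖ * ‖f‖ := by
  refine Lp.norm_le_mul_norm_of_ae_le_mul ?_
  filter_upwards [h.coeFn_mulFn U f, h.ae_abs_le U] with x hx hU
  rw [hx, norm_mul, mul_comm]
  exact mul_le_mul_of_nonneg_right hU (norm_nonneg _)

/-- The product of an element of `H²(Ω)` and an element of `H¹(Ω)`. -/
noncomputable def mulH1 (U : H2 Ω) (V : H1 Ω) : H1 Ω :=
  ⟨WithLp.toLp 2 fun a => a.casesOn (h.mulFn U (V.1 none)) fun i =>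
      h.mulFour (H2.partial U i) V + h.mulFn U (V.1 (some i)), fun i => by
    have hd := HasWeakDirDeriv.mul h.isOpen (H2.memLp_fn U) (Lp.memLp (U.1 (some (Sum.inl i))))
      (Lp.memLp (V.1 none)) (Lp.memLp (V.1 (some i))) (U.2.1 i) (V.2 i)
    refine hd.congr_ae ?_ ?_
    · filter_upwards [h.coeFn_mulFn U (V.1 none)] with x hx
      exact (mul_comm _ _).trans hx.symm
    · filter_upwards [h.coeFn_mulFn U (V.1 (some i)), h.coeFn_mulFour (H2.partial U i) V,
        Lp.coeFn_add (h.mulFour (H2.partial U i) V) (h.mulFn U (V.1 (some i)))] with x h1 h2 h3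
      refine Eq.symm (h3.trans ?_)
      rw [Pi.add_apply, h1, h2, mul_comm (V.1 (some i) x)]
      rfl⟩

theorem coeFn_mulH1 (U : H2 Ω) (V : H1 Ω) :
    (h.mulH1 U V).1 none =ᵐ[volume.restrict Ω] fun x => H2.fn U x * V.1 none x := by
  filter_upwards [h.coeFn_mulFn U (V.1 none)] with x hx
  rw [mul_comm]; exact hx

theorem norm_mulH1_le (U : H2 Ω) (V : H1 Ω) :
    ‖h.mulH1 U V‖ ≤ ((n + 1) * (C ^ 2 * (n + 1) + C)) * ‖U‖ * ‖V‖ := by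
  have hC := h.nonneg
  rw [mul_assoc, mul_assoc]
  refine H1.norm_le_of_forall fun a => ?_
  have e0 : C * ‖U‖ * ‖V‖ + C ^ 2 * ((n + 1) * ‖U‖) * ‖V‖ =
    (C ^ 2 * (n + 1) + C) * (‖U‖ * ‖V‖) := by ring
  rw [← e0]
  have hp : 0 ≤ C ^ 2 * ((n + 1) * ‖U‖) * ‖V‖ := by positivity
  rcases a with _ | i
  · refine (h.norm_mulFn_le U (V.1 none)).trans (le_add_of_le_of_nonneg ?_ hp)
    gcongr
    exact H1.norm_apply_le V _
  · refine (norm_add_le (h.mulFour (H2.partial U i) V) (h.mulFn U (V.1 (some i)))).trans ?_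
    rw [add_comm]
    refine add_le_add ((h.norm_mulFn_le U (V.1 (some i))).trans ?_)
      ((h.norm_mulFour_le _ _).trans ?_)
    · gcongr
      exact H1.norm_apply_le V _
    · gcongr
      exact H2.norm_partial_le U i

/-- The product of two elements of `H²(Ω)`. -/
noncomputable def mulH2 (U V : H2 Ω) : H2 Ω :=
  ⟨WithLp.toLp 2 fun a => a.casesOn (h.mulFn U (V.1 none)) fun b => b.casesOn
      (fun i => (h.mulH1 V (H2.partial U i)).1 none + (h.mulH1 U (H2.partial V i)).1 none)
      (fun p => (h.mulH1 V (H2.partial U p.1)).1 (some p.2) +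
        (h.mulH1 U (H2.partial V p.1)).1 (some p.2)),
    fun i => by
      refine HasWeakDirDeriv.congr_ae ((h.mulH1 U (H2.toH1 Ω V)).2 i) (ae_eq_refl _) ?_
      have e1 := h.coeFn_mulFour (H2.partial U i) (H2.toH1 Ω V)
      have e2 := h.coeFn_mulFn U (V.1 (some (Sum.inl i)))
      have e3 := Lp.coeFn_add (h.mulFour (H2.partial U i) (H2.toH1 Ω V))
        (h.mulFn U (V.1 (some (Sum.inl i))))
      have e4 := Lp.coeFn_add ((h.mulH1 V (H2.partial U i)).1 none)
        ((h.mulH1 U (H2.partial V i)).1 none)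
      filter_upwards [e1, e2, e3, e4, h.coeFn_mulH1 V (H2.partial U i),
        h.coeFn_mulH1 U (H2.partial V i)] with x h1 h2 h3 h4 h5 h6
      refine (h3.trans ?_).trans h4.symm
      rw [Pi.add_apply, Pi.add_apply, h1, h2, h5, h6, mul_comm, mul_comm (H2.fn U x)]
      rfl,
    fun i j => ((h.mulH1 V (H2.partial U i)).2 j).add ((h.mulH1 U (H2.partial V i)).2 j)⟩

theorem fn_mulH2 (U V : H2 Ω) :
    H2.fn (h.mulH2 U V) =ᵐ[volume.restrict Ω] fun x => H2.fn U x * H2.fn V x := by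
  filter_upwards [h.coeFn_mulFn U (V.1 none)] with x hx
  rw [mul_comm]; exact hx

/-- The two products have the same underlying function, so stability of `H¹₀` under multiplication
passes to `H²ₒ`. -/
theorem toH1_mulH2 (U V : H2 Ω) : H2.toH1 Ω (h.mulH2 U V) = h.mulH1 U (H2.toH1 Ω V) :=
  H1_ext h.isOpen (ae_eq_refl _)

/-- The derivatives of `UV` up to order two are components of the `H¹` elements `U ∂ᵢV` and `V ∂ᵢU`,
so the bound reduces to `norm_mulH1_le`. Adding one to the constant makes it positive. -/
theorem exists_norm_mulH2_le : ∃ K, 0 < K ∧ ∀ U V : H2 Ω, ‖h.mulH2 U V‖ ≤ K * ‖U‖ * ‖V‖ := by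
  have hC := h.nonneg
  set K₁ : ℝ := (n + 1) * (C ^ 2 * (n + 1) + C)
  have hK₁ : 0 ≤ K₁ := by positivity
  set N : ℝ := (Fintype.card (Option (Fin n ⊕ Fin n × Fin n)) : ℝ)
  have hsum : ∀ (U V : H2 Ω) (i : Fin n) (a : Option (Fin n)),
      ‖(h.mulH1 V (H2.partial U i)).1 a + (h.mulH1 U (H2.partial V i)).1 a‖ ≤
        2 * K₁ * (n + 1) * ‖U‖ * ‖V‖ := by
    intro U V i a
    refine (norm_add_le _ _).trans ?_
    have h1 : ‖(h.mulH1 V (H2.partial U i)).1 a‖ ≤ K₁ * ‖V‖ * ((n + 1) * ‖U‖) :=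
      (H1.norm_apply_le _ _).trans ((h.norm_mulH1_le _ _).trans
        (by gcongr; exact H2.norm_partial_le U i))
    have h2 : ‖(h.mulH1 U (H2.partial V i)).1 a‖ ≤ K₁ * ‖U‖ * ((n + 1) * ‖V‖) :=
      (H1.norm_apply_le _ _).trans ((h.norm_mulH1_le _ _).trans
        (by gcongr; exact H2.norm_partial_le V i))
    refine (add_le_add h1 h2).trans_eq (by ring)
  refine ⟨N * (C + 2 * K₁ * (n + 1)) + 1, by positivity, fun U V => ?_⟩
  have hcomp : ∀ a, ‖(h.mulH2 U V).1 a‖ ≤ (C + 2 * K₁ * (n + 1)) * (‖U‖ * ‖V‖) := by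
    have hp : 0 ≤ 2 * K₁ * (n + 1) * (‖U‖ * ‖V‖) := by positivity
    have hq : 0 ≤ C * (‖U‖ * ‖V‖) := by positivity
    rintro (_ | i | ⟨i, j⟩)
    · refine (h.norm_mulFn_le U (V.1 none)).trans ?_
      have : C * ‖U‖ * ‖V.1 none‖ ≤ C * ‖U‖ * ‖V‖ := by gcongr; exact H2.norm_apply_le V _
      linarith
    · refine (hsum U V i none).trans ?_
      linarith
    · refine (hsum U V i (some j)).trans ?_
      linarith
  refine (PiLp_two_norm_le_sum _).trans ((Finset.sum_le_sum fun a _ => hcomp a).trans ?_)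
  rw [Finset.sum_const, nsmul_eq_mul, Finset.card_univ]
  have : 0 ≤ ‖U‖ * ‖V‖ := by positivity
  simp only [N]
  linarith

end SobolevEmbedding

end Algebra

/-! ### Reciprocals in `H²(Ω)` -/

section Reciprocal

variable {n : ℕ} {Ω : Set (Euc n)} {C : ℝ}

theorem hasWeakDirDeriv_const (e : Euc n) (c : ℝ) :
    HasWeakDirDeriv Ω e (fun _ => c) fun _ => 0 := by
  intro φ hφ
  simp [integral_const_mul, hφ.integral_fderiv_eq_zero]

/-- Constants belong to `H²(Ω)`. -/
theorem SobolevEmbedding.exists_const (h : SobolevEmbedding Ω C) (c : ℝ) :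
    ∃ U : H2 Ω, H2.fn U =ᵐ[volume.restrict Ω] fun _ => c := by
  have : IsFiniteMeasure (volume.restrict Ω) := isFiniteMeasure_restrict.2 h.volume_ne_top
  have hc : MemLp (fun _ : Euc n => c) 2 (volume.restrict Ω) := memLp_const c
  let a : Option (Fin n ⊕ Fin n × Fin n) → L2 Ω := fun b => b.casesOn (hc.toLp _) fun _ => 0
  refine ⟨⟨WithLp.toLp 2 a, fun i => ?_, fun i j => ?_⟩, hc.coeFn_toLp⟩
  · exact (hasWeakDirDeriv_const _ c).congr_ae hc.coeFn_toLp.symm (Lp.coeFn_zero _ _ _).symm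
  · exact HasWeakPartial.zero Ω j

/-- The weak derivative of `u / w²`. -/
theorem HasWeakDirDeriv.mul_inv_sq (hΩ : IsOpen Ω) (hfin : volume Ω ≠ ⊤) {e : Euc n}
    {u u' w w' : Euc n → ℝ} (hu : MemLp u 2 (volume.restrict Ω))
    (hu' : MemLp u' 2 (volume.restrict Ω)) (hud : HasWeakDirDeriv Ω e u u')
    (hw : MemLp w 2 (volume.restrict Ω)) (hw' : MemLp w' 2 (volume.restrict Ω))
    (hwd : HasWeakDirDeriv Ω e w w') {δ : ℝ} (hδ : 0 < δ)
    (hwδ : ∀ᵐ x ∂volume.restrict Ω, δ ≤ w x) :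
    HasWeakDirDeriv Ω e (fun x => u x * (w x ^ 2)⁻¹)
      (fun x => u' x * (w x ^ 2)⁻¹ - 2 * (u x * w' x * (w x ^ 3)⁻¹)) := by
  have : IsFiniteMeasure (volume.restrict Ω) := isFiniteMeasure_restrict.2 hfin
  have hwm : AEMeasurable w (volume.restrict Ω) := hw.1.aemeasurable
  have bd : ∀ k : ℕ, ∀ᵐ x ∂volume.restrict Ω, |(w x ^ k)⁻¹| ≤ (δ ^ k)⁻¹ := fun k => by
    filter_upwards [hwδ] with x hx
    rw [abs_of_pos (inv_pos.2 (pow_pos (hδ.trans_le hx) k))]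
    exact inv_anti₀ (by positivity) (pow_le_pow_left₀ hδ.le hx k)
  have mk : ∀ k : ℕ, AEStronglyMeasurable (fun x => (w x ^ k)⁻¹) (volume.restrict Ω) :=
    fun k => (hwm.pow_const k).inv.aestronglyMeasurable
  have hb : MemLp (fun x => (w x)⁻¹) 2 (volume.restrict Ω) := by
    refine MemLp.of_bound hwm.inv.aestronglyMeasurable δ⁻¹ ?_
    simpa using bd 1
  -- The inverse square is treated as a product of two bounded reciprocals, so that the product rule
  -- in `L²` applies twice.
  have hb2 : MemLp (fun x => (w x)⁻¹ * (w x)⁻¹) 2 (volume.restrict Ω) := by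
    refine hb.mul_bounded hwm.inv.aestronglyMeasurable (C := δ⁻¹) ?_
    simpa using bd 1
  have hd1 := hwd.inv hΩ hfin hw hw' hδ hwδ
  have hb' : MemLp (fun x => -(w' x * (w x ^ 2)⁻¹)) 2 (volume.restrict Ω) :=
    (hw'.mul_bounded (mk 2) (bd 2)).neg
  have hd2 := hd1.mul hΩ hb hb' hb hb' hd1
  have hb2' : MemLp (fun x => -(w' x * (w x ^ 2)⁻¹) * (w x)⁻¹ + (w x)⁻¹ *
      -(w' x * (w x ^ 2)⁻¹)) 2 (volume.restrict Ω) := by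
    have b1 : ∀ᵐ x ∂volume.restrict Ω, |(w x)⁻¹| ≤ δ⁻¹ := by simpa using bd 1
    refine (hb'.mul_bounded hwm.inv.aestronglyMeasurable b1).add ?_
    exact (hb'.mul_bounded hwm.inv.aestronglyMeasurable b1).ae_eq
      (Eventually.of_forall fun x => mul_comm _ _)
  have hd3 := hud.mul hΩ hu hu' hb2 hb2' hd2
  refine hd3.congr_ae (Eventually.of_forall fun x => ?_) ?_
  · simp only [← mul_inv, sq]
  · filter_upwards [hwδ] with x hx
    have : w x ≠ 0 := (hδ.trans_le hx).ne'
    field_simp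
    ring

/-- The second derivatives of `1 / W` are `2 ∂ᵢW ∂ⱼW / W³ - ∂ⱼ∂ᵢW / W²`. The lower bound controls
the powers of `1 / W`, and the `L⁴` embedding controls `∂ᵢW ∂ⱼW`. Here `B` bounds every component;
`|M|` keeps it nonnegative for any real `M`. -/
theorem SobolevEmbedding.exists_inv (h : SobolevEmbedding Ω C) {δ : ℝ} (hδ : 0 < δ) (M : ℝ) :
    ∃ R, 0 < R ∧ ∀ W : H2 Ω, (∀ᵐ x ∂volume.restrict Ω, δ ≤ H2.fn W x) → ‖W‖ ≤ M →
      ∃ A : H2 Ω, (H2.fn A =ᵐ[volume.restrict Ω] fun x => (H2.fn W x)⁻¹) ∧ ‖A‖ ≤ R := by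
  have : IsFiniteMeasure (volume.restrict Ω) := isFiniteMeasure_restrict.2 h.volume_ne_top
  have hC := h.nonneg
  set N : ℝ := (Fintype.card (Option (Fin n ⊕ Fin n × Fin n)) : ℝ)
  set v : ℝ := ((volume Ω) ^ (2 : ℝ)⁻¹).toReal
  set B : ℝ := v * δ⁻¹ + (δ ^ 2)⁻¹ * |M| + 2 * ((δ ^ 3)⁻¹ * (C ^ 2 * ((n + 1) * |M|) *
    ((n + 1) * |M|)))
  refine ⟨N * B + 1, by positivity, fun W hW hWM => ?_⟩
  have hM : ‖W‖ ≤ |M| := hWM.trans (le_abs_self M)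
  have hwm : AEMeasurable (H2.fn W) (volume.restrict Ω) := (H2.measurable_fn W).aemeasurable
  have bd : ∀ k : ℕ, ∀ᵐ x ∂volume.restrict Ω, |(H2.fn W x ^ k)⁻¹| ≤ (δ ^ k)⁻¹ := fun k => by
    filter_upwards [hW] with x hx
    rw [abs_of_pos (inv_pos.2 (pow_pos (hδ.trans_le hx) k))]
    exact inv_anti₀ (by positivity) (pow_le_pow_left₀ hδ.le hx k)
  have mk : ∀ k : ℕ, AEStronglyMeasurable (fun x => (H2.fn W x ^ k)⁻¹) (volume.restrict Ω) :=
    fun k => (hwm.pow_const k).inv.aestronglyMeasurable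
  have bd1 : ∀ᵐ x ∂volume.restrict Ω, |(H2.fn W x)⁻¹| ≤ δ⁻¹ := by simpa using bd 1
  have l0 : MemLp (fun x => (H2.fn W x)⁻¹) 2 (volume.restrict Ω) :=
    MemLp.of_bound hwm.inv.aestronglyMeasurable δ⁻¹ bd1
  have l1 : ∀ f : L2 Ω, MemLp (fun x => f x * (H2.fn W x ^ 2)⁻¹) 2 (volume.restrict Ω) :=
    fun f => (Lp.memLp f).mul_bounded (mk 2) (bd 2)
  have l2 : ∀ f : L2 Ω, MemLp (fun x => f x * (H2.fn W x ^ 3)⁻¹) 2 (volume.restrict Ω) :=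
    fun f => (Lp.memLp f).mul_bounded (mk 3) (bd 3)
  have n0 : ‖l0.toLp _‖ ≤ v * δ⁻¹ := by
    refine Lp_norm_toLp_le _ (by positivity) ((eLpNorm_le_of_ae_bound
      (f := fun x => (H2.fn W x)⁻¹) (C := δ⁻¹) bd1).trans_eq ?_)
    rw [Measure.restrict_apply_univ, ENNReal.ofReal_mul ENNReal.toReal_nonneg]
    congr 1
    rw [ENNReal.ofReal_toReal (ENNReal.rpow_ne_top_of_nonneg (by norm_num) h.volume_ne_top)]
    norm_num
  have n1 : ∀ f : L2 Ω, ‖(l1 f).toLp _‖ ≤ (δ ^ 2)⁻¹ * ‖f‖ := fun f => by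
    refine Lp.norm_le_mul_norm_of_ae_le_mul ?_
    filter_upwards [(l1 f).coeFn_toLp, bd 2] with x hx hb
    rw [hx, norm_mul, mul_comm]
    exact mul_le_mul_of_nonneg_right hb (norm_nonneg _)
  have n2 : ∀ f : L2 Ω, ‖(l2 f).toLp _‖ ≤ (δ ^ 3)⁻¹ * ‖f‖ := fun f => by
    refine Lp.norm_le_mul_norm_of_ae_le_mul ?_
    filter_upwards [(l2 f).coeFn_toLp, bd 3] with x hx hb
    rw [hx, norm_mul, mul_comm]
    exact mul_le_mul_of_nonneg_right hb (norm_nonneg _)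
  let D : Fin n → L2 Ω := fun i => W.1 (some (Sum.inl i))
  let Q : Fin n → Fin n → L2 Ω := fun i j => h.mulFour (H2.partial W i) (H2.partial W j)
  have hpW : ∀ i, ‖H2.partial W i‖ ≤ (n + 1) * |M| := fun i =>
    (H2.norm_partial_le W i).trans (by gcongr)
  have nQ : ∀ i j, ‖Q i j‖ ≤ C ^ 2 * ((n + 1) * |M|) * ((n + 1) * |M|) := fun i j =>
    (h.norm_mulFour_le _ _).trans (by gcongr <;> exact hpW _)
  let a : Option (Fin n ⊕ Fin n × Fin n) → L2 Ω := fun b => b.casesOn (l0.toLp _) fun b =>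
    b.casesOn (fun i => -(l1 (D i)).toLp _) fun p =>
      (2 : ℝ) • (l2 (Q p.1 p.2)).toLp _ - (l1 (W.1 (some (Sum.inr p)))).toLp _
  refine ⟨⟨WithLp.toLp 2 a, fun i => ?_, fun i j => ?_⟩, l0.coeFn_toLp, ?_⟩
  · refine HasWeakDirDeriv.congr_ae (HasWeakDirDeriv.inv h.isOpen h.volume_ne_top
      (H2.memLp_fn W) (Lp.memLp (D i)) (W.2.1 i) hδ hW) l0.coeFn_toLp.symm ?_
    filter_upwards [(l1 (D i)).coeFn_toLp, Lp.coeFn_neg ((l1 (D i)).toLp _)] with x h1 h2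
    exact Eq.symm (h2.trans (congrArg Neg.neg h1))
  · have hd := HasWeakDirDeriv.mul_inv_sq h.isOpen h.volume_ne_top (Lp.memLp (D i))
      (Lp.memLp (W.1 (some (Sum.inr (i, j))))) (W.2.2 i j) (H2.memLp_fn W) (Lp.memLp (D j))
      (W.2.1 j) hδ hW
    have hd' : HasWeakPartial Ω j ((l1 (D i)).toLp _)
        ((l1 (W.1 (some (Sum.inr (i, j))))).toLp _ - (2 : ℝ) • (l2 (Q i j)).toLp _) := by
      refine HasWeakDirDeriv.congr_ae hd (l1 (D i)).coeFn_toLp.symm ?_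
      filter_upwards [(l1 (W.1 (some (Sum.inr (i, j))))).coeFn_toLp, (l2 (Q i j)).coeFn_toLp,
        Lp.coeFn_smul (2 : ℝ) ((l2 (Q i j)).toLp _), h.coeFn_mulFour (H2.partial W i)
        (H2.partial W j), Lp.coeFn_sub ((l1 (W.1 (some (Sum.inr (i, j))))).toLp _)
        ((2 : ℝ) • (l2 (Q i j)).toLp _)] with x h1 h2 h3 h4 h5
      rw [h5, Pi.sub_apply, h1, h3, Pi.smul_apply, h2, h4]
      rfl
    -- The rule differentiates `∂ᵢW / W²`, whereas the first derivative of `1 / W` is its negative.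
    have := hd'.smul (-1)
    simpa [a] using this
  · refine (PiLp_two_norm_le_sum _).trans ((Finset.sum_le_sum (g := fun _ => B) fun b _ => ?_).trans
      ?_)
    · have p0 : 0 ≤ v * δ⁻¹ := by positivity
      have p1 : 0 ≤ (δ ^ 2)⁻¹ * |M| := by positivity
      have p2 : 0 ≤ 2 * ((δ ^ 3)⁻¹ * (C ^ 2 * ((n + 1) * |M|) * ((n + 1) * |M|))) := by
        positivity
      have q1 : ∀ b, ‖(l1 (W.1 b)).toLp _‖ ≤ (δ ^ 2)⁻¹ * |M| := fun b =>
        (n1 (W.1 b)).trans (by gcongr; exact (H2.norm_apply_le W b).trans hM)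
      rcases b with _ | i | p
      · refine le_trans n0 ?_
        linarith
      · refine le_trans (norm_neg _).le ((q1 _).trans ?_)
        linarith
      · refine le_trans (norm_sub_le _ _) ((add_le_add (norm_smul_le _ _) (q1 _)).trans ?_)
        have q2 : ‖(l2 (Q p.1 p.2)).toLp _‖ ≤
            (δ ^ 3)⁻¹ * (C ^ 2 * ((n + 1) * |M|) * ((n + 1) * |M|)) :=
          (n2 _).trans (by gcongr; exact nQ _ _)
        rw [Real.norm_of_nonneg zero_le_two]
        linarith
    · rw [Finset.sum_const, nsmul_eq_mul, Finset.card_univ]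
      simp only [N]
      linarith

end Reciprocal

/-! ### Multiplication preserves `H¹₀(Ω)` and `H²ₒ(Ω)` -/

section ZeroBoundary

variable {n : ℕ} {Ω : Set (Euc n)} {C : ℝ}

theorem IsTestFunction.hasWeakDirDeriv {ψ : Euc n → ℝ} (hψ : IsTestFunction Ω ψ) (e : Euc n) :
    HasWeakDirDeriv Ω e ψ fun x => fderiv ℝ ψ x e := by
  intro φ hφ
  have e0 : ∀ x ∉ Ω, φ x = 0 := fun x hx =>
    image_eq_zero_of_notMem_tsupport fun h' => hx (hφ.2.2 h')
  have e1 : ∀ x ∉ Ω, ψ x = 0 := fun x hx =>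
    image_eq_zero_of_notMem_tsupport fun h' => hx (hψ.2.2 h')
  rw [setIntegral_eq_integral_of_forall_compl_eq_zero fun x hx => by rw [e1 x hx, zero_mul],
    setIntegral_eq_integral_of_forall_compl_eq_zero fun x hx => by rw [e0 x hx, mul_zero]]
  refine integral_mul_fderiv_eq_neg_fderiv_mul_of_integrable
    (((hψ.continuous_fderiv_apply e).mul hφ.1.continuous).integrable_of_hasCompactSupport
      hφ.2.1.mul_left)
    ((hψ.1.continuous.mul (hφ.continuous_fderiv_apply e)).integrable_of_hasCompactSupport
      hψ.2.1.mul_right)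
    ((hψ.1.continuous.mul hφ.1.continuous).integrable_of_hasCompactSupport hφ.2.1.mul_left)
    (fun x _ => (hψ.1.differentiable (by simp)).differentiableAt)
    fun x _ => (hφ.1.differentiable (by simp)).differentiableAt

/-- A test function as an element of `H¹(Ω)`. -/
noncomputable def IsTestFunction.toH1 {ψ : Euc n → ℝ} (hψ : IsTestFunction Ω ψ) : H1 Ω :=
  let a : Option (Fin n) → L2 Ω := fun b =>
    b.casesOn (hψ.memLp.toLp ψ) fun i => (hψ.memLp_partialDeriv i).toLp (partialDeriv i ψ)
  ⟨WithLp.toLp 2 a, fun i => by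
    have hd : HasWeakDirDeriv Ω (EuclideanSpace.single i 1) ψ (partialDeriv i ψ) :=
      hψ.hasWeakDirDeriv _
    exact hd.congr_ae hψ.memLp.coeFn_toLp.symm (hψ.memLp_partialDeriv i).coeFn_toLp.symm⟩

theorem IsTestFunction.toH1_mem_H10 {ψ : Euc n → ℝ} (hψ : IsTestFunction Ω ψ) :
    hψ.toH1 ∈ H10 Ω :=
  Submodule.le_topologicalClosure _ (Submodule.subset_span
    ⟨ψ, hψ, hψ.memLp.coeFn_toLp, fun i => (hψ.memLp_partialDeriv i).coeFn_toLp⟩)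

theorem H1_tendsto_of_apply {V : ℕ → H1 Ω} {W : H1 Ω}
    (h : ∀ a, Tendsto (fun k => eLpNorm (fun x => (V k).1 a x - W.1 a x) 2 (volume.restrict Ω))
      atTop (𝓝 0)) : Tendsto V atTop (𝓝 W) := by
  rw [tendsto_iff_norm_sub_tendsto_zero]
  have h' : ∀ a, Tendsto (fun k => ‖(V k - W).1 a‖) atTop (𝓝 0) := by
    intro a
    have := (ENNReal.tendsto_toReal ENNReal.zero_ne_top).comp (h a)
    rw [ENNReal.toReal_zero] at this
    refine this.congr fun k => ?_
    rw [Lp.norm_def, Function.comp_apply]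
    refine congrArg _ (eLpNorm_congr_ae ?_)
    exact (Lp.coeFn_sub ((V k).1 a) (W.1 a)).symm
  refine squeeze_zero (fun _ => norm_nonneg _) (fun k => PiLp_two_norm_le_sum _)
    (by simpa using tendsto_finsetSum Finset.univ fun a _ => h' a)

/-- Multiplication by an element of `H²(Ω)` maps test functions into `H¹₀(Ω)`. -/
theorem SobolevEmbedding.mulH1_toH1_mem_H10 (h : SobolevEmbedding Ω C) (U : H2 Ω)
    {φ : Euc n → ℝ} (hφ : IsTestFunction Ω φ) : h.mulH1 U hφ.toH1 ∈ H10 Ω := by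
  have hm := h.isOpen.measurableSet
  set F : (Euc n → ℝ) → ℕ → Euc n → ℝ := fun f k => mollify k (Ω.indicator f) with hF
  have hs : ∀ k, ContDiff ℝ ∞ (F (H2.fn U) k) := fun k =>
    contDiff_mollify k (locallyIntegrable_indicator hm (H2.memLp_fn U))
  -- Multiplication by `φ` localizes the mollified `U` inside `Ω`, so convergence in `H¹` is not
  -- affected by the boundary.
  have htest : ∀ k, IsTestFunction Ω fun x => F (H2.fn U) k x * φ x := fun k =>
    hφ.mul_left (hs k)
  have lim : ∀ {f : Euc n → ℝ} {ψ : Euc n → ℝ}, MemLp f 2 (volume.restrict Ω) →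
      Continuous ψ → HasCompactSupport ψ →
      Tendsto (fun k => eLpNorm (fun x => (F f k x - f x) * ψ x) 2 (volume.restrict Ω))
        atTop (𝓝 0) := by
    intro f ψ hf hψ hψc
    obtain ⟨c, hc⟩ := hψc.exists_bound_of_continuous hψ
    have := ENNReal.Tendsto.const_mul (a := ENNReal.ofReal c)
      (tendsto_eLpNorm_mollify_indicator_sub hm hf) (Or.inr ENNReal.ofReal_ne_top)
    rw [mul_zero] at this
    exact tendsto_of_tendsto_of_tendsto_of_le_of_le tendsto_const_nhds this (fun _ => zero_le)
      fun k => eLpNorm_mul_bounded_le (Eventually.of_forall hc)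
  have hclosed : IsClosed (H10 Ω : Set (H1 Ω)) := Submodule.isClosed_topologicalClosure _
  refine hclosed.mem_of_tendsto (H1_tendsto_of_apply (V := fun k => (htest k).toH1) ?_)
    (Eventually.of_forall fun k => (htest k).toH1_mem_H10)
  rintro (_ | i)
  · refine (lim (H2.memLp_fn U) hφ.1.continuous hφ.2.1).congr fun k => eLpNorm_congr_ae ?_
    filter_upwards [(htest k).memLp.coeFn_toLp, h.coeFn_mulH1 U hφ.toH1,
      hφ.memLp.coeFn_toLp] with x h1 h2 h3
    rw [h2, sub_mul]
    exact congrArg₂ (· - ·) h1.symm (congrArg (H2.fn U x * ·) h3.symm)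
  · set e : Euc n := EuclideanSpace.single i 1
    set u' : L2 Ω := U.1 (some (Sum.inl i)) with hu'
    have l1 := lim (Lp.memLp u') hφ.1.continuous hφ.2.1
    have l2 := lim (H2.memLp_fn U) (hφ.continuous_fderiv_apply e)
      (hφ.hasCompactSupport_fderiv_apply e)
    have l3 := l1.add l2
    rw [add_zero] at l3
    have hFm : ∀ {f : Euc n → ℝ}, MemLp f 2 (volume.restrict Ω) → ∀ k,
        AEStronglyMeasurable (fun x => F f k x - f x) (volume.restrict Ω) := fun hf k =>
      (contDiff_mollify k (locallyIntegrable_indicator hm hf)).continuous.aestronglyMeasurable.sub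
        hf.1
    refine tendsto_of_tendsto_of_tendsto_of_le_of_le' tendsto_const_nhds l3
      (Eventually.of_forall fun _ => zero_le) ?_
    -- For these `k`, the derivative error splits into the mollification errors of `∂ᵢU` and `U`,
    -- multiplied by `φ` and `∂ᵢφ` respectively.
    filter_upwards [eventually_forall_closedBall_subset hφ.2.1.isCompact h.isOpen hφ.2.2]
      with k hk
    refine le_trans (eLpNorm_congr_ae ?_).le (eLpNorm_add_le
      ((hFm (Lp.memLp u') k).mul hφ.1.continuous.aestronglyMeasurable)
      ((hFm (H2.memLp_fn U) k).mul (hφ.continuous_fderiv_apply e).aestronglyMeasurable)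
      one_le_two)
    have c1 := ((htest k).memLp_partialDeriv i).coeFn_toLp
    have c2 := Lp.coeFn_add (h.mulFour (H2.partial U i) hφ.toH1)
      (h.mulFn U (hφ.toH1.1 (some i)))
    filter_upwards [c1, c2, h.coeFn_mulFour (H2.partial U i) hφ.toH1,
      h.coeFn_mulFn U (hφ.toH1.1 (some i)), hφ.memLp.coeFn_toLp,
      (hφ.memLp_partialDeriv i).coeFn_toLp] with x h1 h2 h3 h4 h5 h6
    have g1 : (h.mulH1 U hφ.toH1).1 (some i) x = u' x * φ x + fderiv ℝ φ x e * H2.fn U x := by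
      refine h2.trans ?_
      rw [Pi.add_apply, h3, h4]
      exact congrArg₂ (· + ·) (congrArg (u' x * ·) h5) (congrArg (· * H2.fn U x) h6)
    have g2 : (htest k).toH1.1 (some i) x =
        F u' k x * φ x + F (H2.fn U) k x * fderiv ℝ φ x e := by
      refine h1.trans ?_
      have d1 : DifferentiableAt ℝ (F (H2.fn U) k) x := (hs k).differentiable (by simp) x
      have d2 : DifferentiableAt ℝ φ x := hφ.1.differentiable (by simp) x
      have hd : fderiv ℝ (fun x => F (H2.fn U) k x * φ x) x = _ := fderiv_mul d1 d2
      rw [partialDeriv, hd]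
      simp only [add_apply, smul_apply, smul_eq_mul]
      by_cases hx : x ∈ tsupport φ
      · have hw : HasWeakDirDeriv Ω e (H2.fn U) u' := U.2.1 i
        have := (hw.indicator hm).fderiv_mollify
          (locallyIntegrable_indicator hm (H2.memLp_fn U)) (hk x hx)
        simp only [hF]
        rw [this]; ring
      · rw [image_eq_zero_of_notMem_tsupport hx]; ring
    rw [g1, g2]
    simp only [Pi.add_apply]
    ring

theorem SobolevEmbedding.mulH1_add (h : SobolevEmbedding Ω C) (U : H2 Ω) (V W : H1 Ω) :
    h.mulH1 U (V + W) = h.mulH1 U V + h.mulH1 U W := by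
  refine H1_ext h.isOpen ?_
  filter_upwards [h.coeFn_mulH1 U (V + W), h.coeFn_mulH1 U V, h.coeFn_mulH1 U W,
    Lp.coeFn_add (V.1 none) (W.1 none),
    Lp.coeFn_add ((h.mulH1 U V).1 none) ((h.mulH1 U W).1 none)] with x h1 h2 h3 h4 h5
  rw [h1]
  refine Eq.trans ?_ h5.symm
  rw [Pi.add_apply, h2, h3, ← mul_add]
  exact congrArg (H2.fn U x * ·) h4

theorem SobolevEmbedding.mulH1_smul (h : SobolevEmbedding Ω C) (U : H2 Ω) (c : ℝ) (V : H1 Ω) :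
    h.mulH1 U (c • V) = c • h.mulH1 U V := by
  refine H1_ext h.isOpen ?_
  filter_upwards [h.coeFn_mulH1 U (c • V), h.coeFn_mulH1 U V,
    Lp.coeFn_smul c (V.1 none), Lp.coeFn_smul c ((h.mulH1 U V).1 none)] with x h1 h2 h4 h5
  rw [h1]
  refine Eq.trans ?_ h5.symm
  rw [Pi.smul_apply, h2, smul_eq_mul, mul_left_comm]
  exact congrArg (H2.fn U x * ·) h4

/-- Multiplication by an element of `H²(Ω)` as a bounded operator on `H¹(Ω)`. -/
noncomputable def SobolevEmbedding.mulH1L (h : SobolevEmbedding Ω C) (U : H2 Ω) :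
    H1 Ω →L[ℝ] H1 Ω :=
  LinearMap.mkContinuous
    { toFun := h.mulH1 U
      map_add' := h.mulH1_add U
      map_smul' := h.mulH1_smul U }
    (((n + 1) * (C ^ 2 * (n + 1) + C)) * ‖U‖) (h.norm_mulH1_le U)

/-- Multiplication is continuous on `H¹`, so the elements sent into `H¹₀` form a closed subspace. It
contains the test functions, hence their closed span. -/
theorem SobolevEmbedding.mulH1_mem_H10 (h : SobolevEmbedding Ω C) (U : H2 Ω) {V : H1 Ω}
    (hV : V ∈ H10 Ω) : h.mulH1 U V ∈ H10 Ω := by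
  have hclosed : IsClosed (H10 Ω : Set (H1 Ω)) := Submodule.isClosed_topologicalClosure _
  have hle : H10 Ω ≤ (H10 Ω).comap (h.mulH1L U).toLinearMap := by
    refine Submodule.topologicalClosure_minimal _ (Submodule.span_le.2 ?_)
      (hclosed.preimage (h.mulH1L U).continuous)
    rintro V ⟨φ, hφ, h0, -⟩
    have : V = hφ.toH1 := H1_ext h.isOpen (h0.trans hφ.memLp.coeFn_toLp.symm)
    rw [this]
    exact h.mulH1_toH1_mem_H10 U hφ
  exact hle hV

theorem SobolevEmbedding.mulH2_mem_Ho2 (h : SobolevEmbedding Ω C) (U : H2 Ω) {V : H2 Ω}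
    (hV : V ∈ Ho2 Ω) : h.mulH2 U V ∈ Ho2 Ω := by
  rw [Ho2, Submodule.mem_comap, h.toH1_mulH2]
  exact h.mulH1_mem_H10 U hV

end ZeroBoundary

/-! ### The product as a bounded bilinear map -/

section Multiplication

variable {n : ℕ} {Ω : Set (Euc n)} {C : ℝ}

theorem H2.fn_add (U V : H2 Ω) :
    H2.fn (U + V) =ᵐ[volume.restrict Ω] fun x => H2.fn U x + H2.fn V x :=
  Lp.coeFn_add (U.1 none) (V.1 none)

theorem H2.fn_sub (U V : H2 Ω) :
    H2.fn (U - V) =ᵐ[volume.restrict Ω] fun x => H2.fn U x - H2.fn V x :=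
  Lp.coeFn_sub (U.1 none) (V.1 none)

theorem H2.fn_smul (c : ℝ) (U : H2 Ω) :
    H2.fn (c • U) =ᵐ[volume.restrict Ω] fun x => c * H2.fn U x :=
  Lp.coeFn_smul c (U.1 none)

namespace SobolevEmbedding

variable (h : SobolevEmbedding Ω C)
include h

/-- The bound of the multiplication of `H²(Ω)`. -/
noncomputable def mulBound : ℝ := h.exists_norm_mulH2_le.choose

theorem mulBound_pos : 0 < h.mulBound := h.exists_norm_mulH2_le.choose_spec.1

theorem norm_mulH2_le (U V : H2 Ω) : ‖h.mulH2 U V‖ ≤ h.mulBound * ‖U‖ * ‖V‖ :=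
  h.exists_norm_mulH2_le.choose_spec.2 U V

theorem norm_mulH2_le_of_le {U V : H2 Ω} {a b : ℝ} (hU : ‖U‖ ≤ a) (hV : ‖V‖ ≤ b) :
    ‖h.mulH2 U V‖ ≤ h.mulBound * a * b := by
  have := h.mulBound_pos
  have := (norm_nonneg U).trans hU
  exact (h.norm_mulH2_le U V).trans (by gcongr)

/-- The multiplication of `H²(Ω)` as a bounded bilinear map. -/
noncomputable def mulL : H2 Ω →L[ℝ] H2 Ω →L[ℝ] H2 Ω :=
  LinearMap.mkContinuous₂
    (LinearMap.mk₂ ℝ h.mulH2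
      (fun U V W => H2_ext h.isOpen (by
        filter_upwards [h.fn_mulH2 (U + V) W, h.fn_mulH2 U W, h.fn_mulH2 V W, H2.fn_add U V,
          H2.fn_add (h.mulH2 U W) (h.mulH2 V W)] with x h1 h2 h3 h4 h5
        rw [h1, h4, h5, h2, h3, add_mul]))
      (fun c U W => H2_ext h.isOpen (by
        filter_upwards [h.fn_mulH2 (c • U) W, h.fn_mulH2 U W, H2.fn_smul c U,
          H2.fn_smul c (h.mulH2 U W)] with x h1 h2 h3 h4
        rw [h1, h3, h4, h2, mul_assoc]))
      (fun U V W => H2_ext h.isOpen (by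
        filter_upwards [h.fn_mulH2 U (V + W), h.fn_mulH2 U V, h.fn_mulH2 U W, H2.fn_add V W,
          H2.fn_add (h.mulH2 U V) (h.mulH2 U W)] with x h1 h2 h3 h4 h5
        rw [h1, h4, h5, h2, h3, mul_add]))
      (fun c U W => H2_ext h.isOpen (by
        filter_upwards [h.fn_mulH2 U (c • W), h.fn_mulH2 U W, H2.fn_smul c W,
          H2.fn_smul c (h.mulH2 U W)] with x h1 h2 h3 h4
        rw [h1, h3, h4, h2, mul_left_comm])))
    h.mulBound h.norm_mulH2_le

theorem mulL_apply (U V : H2 Ω) : h.mulL U V = h.mulH2 U V := rfl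

theorem norm_mulL_le (U : H2 Ω) : ‖h.mulL U‖ ≤ h.mulBound * ‖U‖ :=
  ContinuousLinearMap.opNorm_le_bound _ (mul_nonneg h.mulBound_pos.le (norm_nonneg _))
    (h.norm_mulH2_le U)

end SobolevEmbedding

end Multiplication

/-! ### Algebraic identities and uniform bounds for the gap force -/

section GapForce

variable {n : ℕ} {Ω : Set (Euc n)} {C : ℝ}

/-- The states `ψ` with gap `ψ + θ ≥ δ` and `‖ψ + θ‖ ≤ M`. -/
def gapStates (Ω : Set (Euc n)) (δ M θ : ℝ) : Set (H2 Ω) :=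
  {ψ | (∀ᵐ x ∂volume.restrict Ω, δ ≤ H2.fn ψ x + θ) ∧
    ∃ w : H2 Ω, (H2.fn w =ᵐ[volume.restrict Ω] fun x => H2.fn ψ x + θ) ∧ ‖w‖ ≤ M}

theorem SobolevEmbedding.exists_inv_gap (h : SobolevEmbedding Ω C) {δ : ℝ} (hδ : 0 < δ) (M : ℝ) :
    ∃ R, 0 < R ∧ ∀ θ, ∀ ψ ∈ gapStates Ω δ M θ, ∃ A : H2 Ω,
      (H2.fn A =ᵐ[volume.restrict Ω] fun x => (H2.fn ψ x + θ)⁻¹) ∧ ‖A‖ ≤ R := by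
  obtain ⟨R, hR, hinv⟩ := h.exists_inv hδ M
  refine ⟨R, hR, ?_⟩
  rintro θ ψ ⟨hψ, w, hw, hwM⟩
  have hwδ : ∀ᵐ x ∂volume.restrict Ω, δ ≤ H2.fn w x := by
    filter_upwards [hψ, hw] with x h1 h2
    rwa [h2]
  obtain ⟨A, hA, hAR⟩ := hinv w hwδ hwM
  refine ⟨A, ?_, hAR⟩
  filter_upwards [hA, hw] with x h1 h2
  rw [h1, h2]

/-- Exhibiting any element with the required values rules out the default value `0` in the
definition. -/
theorem superposition_spec {f : ℝ → ℝ} {u v : H2 Ω}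
    (hv : H2.fn v =ᵐ[volume.restrict Ω] fun x => f (H2.fn u x)) :
    H2.fn (superposition Ω f u) =ᵐ[volume.restrict Ω] fun x => f (H2.fn u x) := by
  have hex : ∃ v : H2 Ω, H2.fn v =ᵐ[volume.restrict Ω] fun x => f (H2.fn u x) := ⟨v, hv⟩
  rw [superposition, dif_pos hex]
  exact hex.choose_spec

theorem SobolevEmbedding.fn_gapForce (h : SobolevEmbedding Ω C) {δ M θ : ℝ} (hδ : 0 < δ)
    (βF βp θ₁ : ℝ) {ψ : H2 Ω} (hψ : ψ ∈ gapStates Ω δ M θ) :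
    H2.fn (gapForce Ω βF βp θ₁ θ ψ) =ᵐ[volume.restrict Ω]
      fun x => -βF / (H2.fn ψ x + θ) ^ 2 + βp * (θ₁ - 1) := by
  obtain ⟨R, -, hinv⟩ := h.exists_inv_gap hδ M
  obtain ⟨A, hA, -⟩ := hinv θ ψ hψ
  obtain ⟨c, hc⟩ := h.exists_const (βp * (θ₁ - 1))
  refine superposition_spec (f := fun s => -βF / (s + θ) ^ 2 + βp * (θ₁ - 1))
    (v := (-βF) • h.mulH2 A A + c) ?_
  filter_upwards [hA, hc, H2.fn_add ((-βF) • h.mulH2 A A) c, H2.fn_smul (-βF) (h.mulH2 A A),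
    h.fn_mulH2 A A] with x h1 h2 h3 h4 h5
  rw [h3, h4, h5, h1, h2, div_eq_mul_inv, sq, mul_inv]

/-- The bounds for the gap force and its derivative that are uniform on sets of states with a
positive gap. -/
theorem SobolevEmbedding.exists_gapForce_bounds (h : SobolevEmbedding Ω C) {δ βF : ℝ} (hδ : 0 < δ)
    (hβ : 0 < βF) (M : ℝ) : ∃ L, 0 < L ∧ ∀ θ, ∃ D : H2 Ω → H2 Ω →L[ℝ] H2 Ω,
      (∀ ψ ∈ gapStates Ω δ M θ, ‖D ψ‖ ≤ L ∧ (∀ q, q ∈ Ho2 Ω → D ψ q ∈ Ho2 Ω) ∧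
        ∀ q, H2.fn (D ψ q) =ᵐ[volume.restrict Ω]
          fun x => 2 * βF / (H2.fn ψ x + θ) ^ 3 * H2.fn q x) ∧
      (∀ ψ₁ ∈ gapStates Ω δ M θ, ∀ ψ₂ ∈ gapStates Ω δ M θ, ‖D ψ₁ - D ψ₂‖ ≤ L * ‖ψ₁ - ψ₂‖) ∧
      ∀ βp θ₁, (∀ ψ₁ ∈ gapStates Ω δ M θ, ∀ ψ₂ ∈ gapStates Ω δ M θ,
          ‖gapForce Ω βF βp θ₁ θ ψ₁ - gapForce Ω βF βp θ₁ θ ψ₂‖ ≤ L * ‖ψ₁ - ψ₂‖) ∧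
        ∀ ψ ∈ gapStates Ω δ M θ, ∀ q, ψ + q ∈ gapStates Ω δ M θ →
          ‖gapForce Ω βF βp θ₁ θ (ψ + q) - gapForce Ω βF βp θ₁ θ ψ - D ψ q‖ ≤ L * ‖q‖ ^ 2 := by
  obtain ⟨R, hR, hinv⟩ := h.exists_inv_gap hδ M
  have hK := h.mulBound_pos
  set K := h.mulBound
  -- The four constants bound, in order, the norm of `D`, the Lipschitz constant of `G`, that of
  -- `D`, and the quadratic remainder. They involve only `K`, `R` and `βF`, so they are uniform in
  -- `θ`, `βp` and `θ₁`.
  set L₁ : ℝ := K * (2 * βF * (K * R * (K * R * R)))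
  set L₂ : ℝ := βF * (K * (K * R * R) * (K * (R + R)))
  set L₃ : ℝ := K * (2 * βF * (K * (K * R * R) * (K * (K * R * R + (K * R * R + K * R * R)))))
  set L₄ : ℝ := βF * (K * (K * (K * R * R) * R) * (K * (R + (R + R)) * K))
  have p1 : 0 < L₁ := by positivity
  have p2 : 0 < L₂ := by positivity
  have p3 : 0 < L₃ := by positivity
  have p4 : 0 < L₄ := by positivity
  refine ⟨L₁ + L₂ + L₃ + L₄, by positivity, fun θ => ?_⟩
  -- The reciprocal is chosen for every `ψ`, with the irrelevant value `0` off the admissible set,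
  -- so that `D` is a total function.
  have hchoice : ∀ ψ : H2 Ω, ∃ A : H2 Ω, ψ ∈ gapStates Ω δ M θ →
      (H2.fn A =ᵐ[volume.restrict Ω] fun x => (H2.fn ψ x + θ)⁻¹) ∧ ‖A‖ ≤ R := fun ψ => by
    by_cases hψ : ψ ∈ gapStates Ω δ M θ
    · obtain ⟨A, hA⟩ := hinv θ ψ hψ
      exact ⟨A, fun _ => hA⟩
    · exact ⟨0, fun h' => absurd h' hψ⟩
  choose A hA using hchoice
  let D₀ : H2 Ω → H2 Ω := fun ψ => (2 * βF) • h.mulH2 (A ψ) (h.mulH2 (A ψ) (A ψ))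
  have hD₀ : ∀ ψ ∈ gapStates Ω δ M θ, H2.fn (D₀ ψ) =ᵐ[volume.restrict Ω]
      fun x => 2 * βF / (H2.fn ψ x + θ) ^ 3 := fun ψ hψ => by
    filter_upwards [(hA ψ hψ).1, h.fn_mulH2 (A ψ) (A ψ),
      h.fn_mulH2 (A ψ) (h.mulH2 (A ψ) (A ψ)),
      H2.fn_smul (2 * βF) (h.mulH2 (A ψ) (h.mulH2 (A ψ) (A ψ)))] with x h1 h2 h3 h4
    rw [h4, h3, h2, h1, div_eq_mul_inv, pow_succ, sq, mul_inv, mul_inv]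
    ring
  have hne : ∀ ψ ∈ gapStates Ω δ M θ, ∀ᵐ x ∂volume.restrict Ω, H2.fn ψ x + θ ≠ 0 := fun ψ hψ => by
    filter_upwards [hψ.1] with x hx using (hδ.trans_le hx).ne'
  have hAA : ∀ ψ₁ ∈ gapStates Ω δ M θ, ∀ ψ₂ ∈ gapStates Ω δ M θ,
      ‖h.mulH2 (A ψ₁) (A ψ₂)‖ ≤ K * R * R := fun ψ₁ h1 ψ₂ h2 =>
    h.norm_mulH2_le_of_le (hA ψ₁ h1).2 (hA ψ₂ h2).2
  refine ⟨fun ψ => h.mulL (D₀ ψ), fun ψ hψ => ⟨?_, fun q hq => h.mulH2_mem_Ho2 _ hq, fun q => ?_⟩,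
    fun ψ₁ h1 ψ₂ h2 => ?_, fun βp θ₁ => ⟨fun ψ₁ h1 ψ₂ h2 => ?_, fun ψ hψ q hψq => ?_⟩⟩
  · refine (h.norm_mulL_le _).trans (le_trans ?_ (by linarith : L₁ ≤ _))
    refine mul_le_mul_of_nonneg_left ?_ hK.le
    rw [norm_smul, Real.norm_of_nonneg (by positivity)]
    gcongr
    exact h.norm_mulH2_le_of_le (hA ψ hψ).2 (hAA ψ hψ ψ hψ)
  · rw [h.mulL_apply]
    filter_upwards [h.fn_mulH2 (D₀ ψ) q, hD₀ ψ hψ] with x e1 e2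
    rw [e1, e2]
  · rw [← map_sub]
    refine (h.norm_mulL_le _).trans (le_trans ?_
      (mul_le_mul_of_nonneg_right (by linarith : L₃ ≤ _) (norm_nonneg _)))
    set S : H2 Ω := h.mulH2 (A ψ₁) (A ψ₁) + (h.mulH2 (A ψ₁) (A ψ₂) + h.mulH2 (A ψ₂) (A ψ₂))
    have hS : ‖S‖ ≤ K * R * R + (K * R * R + K * R * R) :=
      (norm_add_le _ _).trans (add_le_add (hAA _ h1 _ h1)
        ((norm_add_le _ _).trans (add_le_add (hAA _ h1 _ h2) (hAA _ h2 _ h2))))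
    -- With `a` and `b` the two reciprocals, `a³ - b³ = (a - b)(a² + ab + b²)` and `a - b = -ab(ψ₁ -
    -- ψ₂)`.
    have e : D₀ ψ₁ - D₀ ψ₂ =
        (-(2 * βF)) • h.mulH2 (h.mulH2 (A ψ₁) (A ψ₂)) (h.mulH2 S (ψ₁ - ψ₂)) := by
      refine H2_ext h.isOpen ?_
      filter_upwards [hne ψ₁ h1, hne ψ₂ h2, H2.fn_sub (D₀ ψ₁) (D₀ ψ₂), hD₀ ψ₁ h1, hD₀ ψ₂ h2,
        H2.fn_smul (-(2 * βF)) (h.mulH2 (h.mulH2 (A ψ₁) (A ψ₂)) (h.mulH2 S (ψ₁ - ψ₂))),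
        h.fn_mulH2 (h.mulH2 (A ψ₁) (A ψ₂)) (h.mulH2 S (ψ₁ - ψ₂)), h.fn_mulH2 (A ψ₁) (A ψ₂),
        h.fn_mulH2 S (ψ₁ - ψ₂), H2.fn_sub ψ₁ ψ₂,
        H2.fn_add (h.mulH2 (A ψ₁) (A ψ₁)) (h.mulH2 (A ψ₁) (A ψ₂) + h.mulH2 (A ψ₂) (A ψ₂)),
        H2.fn_add (h.mulH2 (A ψ₁) (A ψ₂)) (h.mulH2 (A ψ₂) (A ψ₂)), h.fn_mulH2 (A ψ₁) (A ψ₁),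
        h.fn_mulH2 (A ψ₂) (A ψ₂), (hA ψ₁ h1).1, (hA ψ₂ h2).1]
        with x n1 n2 a1 a2 a3 a4 a5 a6 a7 a8 a9 a10 a11 a12 a13 a14
      rw [a1, a2, a3, a4, a5, a6, a7, a8, a9, a10, a11, a12, a6, a13, a14]
      field_simp
      ring
    rw [e, norm_smul, norm_neg, Real.norm_of_nonneg (by positivity)]
    have := h.norm_mulH2_le_of_le (hAA ψ₁ h1 ψ₂ h2)
      (h.norm_mulH2_le_of_le hS (le_refl ‖ψ₁ - ψ₂‖))
    calc K * (2 * βF * ‖h.mulH2 (h.mulH2 (A ψ₁) (A ψ₂)) (h.mulH2 S (ψ₁ - ψ₂))‖)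
        ≤ K * (2 * βF * (K * (K * R * R) * (K * (K * R * R + (K * R * R + K * R * R)) *
          ‖ψ₁ - ψ₂‖))) := by gcongr
      _ = L₃ * ‖ψ₁ - ψ₂‖ := by ring
  · refine le_trans ?_ (mul_le_mul_of_nonneg_right (by linarith : L₂ ≤ _) (norm_nonneg _))
    -- Here `a² - b² = -ab(a + b)(ψ₁ - ψ₂)`; the constant term of `G` cancels.
    have e : gapForce Ω βF βp θ₁ θ ψ₁ - gapForce Ω βF βp θ₁ θ ψ₂ =
        βF • h.mulH2 (h.mulH2 (A ψ₁) (A ψ₂)) (h.mulH2 (A ψ₁ + A ψ₂) (ψ₁ - ψ₂)) := by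
      refine H2_ext h.isOpen ?_
      filter_upwards [hne ψ₁ h1, hne ψ₂ h2,
        H2.fn_sub (gapForce Ω βF βp θ₁ θ ψ₁) (gapForce Ω βF βp θ₁ θ ψ₂),
        h.fn_gapForce hδ βF βp θ₁ h1, h.fn_gapForce hδ βF βp θ₁ h2,
        H2.fn_smul βF (h.mulH2 (h.mulH2 (A ψ₁) (A ψ₂)) (h.mulH2 (A ψ₁ + A ψ₂) (ψ₁ - ψ₂))),
        h.fn_mulH2 (h.mulH2 (A ψ₁) (A ψ₂)) (h.mulH2 (A ψ₁ + A ψ₂) (ψ₁ - ψ₂)),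
        h.fn_mulH2 (A ψ₁) (A ψ₂), h.fn_mulH2 (A ψ₁ + A ψ₂) (ψ₁ - ψ₂), H2.fn_sub ψ₁ ψ₂,
        H2.fn_add (A ψ₁) (A ψ₂), (hA ψ₁ h1).1, (hA ψ₂ h2).1]
        with x n1 n2 a1 a2 a3 a4 a5 a6 a7 a8 a9 a13 a14
      rw [a1, a2, a3, a4, a5, a6, a7, a8, a9, a13, a14]
      field_simp
      ring
    rw [e, norm_smul, Real.norm_of_nonneg hβ.le]
    have := h.norm_mulH2_le_of_le (hAA ψ₁ h1 ψ₂ h2) (h.norm_mulH2_le_of_le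
      ((norm_add_le _ _).trans (add_le_add (hA ψ₁ h1).2 (hA ψ₂ h2).2)) (le_refl ‖ψ₁ - ψ₂‖))
    calc βF * ‖h.mulH2 (h.mulH2 (A ψ₁) (A ψ₂)) (h.mulH2 (A ψ₁ + A ψ₂) (ψ₁ - ψ₂))‖
        ≤ βF * (K * (K * R * R) * (K * (R + R) * ‖ψ₁ - ψ₂‖)) := by gcongr
      _ = L₂ * ‖ψ₁ - ψ₂‖ := by ring
  · refine le_trans ?_ (mul_le_mul_of_nonneg_right (by linarith : L₄ ≤ _) (sq_nonneg _))
    set a := A ψ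
    set b := A (ψ + q)
    set m := h.mulH2 (h.mulH2 a a) b
    set s := b + (a + a)
    -- From `b - a = -abq` follows `b² - a² + 2a³q = a²b(b + 2a)q²`, so the remainder is quadratic
    -- in `q`.
    have e : gapForce Ω βF βp θ₁ θ (ψ + q) - gapForce Ω βF βp θ₁ θ ψ - h.mulL (D₀ ψ) q =
        (-βF) • h.mulH2 m (h.mulH2 s (h.mulH2 q q)) := by
      rw [h.mulL_apply]
      refine H2_ext h.isOpen ?_
      filter_upwards [hne ψ hψ, hne _ hψq,
        H2.fn_sub (gapForce Ω βF βp θ₁ θ (ψ + q) - gapForce Ω βF βp θ₁ θ ψ) (h.mulH2 (D₀ ψ) q),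
        H2.fn_sub (gapForce Ω βF βp θ₁ θ (ψ + q)) (gapForce Ω βF βp θ₁ θ ψ),
        h.fn_gapForce hδ βF βp θ₁ hψ, h.fn_gapForce hδ βF βp θ₁ hψq,
        h.fn_mulH2 (D₀ ψ) q, hD₀ ψ hψ, H2.fn_smul (-βF) (h.mulH2 m (h.mulH2 s (h.mulH2 q q))),
        h.fn_mulH2 m (h.mulH2 s (h.mulH2 q q)), h.fn_mulH2 (h.mulH2 a a) b, h.fn_mulH2 a a,
        h.fn_mulH2 s (h.mulH2 q q), h.fn_mulH2 q q, H2.fn_add b (a + a), H2.fn_add a a,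
        (hA ψ hψ).1, (hA _ hψq).1, H2.fn_add ψ q]
        with x n1 n2 a1 a2 a3 a4 a5 a6 a7 a8 a9 a10 a11 a12 a13 a14 a15 a16 a17
      rw [a17] at n2
      rw [a1, a2, a3, a4, a5, a6, a7, a8, a9, a10, a11, a12, a13, a14, a15, a16, a17]
      field_simp
      ring
    rw [e, norm_smul, norm_neg, Real.norm_of_nonneg hβ.le]
    have hm : ‖m‖ ≤ K * (K * R * R) * R := h.norm_mulH2_le_of_le (hAA ψ hψ ψ hψ) (hA _ hψq).2
    have hs : ‖s‖ ≤ R + (R + R) := (norm_add_le _ _).trans (add_le_add (hA _ hψq).2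
      ((norm_add_le _ _).trans (add_le_add (hA ψ hψ).2 (hA ψ hψ).2)))
    have := h.norm_mulH2_le_of_le hm (h.norm_mulH2_le_of_le hs (h.norm_mulH2_le q q))
    calc βF * ‖h.mulH2 m (h.mulH2 s (h.mulH2 q q))‖
        ≤ βF * (K * (K * (K * R * R) * R) * (K * (R + (R + R)) * (K * ‖q‖ * ‖q‖))) := by gcongr
      _ = L₄ * ‖q‖ ^ 2 := by ring

end GapForce

/-! ### Superposition operators on continuous paths -/

section Paths

variable {n : ℕ} {Ω : Set (Euc n)} {C : ℝ}

theorem hasFDerivAt_of_norm_sub_le_sq {E F : Type*} [NormedAddCommGroup E] [NormedSpace ℝ E]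
    [NormedAddCommGroup F] [NormedSpace ℝ F] {f : E → F} {f' : E →L[ℝ] F} {x : E} {c ρ : ℝ}
    (hρ : 0 < ρ) (h : ∀ q, ‖q‖ < ρ → ‖f (x + q) - f x - f' q‖ ≤ c * ‖q‖ ^ 2) :
    HasFDerivAt f f' x := by
  rw [hasFDerivAt_iff_isLittleO_nhds_zero]
  refine Asymptotics.IsBigO.trans_isLittleO (g := fun q : E => ‖q‖ ^ 2)
    (Asymptotics.IsBigO.of_bound c ?_) (Asymptotics.isLittleO_norm_pow_id one_lt_two)
  filter_upwards [Metric.ball_mem_nhds (0 : E) hρ] with q hq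
  rw [Real.norm_of_nonneg (sq_nonneg ‖q‖)]
  exact h q (by simpa using hq)

theorem mulOperator_spec {m : Euc n → ℝ} {A : Ho2 Ω →L[ℝ] Ho2 Ω}
    (hA : ∀ q : Ho2 Ω, H2.fn (A q : H2 Ω) =ᵐ[volume.restrict Ω]
      fun x => m x * H2.fn (q : H2 Ω) x) (q : Ho2 Ω) :
    H2.fn (mulOperator Ω m q : H2 Ω) =ᵐ[volume.restrict Ω] fun x => m x * H2.fn (q : H2 Ω) x := by
  have hex : ∃ A : Ho2 Ω →L[ℝ] Ho2 Ω, ∀ q : Ho2 Ω,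
      H2.fn (A q : H2 Ω) =ᵐ[volume.restrict Ω] fun x => m x * H2.fn (q : H2 Ω) x := ⟨A, hA⟩
  rw [mulOperator, dif_pos hex]
  exact hex.choose_spec q

theorem pathLift_apply {X : Type} [TopologicalSpace X] [Zero X] {T : ℝ} {F : X → X}
    {w : C(Icc (0 : ℝ) T, X)} (h : Continuous fun t => F (w t)) (t : Icc (0 : ℝ) T) :
    pathLift T F w t = F (w t) := by
  rw [pathLift, dif_pos h]; rfl

/-- On `H²ₒ(Ω)`, the operator `G'(ψ)` agrees with a given multiplication operator on `H²(Ω)`. -/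
theorem coe_gapForceDeriv_apply (hΩ : IsOpen Ω) {βF θ : ℝ} {ψ : H2 Ω} {D : H2 Ω →L[ℝ] H2 Ω}
    (hDo : ∀ q, q ∈ Ho2 Ω → D q ∈ Ho2 Ω)
    (hD : ∀ q, H2.fn (D q) =ᵐ[volume.restrict Ω]
      fun x => 2 * βF / (H2.fn ψ x + θ) ^ 3 * H2.fn q x) (q : Ho2 Ω) :
    (gapForceDeriv Ω βF θ ψ q : H2 Ω) = D q := by
  have hA := mulOperator_spec (A := (D.comp (Ho2 Ω).subtypeL).codRestrict (Ho2 Ω)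
    fun q => hDo q q.2) (fun q => hD q) q
  exact H2_ext hΩ (hA.trans (hD q).symm)

/-- The operator on paths which acts at time `t` by the bounded operator `D t`. -/
noncomputable def pathOperator {X : Type*} [NormedAddCommGroup X] [NormedSpace ℝ X] {T : ℝ}
    (D : Icc (0 : ℝ) T → X →L[ℝ] X)
    (hc : ∀ q : C(Icc (0 : ℝ) T, X), Continuous fun t => D t (q t)) (L : ℝ) (hL : 0 ≤ L)
    (hD : ∀ t, ‖D t‖ ≤ L) : C(Icc (0 : ℝ) T, X) →L[ℝ] C(Icc (0 : ℝ) T, X) :=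
  LinearMap.mkContinuous
    { toFun := fun q => ⟨fun t => D t (q t), hc q⟩
      map_add' := fun p q => by ext1 t; exact map_add (D t) _ _
      map_smul' := fun c q => by ext1 t; exact map_smul (D t) _ _ } L fun q =>
    (ContinuousMap.norm_le _ (mul_nonneg hL (norm_nonneg _))).2 fun t =>
      (D t).le_of_opNorm_le_of_le (hD t) (q.norm_coe_le_norm t)

theorem pathOperator_apply {X : Type*} [NormedAddCommGroup X] [NormedSpace ℝ X] {T : ℝ}
    {D : Icc (0 : ℝ) T → X →L[ℝ] X}
    (hc : ∀ q : C(Icc (0 : ℝ) T, X), Continuous fun t => D t (q t)) {L : ℝ} (hL : 0 ≤ L)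
    (hD : ∀ t, ‖D t‖ ≤ L) (q : C(Icc (0 : ℝ) T, X)) (t : Icc (0 : ℝ) T) :
    pathOperator D hc L hL hD q t = D t (q t) := rfl

theorem norm_pathOperator_apply_le {X : Type*} [NormedAddCommGroup X] [NormedSpace ℝ X] {T : ℝ}
    {D : Icc (0 : ℝ) T → X →L[ℝ] X}
    (hc : ∀ q : C(Icc (0 : ℝ) T, X), Continuous fun t => D t (q t)) {L : ℝ} (hL : 0 ≤ L)
    (hD : ∀ t, ‖D t‖ ≤ L) (q : C(Icc (0 : ℝ) T, X)) : ‖pathOperator D hc L hL hD q‖ ≤ L * ‖q‖ :=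
  (ContinuousMap.norm_le _ (mul_nonneg hL (norm_nonneg _))).2 fun t =>
    (D t).le_of_opNorm_le_of_le (hD t) (q.norm_coe_le_norm t)

theorem continuous_comp_of_lipschitz {X Y Z : Type*} [TopologicalSpace Z]
    [SeminormedAddCommGroup X] [SeminormedAddCommGroup Y] {F : X → Y} {S : Set X} {L : ℝ}
    (hF : ∀ x ∈ S, ∀ y ∈ S, ‖F x - F y‖ ≤ L * ‖x - y‖) {w : Z → X} (hw : Continuous w)
    (hwS : ∀ t, w t ∈ S) : Continuous fun t => F (w t) := by
  refine continuous_iff_continuousAt.2 fun t => tendsto_iff_norm_sub_tendsto_zero.2 ?_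
  have h := ((tendsto_iff_norm_sub_tendsto_zero.1 (hw.tendsto t)).const_mul L)
  rw [mul_zero] at h
  exact squeeze_zero (fun _ => norm_nonneg _) (fun s => hF _ (hwS s) _ (hwS t)) h

/-- States near a state with essential lower bound `κ` for the gap have a gap at least `κ / 2`. -/
theorem SobolevEmbedding.mem_gapStates (h : SobolevEmbedding Ω C) {κ θ r : ℝ}
    (hr : C * r ≤ κ / 2) {w₀ wt₀ : H2 Ω}
    (hw : H2.fn w₀ =ᵐ[volume.restrict Ω] fun x => H2.fn wt₀ x + θ)
    (hκ : essInf (H2.fn w₀) (volume.restrict Ω) = κ) {ψ : H2 Ω} (hψ : ‖ψ - wt₀‖ ≤ r) :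
    ψ ∈ gapStates Ω (κ / 2) (‖w₀‖ + r) θ := by
  -- The real-valued essential infimum is an a.e. lower bound only for functions bounded below; the
  -- `L^∞` embedding provides this.
  have hbdd : IsBoundedUnder (· ≥ ·) (ae (volume.restrict Ω)) (H2.fn w₀) := by
    refine ⟨-(C * ‖w₀‖), ?_⟩
    rw [eventually_map]
    filter_upwards [h.ae_abs_le w₀] with x hx using (abs_le.1 hx).1
  refine ⟨?_, w₀ + (ψ - wt₀), ?_, (norm_add_le _ _).trans (by gcongr)⟩
  · filter_upwards [ae_essInf_le hbdd, hw, h.ae_abs_le (ψ - wt₀), H2.fn_sub ψ wt₀]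
      with x h1 h2 h3 h4
    rw [hκ, h2] at h1
    rw [h4] at h3
    have h5 := (abs_le.1 (h3.trans (mul_le_mul_of_nonneg_left hψ h.nonneg))).1
    linarith
  · filter_upwards [H2.fn_add w₀ (ψ - wt₀), H2.fn_sub ψ wt₀, hw] with x h1 h2 h3
    rw [h1, h2, h3]; ring

theorem norm_segment_sub_le {X : Type*} [SeminormedAddCommGroup X] [NormedSpace ℝ X]
    {a b c : X} {r τ : ℝ} (ha : ‖a - c‖ ≤ r) (hb : ‖b - c‖ ≤ r) (h0 : 0 ≤ τ) (h1 : τ ≤ 1) :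
    ‖a + τ • (b - a) - c‖ ≤ r := by
  have e : a + τ • (b - a) - c = (1 - τ) • (a - c) + τ • (b - c) := by module
  rw [e]
  calc _ ≤ (1 - τ) * ‖a - c‖ + τ * ‖b - c‖ := by
        refine (norm_add_le _ _).trans ?_
        rw [norm_smul, norm_smul, Real.norm_of_nonneg h0, Real.norm_of_nonneg (sub_nonneg.2 h1)]
    _ ≤ (1 - τ) * r + τ * r := by
        have := sub_nonneg.2 h1
        gcongr
    _ = r := by ring

/-- Uniform continuity of a Lipschitz operator family along the segments of a path. -/
theorem tendsto_iSup_enorm_segment {X Y : Type*} [SeminormedAddCommGroup X] [NormedSpace ℝ X]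
    [SeminormedAddCommGroup Y] {T L r : ℝ} {F : X → Y} {c : X} (hL : 0 < L)
    (hF : ∀ x, ‖x - c‖ ≤ r → ∀ y, ‖y - c‖ ≤ r → ‖F x - F y‖ ≤ L * ‖x - y‖)
    (w : C(Icc (0 : ℝ) T, X)) (hw : ∀ t, ‖w t - c‖ ≤ r) :
    Tendsto (fun h : ℝ =>
      ⨆ (t : Icc (0 : ℝ) T) (s : Icc (0 : ℝ) T) (_ : t ≤ s ∧ (s : ℝ) = t + h)
        (τ : ℝ) (_ : 0 ≤ τ ∧ τ ≤ 1), ‖F (w t + τ • (w s - w t)) - F (w t)‖ₑ) (𝓝 0) (𝓝 0) := by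
  rw [ENNReal.tendsto_nhds_zero]
  intro ε hε
  obtain ⟨η, hη, hηε⟩ := ENNReal.lt_iff_exists_nnreal_btwn.1 hε
  have hη0 : (0 : ℝ) < η := by exact_mod_cast hη
  -- Uniform continuity of the path on the compact interval makes the estimate uniform in `t`.
  -- Convexity of the ball keeps the segments where `F` is Lipschitz, and `τ ≤ 1` makes it uniform
  -- in `τ`.
  obtain ⟨δ, hδ, huc⟩ := Metric.uniformContinuous_iff.1
    (CompactSpace.uniformContinuous_of_continuous w.continuous) (η / L) (by positivity)
  filter_upwards [Metric.ball_mem_nhds (0 : ℝ) hδ] with k hk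
  refine iSup_le fun t => iSup_le fun s => iSup_le fun hts => iSup_le fun τ => iSup_le fun hτ => ?_
  refine le_trans ?_ hηε.le
  have hdist : dist s t < δ := by
    rw [Subtype.dist_eq, hts.2, Real.dist_eq, add_sub_cancel_left]
    simpa using hk
  have h1 := huc hdist
  rw [dist_eq_norm, lt_div_iff₀ hL] at h1
  have h2 := hF _ (norm_segment_sub_le (hw t) (hw s) hτ.1 hτ.2) _ (hw t)
  rw [add_sub_cancel_left, norm_smul, Real.norm_of_nonneg hτ.1] at h2
  have h3 : ‖F (w t + τ • (w s - w t)) - F (w t)‖ ≤ η := by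
    refine h2.trans (le_trans ?_ h1.le)
    rw [mul_comm]
    gcongr
    exact mul_le_of_le_one_left (norm_nonneg _) hτ.2
  rw [← ofReal_norm]
  exact (ENNReal.ofReal_le_ofReal h3).trans_eq (ENNReal.ofReal_coe_nnreal)

theorem norm_le_of_coe_apply_eq {X : Type*} [NormedAddCommGroup X] [NormedSpace ℝ X]
    {Y : Submodule ℝ X} {A : Y →L[ℝ] Y} {B : X →L[ℝ] X} (h : ∀ q : Y, (A q : X) = B q) :
    ‖A‖ ≤ ‖B‖ := by
  refine ContinuousLinearMap.opNorm_le_bound _ (norm_nonneg _) fun q => ?_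
  exact (congrArg norm (h q)).trans_le (B.le_opNorm q)

theorem norm_sub_le_of_coe_apply_eq {X : Type*} [NormedAddCommGroup X] [NormedSpace ℝ X]
    {Y : Submodule ℝ X} {A A' : Y →L[ℝ] Y} {B B' : X →L[ℝ] X} (h : ∀ q : Y, (A q : X) = B q)
    (h' : ∀ q : Y, (A' q : X) = B' q) : ‖A - A'‖ ≤ ‖B - B'‖ :=
  norm_le_of_coe_apply_eq fun q => by
    rw [sub_apply, sub_apply, Submodule.coe_sub, h, h']

theorem norm_path_sub_le {X : Type*} [SeminormedAddCommGroup X] {T L : ℝ} {F : X → X} {S : Set X}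
    {P : C(Icc (0 : ℝ) T, X) → C(Icc (0 : ℝ) T, X)} (hL : 0 ≤ L)
    (hF : ∀ x ∈ S, ∀ y ∈ S, ‖F x - F y‖ ≤ L * ‖x - y‖)
    (hP : ∀ w : C(Icc (0 : ℝ) T, X), (∀ t, w t ∈ S) → ∀ t, P w t = F (w t))
    {v w : C(Icc (0 : ℝ) T, X)} (hv : ∀ t, v t ∈ S) (hw : ∀ t, w t ∈ S) :
    ‖P v - P w‖ ≤ L * ‖v - w‖ := by
  refine (ContinuousMap.norm_le _ (by positivity)).2 fun t => ?_
  rw [ContinuousMap.sub_apply, hP _ hv, hP _ hw]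
  refine (hF _ (hv t) _ (hw t)).trans ?_
  gcongr
  exact (v - w).norm_coe_le_norm t

/-- A superposition operator on paths is differentiable where `F` is uniformly differentiable, and
its derivative acts pointwise in time. -/
theorem exists_hasFDerivAt_path {X : Type*} [NormedAddCommGroup X] [NormedSpace ℝ X]
    {Y : Submodule ℝ X} {T L ρ : ℝ} {F : X → X} {S : Set X} {D : X → X →L[ℝ] X}
    {D₀ : X → Y →L[ℝ] Y} {P : C(Icc (0 : ℝ) T, X) → C(Icc (0 : ℝ) T, X)} (hL : 0 ≤ L)
    (hρ : 0 < ρ) (hDL : ∀ x ∈ S, ‖D x‖ ≤ L)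
    (hD : ∀ x ∈ S, ∀ y ∈ S, ‖D x - D y‖ ≤ L * ‖x - y‖)
    (hD₀ : ∀ x ∈ S, ∀ q : Y, (D₀ x q : X) = D x q)
    (hF : ∀ x ∈ S, ∀ q, x + q ∈ S → ‖F (x + q) - F x - D x q‖ ≤ L * ‖q‖ ^ 2)
    (hP : ∀ w : C(Icc (0 : ℝ) T, X), (∀ t, w t ∈ S) → ∀ t, P w t = F (w t))
    {w : C(Icc (0 : ℝ) T, X)} (hw : ∀ t, w t ∈ S)
    (hwρ : ∀ t, ∀ q : X, ‖q‖ < ρ → w t + q ∈ S) :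
    ∃ B : C(Icc (0 : ℝ) T, X) →L[ℝ] C(Icc (0 : ℝ) T, X), HasFDerivAt P B w ∧
      (∀ q t, B q t = D (w t) (q t)) ∧ (∀ q, ‖B q‖ ≤ L * ‖q‖) ∧
      ∃ A : C(Icc (0 : ℝ) T, Y) →L[ℝ] C(Icc (0 : ℝ) T, Y),
        (∀ q, Y.subtypeL.compLeftContinuous ℝ (Icc (0 : ℝ) T) (A q) =
          B (Y.subtypeL.compLeftContinuous ℝ (Icc (0 : ℝ) T) q)) ∧
        (∀ q t, A q t = D₀ (w t) (q t)) ∧ ∀ q, ‖A q‖ ≤ L * ‖q‖ := by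
  have hDc : Continuous fun t => D (w t) := continuous_comp_of_lipschitz hD w.continuous hw
  have hc : ∀ q : C(Icc (0 : ℝ) T, X), Continuous fun t => D (w t) (q t) := fun q =>
    hDc.clm_apply q.continuous
  have hwL : ∀ t, ‖D (w t)‖ ≤ L := fun t => hDL _ (hw t)
  -- The subspace carries the induced topology, so continuity can be checked after inclusion into
  -- `X`.
  have hco : ∀ q : C(Icc (0 : ℝ) T, Y), Continuous fun t => D₀ (w t) (q t) := fun q =>
    continuous_induced_rng.2 ((hc (Y.subtypeL.compLeftContinuous ℝ (Icc (0 : ℝ) T) q)).congr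
      fun t => (hD₀ _ (hw t) (q t)).symm)
  have hoL : ∀ t, ‖D₀ (w t)‖ ≤ L := fun t =>
    (norm_le_of_coe_apply_eq (hD₀ _ (hw t))).trans (hwL t)
  refine ⟨pathOperator (fun t => D (w t)) hc L hL hwL, ?_, fun q t => rfl,
    norm_pathOperator_apply_le hc hL hwL, pathOperator (fun t => D₀ (w t)) hco L hL hoL,
    fun q => ?_, fun q t => rfl, norm_pathOperator_apply_le hco hL hoL⟩
  · refine hasFDerivAt_of_norm_sub_le_sq (c := L) hρ fun q hq => ?_
    -- A perturbation smaller than `ρ` in the supremum norm is smaller than `ρ` at every time, so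
    -- the pointwise remainder bound holds along the whole path.
    have hwq : ∀ t, (w + q) t ∈ S := fun t => hwρ t _ ((q.norm_coe_le_norm t).trans_lt hq)
    refine (ContinuousMap.norm_le _ (by positivity)).2 fun t => ?_
    rw [ContinuousMap.sub_apply, ContinuousMap.sub_apply, hP _ hwq, hP _ hw, pathOperator_apply]
    refine (hF (w t) (hw t) (q t) (hwq t)).trans ?_
    gcongr
    exact q.norm_coe_le_norm t
  · ext1 t
    exact hD₀ _ (hw t) (q t)

/-- The Fréchet derivative at `0` along a subspace. -/
theorem hasFDerivAt_subspace {X : Type*} [NormedAddCommGroup X] [NormedSpace ℝ X]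
    {Y : Submodule ℝ X} {L ρ : ℝ} {F : X → X} {x : X} {D : X →L[ℝ] X} {D₀ : Y →L[ℝ] Y}
    (hρ : 0 < ρ) (hD₀ : ∀ q : Y, (D₀ q : X) = D q)
    (hF : ∀ q, ‖q‖ < ρ → ‖F (x + q) - F x - D q‖ ≤ L * ‖q‖ ^ 2) :
    HasFDerivAt (fun q : Y => F (x + (q : X))) (Y.subtypeL.comp D₀) 0 := by
  refine hasFDerivAt_of_norm_sub_le_sq (c := L) hρ fun q hq => ?_
  have := hF q hq
  simp only [zero_add, ZeroMemClass.coe_zero, add_zero, ContinuousLinearMap.comp_apply,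
    Submodule.subtypeL_apply, hD₀]
  exact this

end Paths

/-! ### Choice of the constants and the main theorem -/

/-- On the ball around `w₀ - θ` the gap force is differentiable, uniformly, with a Lipschitz
derivative which restricts to `H²ₒ(Ω)`. -/
theorem exists_gapForce_data {n : ℕ} (hn : n = 1 ∨ n = 2) {Ω : Set (Euc n)} (hΩo : IsOpen Ω)
    (hΩb : Bornology.IsBounded Ω) (hΩs : HasSmoothBoundary Ω) :
    ∃ C : ℝ, 0 < C ∧ ∀ βF κ M : ℝ, 0 < βF → 0 < κ → ∃ L : ℝ, 0 < L ∧
      ∀ βp θ₁ θ r : ℝ, r < κ / (2 * C) → ∀ w₀ wt₀ : H2 Ω,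
        (H2.fn w₀ =ᵐ[volume.restrict Ω] fun x => H2.fn wt₀ x + θ) →
        essInf (H2.fn w₀) (volume.restrict Ω) = κ → ‖w₀‖ = M →
        ∃ (S : Set (H2 Ω)) (D : H2 Ω → H2 Ω →L[ℝ] H2 Ω) (ρ : ℝ), 0 < ρ ∧
          (∀ ψ, ‖ψ - wt₀‖ ≤ r → ψ ∈ S) ∧
          (∀ ψ q, ‖ψ - wt₀‖ ≤ r → ‖q‖ < ρ → ψ + q ∈ S) ∧
          (∀ ψ ∈ S, (∀ᵐ x ∂volume.restrict Ω, κ / 2 ≤ H2.fn ψ x + θ) ∧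
            H2.fn (gapForce Ω βF βp θ₁ θ ψ) =ᵐ[volume.restrict Ω]
              fun x => -βF / (H2.fn ψ x + θ) ^ 2 + βp * (θ₁ - 1)) ∧
          (∀ ψ ∈ S, ∀ q, H2.fn (D ψ q) =ᵐ[volume.restrict Ω]
            fun x => 2 * βF / (H2.fn ψ x + θ) ^ 3 * H2.fn q x) ∧
          (∀ ψ ∈ S, ∀ q : Ho2 Ω, (gapForceDeriv Ω βF θ ψ q : H2 Ω) = D ψ q) ∧
          (∀ ψ ∈ S, ‖D ψ‖ ≤ L) ∧
          (∀ ψ₁ ∈ S, ∀ ψ₂ ∈ S, ‖D ψ₁ - D ψ₂‖ ≤ L * ‖ψ₁ - ψ₂‖) ∧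
          (∀ ψ₁ ∈ S, ∀ ψ₂ ∈ S,
            ‖gapForce Ω βF βp θ₁ θ ψ₁ - gapForce Ω βF βp θ₁ θ ψ₂‖ ≤ L * ‖ψ₁ - ψ₂‖) ∧
          ∀ ψ ∈ S, ∀ q, ψ + q ∈ S →
            ‖gapForce Ω βF βp θ₁ θ (ψ + q) - gapForce Ω βF βp θ₁ θ ψ - D ψ q‖ ≤ L * ‖q‖ ^ 2 := by
  obtain ⟨C₀, h⟩ := exists_sobolevEmbedding hn hΩo hΩb hΩs
  have hC₀ := h.nonneg
  -- The embedding constant is only known to be nonnegative; adding one makes division by `C`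
  -- meaningful.
  refine ⟨C₀ + 1, by positivity, fun βF κ M hβ hκ => ?_⟩
  -- The bounds are taken on the larger ball of radius `κ / (2C)`, so `L` does not depend on `r`.
  obtain ⟨L, hL, hLθ⟩ := h.exists_gapForce_bounds (half_pos hκ) hβ (M + κ / (2 * (C₀ + 1)))
  refine ⟨L, hL, fun βp θ₁ θ r hrC w₀ wt₀ hw hinf hM => ?_⟩
  obtain ⟨D, hD, hDlip, hG⟩ := hLθ θ
  have hball : ∀ ψ : H2 Ω, ‖ψ - wt₀‖ ≤ κ / (2 * (C₀ + 1)) →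
      ψ ∈ gapStates Ω (κ / 2) (M + κ / (2 * (C₀ + 1))) θ := fun ψ hψ => by
    have hle : C₀ * (κ / (2 * (C₀ + 1))) ≤ κ / 2 := by
      rw [mul_div_assoc', div_le_div_iff₀ (by positivity) two_pos]
      nlinarith
    have := h.mem_gapStates hle hw hinf hψ
    rwa [hM] at this
  -- The strict inequality `r < κ / (2C)` leaves a margin `ρ = κ / (2C) - r`. Thus `G` keeps its
  -- formula in a neighbourhood of every point of the closed `r`-ball, as differentiability
  -- requires.
  refine ⟨gapStates Ω (κ / 2) (M + κ / (2 * (C₀ + 1))) θ, D, κ / (2 * (C₀ + 1)) - r,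
    sub_pos.2 hrC, fun ψ hψ => hball ψ (hψ.trans hrC.le), fun ψ q hψ hq => hball _ ?_,
    fun ψ hψ => ⟨hψ.1, h.fn_gapForce (half_pos hκ) βF βp θ₁ hψ⟩, fun ψ hψ => (hD ψ hψ).2.2,
    fun ψ hψ => coe_gapForceDeriv_apply hΩo (hD ψ hψ).2.1 (hD ψ hψ).2.2, fun ψ hψ => (hD ψ hψ).1,
    hDlip, hG βp θ₁⟩
  rw [add_sub_right_comm]
  exact (norm_add_le _ _).trans ((add_le_add hψ hq.le).trans_eq (add_sub_cancel _ _))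

set_option maxHeartbeats 1000000 in
theorem mainTheorem9 (n : ℕ) (hn : n = 1 ∨ n = 2) (Ω : Set (EuclideanSpace ℝ (Fin n)))
    (hΩo : IsOpen Ω) (hΩb : Bornology.IsBounded Ω) (hΩs : HasSmoothBoundary Ω) :
    -- `C` depends only on `Ω`, and `L` only on `Ω`, `κ`, `M = ‖w₀‖` and `βF`
    ∃ C : ℝ, 0 < C ∧ ∀ βF κ M : ℝ, 0 < βF → 0 < κ → ∃ L : ℝ, 0 < L ∧
      ∀ βp θ₁ θ₂ T r : ℝ, 0 < βp → 0 < θ₁ → 0 < θ₂ → 0 < T → 0 < r → r < κ / (2 * C) →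
      ∀ w₀ wt₀ : H2 Ω,
        -- `wt₀` is the shifted datum `w₀ - θ₂`
        (H2.fn w₀ =ᵐ[volume.restrict Ω] fun x => H2.fn wt₀ x + θ₂) →
        essInf (H2.fn w₀) (volume.restrict Ω) = κ → ‖w₀‖ = M →
        -- on the ball in `H²(Ω)`, `G` and `G'` are given by their formulas
        (∀ ψ : H2 Ω, ‖ψ - wt₀‖ ≤ r →
          (∀ᵐ x ∂volume.restrict Ω, κ / 2 ≤ H2.fn ψ x + θ₂) ∧
          (H2.fn (gapForce Ω βF βp θ₁ θ₂ ψ) =ᵐ[volume.restrict Ω]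
            fun x => -βF / (H2.fn ψ x + θ₂) ^ 2 + βp * (θ₁ - 1)) ∧
          (∀ q : Ho2 Ω, H2.fn (gapForceDeriv Ω βF θ₂ ψ q : H2 Ω) =ᵐ[volume.restrict Ω]
            fun x => 2 * βF / (H2.fn ψ x + θ₂) ^ 3 * H2.fn (q : H2 Ω) x) ∧
          HasFDerivAt (fun q : Ho2 Ω => gapForce Ω βF βp θ₁ θ₂ (ψ + (q : H2 Ω)))
            ((Ho2 Ω).subtypeL.comp (gapForceDeriv Ω βF θ₂ ψ)) 0) ∧
        -- `G` maps `B_r` into `C([0,T]; H²(Ω))`, pointwise in time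
        (∀ w ∈ pathBall Ω T wt₀ r, ∀ t,
          pathGapForce Ω T βF βp θ₁ θ₂ w t = gapForce Ω βF βp θ₁ θ₂ (w t)) ∧
        -- Lipschitz bound for time increments
        (∀ w ∈ pathBall Ω T wt₀ r, ∀ s t,
          ‖pathGapForce Ω T βF βp θ₁ θ₂ w s - pathGapForce Ω T βF βp θ₁ θ₂ w t‖
            ≤ L * ‖w s - w t‖) ∧
        -- Lipschitz bound on `B_r` in the supremum norm
        (∀ w₁ ∈ pathBall Ω T wt₀ r, ∀ w₂ ∈ pathBall Ω T wt₀ r,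
          ‖pathGapForce Ω T βF βp θ₁ θ₂ w₁ - pathGapForce Ω T βF βp θ₁ θ₂ w₂‖
            ≤ L * ‖w₁ - w₂‖) ∧
        -- distance to `G` of the centre
        (∀ w ∈ pathBall Ω T wt₀ r,
          ‖pathGapForce Ω T βF βp θ₁ θ₂ w
            - ContinuousMap.const (Icc (0 : ℝ) T) (gapForce Ω βF βp θ₁ θ₂ wt₀)‖ ≤ L * r) ∧
        -- the Fréchet derivative `B` of `G` at `w`, and its restriction `A` to `C([0,T]; H²ₒ(Ω))`
        (∀ w ∈ pathBall Ω T wt₀ r,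
          ∃ B : C(Icc (0 : ℝ) T, H2 Ω) →L[ℝ] C(Icc (0 : ℝ) T, H2 Ω),
            HasFDerivAt (pathGapForce Ω T βF βp θ₁ θ₂) B w ∧
            (∀ q t, H2.fn (B q t) =ᵐ[volume.restrict Ω]
              fun x => 2 * βF / (H2.fn (w t) x + θ₂) ^ 3 * H2.fn (q t) x) ∧
            (∀ q, ‖B q‖ ≤ L * ‖q‖) ∧
            ∃ A : C(Icc (0 : ℝ) T, Ho2 Ω) →L[ℝ] C(Icc (0 : ℝ) T, Ho2 Ω),
              (∀ q, pathIncl Ω T (A q) = B (pathIncl Ω T q)) ∧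
              (∀ q t, A q t = gapForceDeriv Ω βF θ₂ (w t) (q t)) ∧
              ∀ q, ‖A q‖ ≤ L * ‖q‖) ∧
        -- uniform continuity of `G'` along segments of a trajectory, in the norm of `B(H²ₒ(Ω))`
        (∀ w ∈ pathBall Ω T wt₀ r,
          Tendsto (fun h : ℝ =>
            ⨆ (t : Icc (0 : ℝ) T) (s : Icc (0 : ℝ) T) (_ : t ≤ s ∧ (s : ℝ) = t + h)
              (τ : ℝ) (_ : 0 ≤ τ ∧ τ ≤ 1),
              ‖gapForceDeriv Ω βF θ₂ (w t + τ • (w s - w t)) - gapForceDeriv Ω βF θ₂ (w t)‖ₑ)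
            (𝓝 0) (𝓝 0)) := by
  refine (exists_gapForce_data hn hΩo hΩb hΩs).imp fun C => And.imp_right ?_
  refine fun h βF κ M hβ hκ => (h βF κ M hβ hκ).imp fun L hL => ⟨hL.1, ?_⟩
  intro βp θ₁ θ₂ T r _ _ _ _ hr hrC w₀ wt₀ hw hinf hM
  replace h := hL.2 βp θ₁ θ₂ r hrC w₀ wt₀ hw hinf hM
  replace hL := hL.1
  -- Lipschitz continuity of `G` on `S` makes the composed path continuous, so `pathGapForce` does
  -- not take its default value. This holds for all paths in `S`, including those slightly outside
  -- the `r`-ball.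
  have hpath : ∀ S : Set (H2 Ω), (∀ ψ₁ ∈ S, ∀ ψ₂ ∈ S,
      ‖gapForce Ω βF βp θ₁ θ₂ ψ₁ - gapForce Ω βF βp θ₁ θ₂ ψ₂‖ ≤ L * ‖ψ₁ - ψ₂‖) →
      ∀ w : C(Icc (0 : ℝ) T, H2 Ω), (∀ t, w t ∈ S) → ∀ t,
      pathGapForce Ω T βF βp θ₁ θ₂ w t = gapForce Ω βF βp θ₁ θ₂ (w t) := fun S hS w hwS t =>
    pathLift_apply (continuous_comp_of_lipschitz hS w.continuous hwS) t
  refine ⟨fun ψ hψ => ?_, fun w hw => ?_, fun w hw s t => ?_, fun w₁ hw₁ w₂ hw₂ => ?_,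
    fun w hw => ?_, fun w hw => ?_, fun w hw => ?_⟩
  · obtain ⟨S, D, ρ, hρ, hS, hSadd, hG, hD, hcoe, hDL, hDlip, hGlip, hrem⟩ := h
    refine ⟨(hG ψ (hS ψ hψ)).1, (hG ψ (hS ψ hψ)).2, fun q => ?_, hasFDerivAt_subspace hρ
      (hcoe ψ (hS ψ hψ)) fun q hq => hrem ψ (hS ψ hψ) q (hSadd ψ q hψ hq)⟩
    rw [hcoe ψ (hS ψ hψ)]
    exact hD ψ (hS ψ hψ) q
  · obtain ⟨S, D, ρ, hρ, hS, hSadd, hG, hD, hcoe, hDL, hDlip, hGlip, hrem⟩ := h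
    exact hpath S hGlip w fun t => hS _ (hw t)
  · obtain ⟨S, D, ρ, hρ, hS, hSadd, hG, hD, hcoe, hDL, hDlip, hGlip, hrem⟩ := h
    have hwS : ∀ t, w t ∈ S := fun t => hS _ (hw t)
    rw [hpath S hGlip w hwS, hpath S hGlip w hwS]
    exact hGlip _ (hwS s) _ (hwS t)
  · obtain ⟨S, D, ρ, hρ, hS, hSadd, hG, hD, hcoe, hDL, hDlip, hGlip, hrem⟩ := h
    exact norm_path_sub_le hL.le hGlip (hpath S hGlip) (fun t => hS _ (hw₁ t))
      fun t => hS _ (hw₂ t)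
  · obtain ⟨S, D, ρ, hρ, hS, hSadd, hG, hD, hcoe, hDL, hDlip, hGlip, hrem⟩ := h
    have hwS : ∀ t, w t ∈ S := fun t => hS _ (hw t)
    refine (ContinuousMap.norm_le _ (by positivity)).2 fun t => ?_
    rw [ContinuousMap.sub_apply, hpath S hGlip w hwS, ContinuousMap.const_apply]
    refine (hGlip _ (hwS t) _ (hS wt₀ (by simpa using hr.le))).trans ?_
    gcongr
    exact hw t
  · obtain ⟨S, D, ρ, hρ, hS, hSadd, -, hD, hcoe, hDL, hDlip, hGlip, hrem⟩ := h
    have hwS : ∀ t, w t ∈ S := fun t => hS _ (hw t)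
    obtain ⟨B, hB, hBD, hBL, A, hA⟩ := exists_hasFDerivAt_path hL.le hρ hDL hDlip hcoe hrem
      (hpath S hGlip) hwS fun t q => hSadd _ q (hw t)
    exact ⟨B, hB, fun q t => hBD q t ▸ hD _ (hwS t) (q t), hBL, A, hA⟩
  -- The operator norm on `H²ₒ` of a difference of restrictions is at most that of the difference on
  -- `H²`, so `G'` inherits the Lipschitz bound of `D`.
  · have hlip : ∀ x, ‖x - wt₀‖ ≤ r → ∀ y, ‖y - wt₀‖ ≤ r →
        ‖gapForceDeriv Ω βF θ₂ x - gapForceDeriv Ω βF θ₂ y‖ ≤ L * ‖x - y‖ := by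
      obtain ⟨S, D, ρ, hρ, hS, hSadd, hG, hD, hcoe, hDL, hDlip, hGlip, hrem⟩ := h
      exact fun x hx y hy => (norm_sub_le_of_coe_apply_eq (hcoe x (hS x hx))
        (hcoe y (hS y hy))).trans (hDlip x (hS x hx) y (hS y hy))
    exact tendsto_iSup_enorm_segment (F := gapForceDeriv Ω βF θ₂) (c := wt₀) (r := r) hL hlip w hw
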